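/- **Setting.** Let $\hbar,m_e>0$, $\theta_1,\theta_2\in[0,2\pi)$ and $\eta(\mathbf x)=t^2-s^2$ for $\mathbf x=(t,s)\in\mathbb R^{1,1}$. Let $\mathcal M=(\mathbb R^{1,1})^3$ with points $(\mathbf x_{ph},\mathbf x_{e_1},\mathbf x_{e_2})$, $\mathbf x_j=(t_j,s_j)$, and $$\mathcal S=\{\eta(\mathbf x_{ph}-\mathbf x_{e_1})<0,\ \eta(\mathbf x_{ph}-\mathbf x_{e_2})<0\},\qquad \mathcal S_1=\{p\in\mathcal S: s_{e_1}<s_{ph}<s_{e_2}\},$$ $$\mathcal C_i=\{p\in\partial\mathcal S:\mathbf x_{e_i}=\mathbf x_{ph}\}\ (i=1,2),\qquad \mathcal I=\{p\in\overline{\mathcal S}: t_{ph}=t_{e_1}=t_{e_2}=0\}\cong\mathbb R^3 .$$ A wave function $\Psi=(\psi_{\varsigma_0\varsigma_1\varsigma_2})$, $\varsigma_j\in\{-,+\}$ (photon, first, second electron), takes values in $\mathbb C^8$. With $\gamma^0=\begin{pmatrix}0&1\\1&0\end{pmatrix}$, $\gamma^1=\begin{pmatrix}0&-1\\1&0\end{pmatrix}$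 in the basis $(e_-,e_+)$, let $\gamma_j^\mu$ act on the index $\varsigma_j$ and $D_j=\gamma_j^\mu\partial_{x_j^\mu}$; each component of $D_j\Psi$ is a single null derivative $(\partial_{t_j}-\partial_{s_j})\psi_{\dots+\dots}$ or $(\partial_{t_j}+\partial_{s_j})\psi_{\dots-\dots}$, and is understood as a directional derivative. **Initial data.** A function $\mathring\Psi:\mathcal I\to\mathbb C^8$ is called admissible if it vanishes outside the closed half-space $\mathcal I\cap\overline{\mathcal S_1}$, is $C^1$ on it (up to its boundary), has compact support, and satisfies $\mathring\psi_{-+\varsigma_2}=e^{i\theta_1}\mathring\psi_{+-\varsigma_2}$ on $\mathcal I\cap\mathcal C_1$ and $\mathring\psi_{+\varsigma_1-}=e^{i\theta_2}\mathring\psi_{-\varsigma_1+}$ on $\mathcal I\cap\mathcal C_2$ for all $\varsigma_1,\varsigma_2$. **Solutions.** A (global-in-time) solution with data $\mathring\Psi$ is a function $\Psi:\mathcal M\to\mathbb C^8$ that vanishes outside $\overline{\mathcal S_1}$, is continuous on $\overline{\mathcal S_1}$, has at every point of $\mathcal S_1$ all the null derivatives above, and satisfies $$\left\{\begin{array}{ll}-i\hbar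 D_{ph}\Psi=0,\quad -i\hbar D_{e_1}\Psi+m_e\Psi=0,\quad -i\hbar D_{e_2}\Psi+m_e\Psi=0&\text{in }\mathcal S_1,\\ \Psi=\mathring\Psi&\text{on }\mathcal I,\\ \psi_{-+\varsigma_2}=e^{i\theta_1}\psi_{+-\varsigma_2}&\text{on }\mathcal C_1,\\ \psi_{+\varsigma_1-}=e^{i\theta_2}\psi_{-\varsigma_1+}&\text{on }\mathcal C_2.\end{array}\right.$$ For $T\in\mathbb R$ put $\overline{\mathcal S_1}^T=\{p\in\overline{\mathcal S_1}:|t_{ph}|,|t_{e_1}|,|t_{e_2}|\le T\}$. **Theorem.** 1. For every admissible $\mathring\Psi$ there is exactly one solution $\Psi$. It has bounded derivatives on bounded time intervals: for every $T$ it is Lipschitz on $\overline{\mathcal S_1}^T$. In particular $\Psi$ is differentiable at almost every point of $\mathcal S_1$ (where $D_j\Psi$ is formed with the ordinary partial derivatives). 2. The solution depends continuously on the data: for every $T$ there is a constant $C$ such that, for all admissible $\mathring\Psi,\mathring\Phi$ with solutions $\Psi,\Phi$ and all $\delta\ge0$, if $|\mathring\Psi-\mathring\Phi|\le\delta$ on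 $\mathcal I\cap\overline{\mathcal S_1}$, then $|\Psi-\Phi|\le C\delta$ on $\overline{\mathcal S_1}^T$; and if moreover the derivative of $\mathring\Psi-\mathring\Phi$ is bounded by $\delta$ on $\mathcal I\cap\overline{\mathcal S_1}$, then $\Psi-\Phi$ is Lipschitz on $\overline{\mathcal S_1}^T$ with constant $C\delta$. (Norms are maximum norms.) -/

import Mathlib

open Set MeasureTheory
open scoped NNReal

noncomputable section

namespace ThreeBody

/-- The configuration space-time `ℝ^{1,1}_ph × ℝ^{1,1}_{e₁} × ℝ^{1,1}_{e₂}`. Particle `0` is the photon,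
particles `1` and `2` are the electrons; `p j 0` is the time `t_j` and `p j 1` the position `s_j`. -/
abbrev Config : Type := Fin 3 → Fin 2 → ℝ

/-- Positions `(s_ph, s_{e₁}, s_{e₂})` of the three particles at time zero. -/
abbrev Positions : Type := Fin 3 → ℝ

/-- Spin indices `(ς₀, ς₁, ς₂)`, in the order photon, first electron, second electron;
`0 : Fin 2` is the sign `-` and `1 : Fin 2` is the sign `+`. -/
abbrev SpinIndex : Type := Fin 3 → Fin 2

/-- The values `(ψ_{ς₀ς₁ς₂})` of a wave function, that is `ℂ⁸`. -/
abbrev Spinor : Type := SpinIndex → ℂ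

/-- The Minkowski quadratic form `η(x, x)` on `ℝ^{1,1}`. -/
def eta (x : Fin 2 → ℝ) : ℝ := x 0 ^ 2 - x 1 ^ 2

/-- The set `𝓢` of space-like configurations. -/
def spaceLike : Set Config := {p | eta (p 0 - p 1) < 0 ∧ eta (p 0 - p 2) < 0}

/-- The set `𝓢₁`: the photon is between the first and the second electron. -/
def S1 : Set Config := {p | p ∈ spaceLike ∧ p 1 1 < p 0 1 ∧ p 0 1 < p 2 1}

/-- The coincidence set `𝓒₁` of the photon and the first electron. -/
def C1 : Set Config := {p | p ∈ frontier spaceLike ∧ p 1 1 = p 0 1 ∧ p 1 0 = p 0 0}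

/-- The coincidence set `𝓒₂` of the photon and the second electron. -/
def C2 : Set Config := {p | p ∈ frontier spaceLike ∧ p 2 1 = p 0 1 ∧ p 2 0 = p 0 0}

/-- The configuration with all times equal to `0` and with positions `s`. -/
def atTimeZero (s : Positions) : Config := fun j => ![0, s j]

/-- The initial surface `𝓘`, described by positions. -/
def initialSurface : Set Positions := {s | atTimeZero s ∈ closure spaceLike}

/-- The half-space `𝓘 ∩ closure 𝓢₁`, described by positions. -/
def halfSpace : Set Positions := {s | s ∈ initialSurface ∧ atTimeZero s ∈ closure S1}

/-- The configurations whose three times all lie in `[-T, T]`. -/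
def timeSlab (T : ℝ) : Set Config := {p | ∀ j, |p j 0| ≤ T}

/-- The gamma matrices `γ⁰, γ¹`, in the basis `e₋, e₊`. -/
def gamma : Fin 2 → Matrix (Fin 2) (Fin 2) ℝ := ![!![0, 1; 1, 0], !![0, -1; 1, 0]]

/-- The component `ψ_ς` of `Ψ`. -/
def comp (Ψ : Config → Spinor) (ς : SpinIndex) : Config → ℂ := fun p => Ψ p ς

/-- The vector `∑ μ, γ^μ_{ab} ∂_{x_j^μ}`: it vanishes for `a = b` and is one of the null vectors
`∂_t ± ∂_s` of particle `j` otherwise. -/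
def gammaDir (j : Fin 3) (a b : Fin 2) : Config := Pi.single j (fun μ => gamma μ a b)

/-- The operator `D_j = γ_j^μ ∂_{x_j^μ}`, with `γ_j` acting on the `j`-th tensor factor:
`(D_j Ψ)_ς = ∑ b, (∑ μ, γ^μ_{ς_j b} ∂_{x_j^μ}) ψ_{ς with ς_j replaced by b}`. The first order operator
in parentheses is taken as one directional derivative, which needs less than both partial derivatives;
see `dirac_eq` for its value in terms of these. For the photon, `γ^μ` multiplies the matrix with
first row `(0, χ₋)` and second row `(χ₊, 0)` from the left, so it acts on the column index
`χ₋, χ₊` as it does on `e₋, e₊`. -/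
def dirac (j : Fin 3) (Ψ : Config → Spinor) (p : Config) : Spinor := fun ς =>
  ∑ b, lineDeriv ℝ (comp Ψ (Function.update ς j b)) p (gammaDir j (ς j) b)

/-- All directional derivatives in `dirac j Ψ p` exist. -/
def DiracDifferentiableAt (j : Fin 3) (Ψ : Config → Spinor) (p : Config) : Prop :=
  ∀ (ς : SpinIndex) (b : Fin 2),
    LineDifferentiableAt ℝ (comp Ψ (Function.update ς j b)) p (gammaDir j (ς j) b)

/-- The coordinate vector field `∂_{x_j^μ}`. -/
def coordVec (j : Fin 3) (μ : Fin 2) : Config := Pi.single j (Pi.single μ 1)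

/-- Where `Ψ` is differentiable, `dirac j Ψ` is `γ_j^μ ∂_{x_j^μ} Ψ` with the usual partial
derivatives. -/
theorem dirac_eq (j : Fin 3) (Ψ : Config → Spinor) (p : Config) (h : DifferentiableAt ℝ Ψ p)
    (ς : SpinIndex) :
    dirac j Ψ p ς = ∑ μ, ∑ b, (gamma μ (ς j) b : ℂ) *
      fderiv ℝ Ψ p (coordVec j μ) (Function.update ς j b) := by
  have hc : ∀ τ, HasFDerivAt (comp Ψ τ)
      ((ContinuousLinearMap.proj τ).comp (fderiv ℝ Ψ p)) p := fun τ =>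
    (hasFDerivAt_pi'.1 h.hasFDerivAt) τ
  have hd : ∀ a b, gammaDir j a b = ∑ μ, gamma μ a b • coordVec j μ := by
    intro a b
    ext i μ
    by_cases hi : i = j
    · subst hi
      fin_cases μ <;> simp [gammaDir, coordVec]
    · simp [gammaDir, coordVec, Pi.single_eq_of_ne hi]
  rw [Finset.sum_comm]
  unfold dirac
  refine Finset.sum_congr rfl fun b _ => ?_
  rw [(hc _).differentiableAt.lineDeriv_eq_fderiv, (hc _).fderiv, hd]
  simp

/-- The masses of the three particles. -/
def mass (m : ℝ) : Fin 3 → ℝ := ![0, m, m]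

/-- The contact boundary conditions at a configuration `p` for the value `v` of a wave function there:
`ψ_{-+ς₂} = e^{iθ₁} ψ_{+-ς₂}` on `𝓒₁` and `ψ_{+ς₁-} = e^{iθ₂} ψ_{-ς₁+}` on `𝓒₂`. -/
def BoundaryCondition (θ₁ θ₂ : ℝ) (p : Config) (v : Spinor) : Prop :=
  (p ∈ C1 → ∀ ς₂ : Fin 2, v ![0, 1, ς₂] = Complex.exp (Complex.I * θ₁) * v ![1, 0, ς₂]) ∧
  (p ∈ C2 → ∀ ς₁ : Fin 2, v ![1, ς₁, 0] = Complex.exp (Complex.I * θ₂) * v ![0, ς₁, 1])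

/-- Initial data: `C¹` on the closed half-space (up to its boundary), compactly supported in it, and
satisfying the boundary conditions. The function is zero outside the half-space. -/
structure IsInitialData (θ₁ θ₂ : ℝ) (Ψ₀ : Positions → Spinor) : Prop where
  contDiffOn : ContDiffOn ℝ 1 Ψ₀ halfSpace
  hasCompactSupport : HasCompactSupport Ψ₀
  support_subset : Function.support Ψ₀ ⊆ halfSpace
  boundary : ∀ s, BoundaryCondition θ₁ θ₂ (atTimeZero s) (Ψ₀ s)

/-- Solutions of the initial-boundary value problem that are supported in the closure of `𝓢₁` and
continuous there. -/
structure IsSolution (ħ m θ₁ θ₂ : ℝ) (Ψ₀ : Positions → Spinor) (Ψ : Config → Spinor) : Prop where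
  support_subset : Function.support Ψ ⊆ closure S1
  continuousOn : ContinuousOn Ψ (closure S1)
  differentiable : ∀ p ∈ S1, ∀ j, DiracDifferentiableAt j Ψ p
  equation : ∀ p ∈ S1, ∀ j,
    (-Complex.I * (ħ : ℂ)) • dirac j Ψ p + (mass m j : ℂ) • Ψ p = 0
  initial : ∀ s ∈ initialSurface, Ψ (atTimeZero s) = Ψ₀ s
  boundary : ∀ p, BoundaryCondition θ₁ θ₂ p (Ψ p)

end ThreeBody

end

open ThreeBody

/-!
The Dirac equations say that every component of `Ψ` is transported along light rays of each of the
three particles, with a source proportional to the component with that particle's spin flipped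
(`NullEquations`). A component is therefore labelled by the three rays which carry it; for the massless
photon there is no source, and its time drops out. What is left is a function of three ray labels and
of the two electron times. The electrons always stay on different sides of the photon, so that the order
of the rays is fixed, except that rays of opposite velocity may cross.

*The boundary conditions.* Call a triple of rays uniform if they have the same velocity, and mixed if two
have one velocity and the third has the opposite one. For given majority velocity there is one uniform
component and there are three mixed ones, according to the particle on the exceptional ray. When the
photon meets an electron, the contact conditions relate two of the mixed components. They say
precisely that the three mixed components, divided by the unimodular factors `phase`, fit together to
one function which is continuous across the crossings. So the problem has just one uniform and one mixed
amplitude for each majority velocity (`Amp`), and no boundary condition is left. The Dirac equations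
of the electrons become a linear system of two evolutions of these amplitudes, in the two electron times,
with constant coefficients which switch at the crossings (`Coeffs.Solves`).

*Existence.* The two evolutions commute: this is the algebraic condition `Coeffs.comm_uniform` and its
companions, which holds for the coefficients `waveCoeffs` of the Dirac equations. Hence the Picard step,
the integral of the right hand side along a path of space-like pairs of times, satisfies the equations
in both times (`Coeffs.Solves.step`). In sup norms and Lipschitz norms with an exponential weight in the
times the iterates decay geometrically (`Amp.Bound.iterate`, `Amp.Lip.iterate`). Therefore the Picard
series, started with the data (`dataAmp`), is a locally Lipschitz solution of the system, and the wave
function formed from it solves the original problem, with bounds that are linear in those of the data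
(`exists_isSolution`). The null derivatives exist although the amplitudes are only Lipschitz, because
the coefficients switch only on crossings, which are outside `𝓢₁`.

*Uniqueness.* For a solution that is merely continuous up to the boundary, the null derivatives integrate
to increments in the interior, and by continuity also at boundary points
(`NullEquations.sub_eq_integral`). So its amplitudes solve the system (`IsWave.solves_amplitude`).
They are bounded on each domain of dependence (`domain`), because it is compact. If they vanish at time
zero, then any exponentially weighted bound can be halved there, and the amplitudes are zero
(`Coeffs.Solves.eq_zero`).

By uniqueness, the difference of two solutions is the solution for the difference of the data, and
the linear bounds give the continuous dependence. Differentiability almost everywhere is Rademacher's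
theorem.
-/

namespace ThreeBody

open scoped Interval

/-! ### Integrals that switch integrand at a threshold -/

/-- `∫ σ in 0..p, (if σ ≤ s then g σ else h σ)`, written with continuous integrands only. -/
noncomputable def splitInt (s : ℝ) (g h : ℝ → ℂ) (p : ℝ) : ℂ :=
  (∫ σ in min 0 s..min p s, g σ) + ∫ σ in max 0 s..max p s, h σ

@[simp] theorem splitInt_zero (s : ℝ) (g h : ℝ → ℂ) : splitInt s g h 0 = 0 := by
  simp [splitInt]

theorem splitInt_sub_of_le {s p p' : ℝ} {g h : ℝ → ℂ} (hg : Continuous g) (hp : p ≤ s)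
    (hp' : p' ≤ s) : splitInt s g h p' - splitInt s g h p = ∫ σ in p..p', g σ := by
  simp only [splitInt, min_eq_left hp, min_eq_left hp', max_eq_right hp, max_eq_right hp']
  rw [add_sub_add_right_eq_sub, intervalIntegral.integral_interval_sub_left] <;>
    exact hg.intervalIntegrable _ _

theorem splitInt_sub_of_ge {s p p' : ℝ} {g h : ℝ → ℂ} (hh : Continuous h) (hp : s ≤ p)
    (hp' : s ≤ p') : splitInt s g h p' - splitInt s g h p = ∫ σ in p..p', h σ := by
  simp only [splitInt, max_eq_left hp, max_eq_left hp', min_eq_right hp, min_eq_right hp']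
  rw [add_sub_add_left_eq_sub, intervalIntegral.integral_interval_sub_left] <;>
    exact hh.intervalIntegrable _ _

theorem splitInt_of_le {s p : ℝ} {g h : ℝ → ℂ} (h0 : 0 ≤ s) (hp : p ≤ s) :
    splitInt s g h p = ∫ σ in 0..p, g σ := by
  simp [splitInt, h0, hp]

theorem splitInt_of_ge {s p : ℝ} {g h : ℝ → ℂ} (h0 : s ≤ 0) (hp : s ≤ p) :
    splitInt s g h p = ∫ σ in 0..p, h σ := by
  simp [splitInt, h0, hp]

theorem splitInt_self {s : ℝ} {g : ℝ → ℂ} (hg : Continuous g) (p : ℝ) :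
    splitInt s g g p = ∫ σ in 0..p, g σ := by
  have hi : ∀ a b : ℝ, IntervalIntegrable g volume a b := fun a b => hg.intervalIntegrable a b
  rcases le_total 0 s with h0 | h0 <;> rcases le_total p s with hp | hp
  · exact splitInt_of_le h0 hp
  · simp [splitInt, h0, hp, intervalIntegral.integral_add_adjacent_intervals (hi _ _) (hi _ _)]
  · simp only [splitInt, min_eq_right h0, min_eq_left hp, max_eq_left h0, max_eq_right hp]
    rw [add_comm, intervalIntegral.integral_add_adjacent_intervals (hi _ _) (hi _ _)]
  · exact splitInt_of_ge h0 hp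

/-- If both integrands have the primitive `φ` on their side of the threshold, then so does the
integral which switches between them. -/
theorem splitInt_eq_of_primitive {s p : ℝ} {g h φ : ℝ → ℂ}
    (hg : ∀ a ≤ s, ∀ b ≤ s, ∫ σ in a..b, g σ = φ b - φ a)
    (hh : ∀ a, s ≤ a → ∀ b, s ≤ b → ∫ σ in a..b, h σ = φ b - φ a) :
    splitInt s g h p = φ p - φ 0 := by
  unfold splitInt
  rw [hg _ (min_le_right _ _) _ (min_le_right _ _), hh _ (le_max_right _ _) _ (le_max_right _ _)]
  rcases le_total 0 s with h0 | h0 <;> rcases le_total p s with hp | hp <;> simp [h0, hp]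

theorem splitInt_sub_splitInt {s p : ℝ} {g h g' h' : ℝ → ℂ} (hg : Continuous g)
    (hh : Continuous h) (hg' : Continuous g') (hh' : Continuous h') :
    splitInt s g h p - splitInt s g' h' p =
      splitInt s (fun σ => g σ - g' σ) (fun σ => h σ - h' σ) p := by
  simp only [splitInt]
  rw [intervalIntegral.integral_sub (hg.intervalIntegrable _ _) (hg'.intervalIntegrable _ _),
    intervalIntegral.integral_sub (hh.intervalIntegrable _ _) (hh'.intervalIntegrable _ _)]
  ring

theorem integral_exp_mul_abs_le {l P : ℝ} (hl : 0 < l) (hP : 0 ≤ P) :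
    ∫ σ in (-P)..P, Real.exp (l * |σ|) ≤ 2 * Real.exp (l * P) / l := by
  have hc : Continuous fun σ : ℝ => Real.exp (l * |σ|) := by fun_prop
  have hi : ∀ a b : ℝ, IntervalIntegrable (fun σ : ℝ => Real.exp (l * |σ|)) volume a b :=
    fun a b => hc.intervalIntegrable a b
  have h1 : ∫ σ in (0 : ℝ)..P, Real.exp (l * |σ|) = (Real.exp (l * P) - 1) / l := by
    have h2 : ∫ σ in (0 : ℝ)..P, Real.exp (l * |σ|) = ∫ σ in (0 : ℝ)..P, Real.exp (l * σ) := by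
      refine intervalIntegral.integral_congr fun σ hσ => ?_
      rw [uIcc_of_le hP] at hσ
      rw [abs_of_nonneg hσ.1]
    rw [h2, intervalIntegral.integral_eq_sub_of_hasDerivAt (f := fun σ => Real.exp (l * σ) / l)]
    · simp only [mul_zero, Real.exp_zero]; ring
    · intro σ _
      refine (((hasDerivAt_id σ).const_mul l).exp.div_const l).congr_deriv ?_
      simp only [id, mul_one, mul_div_assoc, div_self hl.ne']
    · exact (by fun_prop : Continuous fun σ : ℝ => Real.exp (l * σ)).intervalIntegrable _ _
  have h3 : ∫ σ in (-P)..(0 : ℝ), Real.exp (l * |σ|) = ∫ σ in (0 : ℝ)..P, Real.exp (l * |σ|) := by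
    have := intervalIntegral.integral_comp_neg (a := 0) (b := P)
      (fun σ : ℝ => Real.exp (l * |σ|))
    simp only [abs_neg, neg_zero] at this
    exact this.symm
  rw [← intervalIntegral.integral_add_adjacent_intervals (hi (-P) 0) (hi 0 P), h3, h1,
    ← add_div]
  gcongr
  linarith

theorem norm_integral_le_exp {l C P a b : ℝ} {g : ℝ → ℂ} (hl : 0 < l) (hC : 0 ≤ C)
    (ha : |a| ≤ P) (hb : |b| ≤ P) (hg : ∀ σ ∈ Ι a b, ‖g σ‖ ≤ C * Real.exp (l * |σ|)) :
    ‖∫ σ in a..b, g σ‖ ≤ 2 * C / l * Real.exp (l * P) := by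
  have hP : 0 ≤ P := (abs_nonneg a).trans ha
  have hc : Continuous fun σ : ℝ => C * Real.exp (l * |σ|) := by fun_prop
  have h1 := intervalIntegral.norm_integral_le_abs_of_norm_le (f := g) (a := a) (b := b)
    (μ := volume) (ae_restrict_of_forall_mem measurableSet_uIoc hg) (hc.intervalIntegrable a b)
  refine h1.trans ?_
  have hsub : Ι a b ⊆ Ι (-P) P := by
    rw [uIoc_of_le (by linarith : -P ≤ P)]
    intro σ hσ
    rw [mem_uIoc] at hσ
    rw [abs_le] at ha hb
    constructor <;> rcases hσ with h | h <;> linarith [h.1, h.2]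
  have h2 := intervalIntegral.abs_integral_mono_interval (f := fun σ : ℝ => C * Real.exp (l * |σ|))
    (μ := volume) hsub (Filter.Eventually.of_forall fun σ => by positivity)
    (hc.intervalIntegrable _ _)
  refine h2.trans ?_
  rw [abs_of_nonneg (intervalIntegral.integral_nonneg (by linarith) fun σ _ => by positivity),
    intervalIntegral.integral_const_mul]
  calc _ ≤ C * (2 * Real.exp (l * P) / l) := by gcongr; exact integral_exp_mul_abs_le hl hP
    _ = _ := by ring

theorem norm_splitInt_le {l C s p : ℝ} {g h : ℝ → ℂ} (hl : 0 < l) (hC : 0 ≤ C)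
    (hg : ∀ σ ∈ uIcc 0 p, σ ≤ s → ‖g σ‖ ≤ C * Real.exp (l * |σ|))
    (hh : ∀ σ ∈ uIcc 0 p, s ≤ σ → ‖h σ‖ ≤ C * Real.exp (l * |σ|)) :
    ‖splitInt s g h p‖ ≤ 4 * C / l * Real.exp (l * |p|) := by
  have key : ∀ (f : ℝ → ℂ) (a b : ℝ), (a = b ∨ (a ∈ uIcc 0 p ∧ b ∈ uIcc 0 p)) →
      (∀ σ ∈ uIcc a b, σ ∈ uIcc 0 p → ‖f σ‖ ≤ C * Real.exp (l * |σ|)) →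
      ‖∫ σ in a..b, f σ‖ ≤ 2 * C / l * Real.exp (l * |p|) := by
    intro f a b hab hf
    rcases hab with rfl | ⟨ha, hb⟩
    · simp; positivity
    · have hmem : ∀ a ∈ uIcc 0 p, |a| ≤ |p| := by
        intro a ha
        simpa using abs_sub_left_of_mem_uIcc ha
      refine norm_integral_le_exp hl hC (hmem a ha) (hmem b hb) fun σ hσ => ?_
      exact hf σ (uIoc_subset_uIcc hσ) (uIcc_subset_uIcc ha hb (uIoc_subset_uIcc hσ))
  have h1 : ‖∫ σ in min 0 s..min p s, g σ‖ ≤ 2 * C / l * Real.exp (l * |p|) := by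
    refine key g _ _ ?_ fun σ hσ h => hg σ h ?_
    · simp only [mem_uIcc]
      rcases le_total 0 s with h0 | h0 <;> rcases le_total p s with h1 | h1 <;> simp [h0, h1]
      all_goals grind
    · exact hσ.2.trans (max_le (min_le_right _ _) (min_le_right _ _))
  have h2 : ‖∫ σ in max 0 s..max p s, h σ‖ ≤ 2 * C / l * Real.exp (l * |p|) := by
    refine key h _ _ ?_ fun σ hσ h => hh σ h ?_
    · simp only [mem_uIcc]
      rcases le_total 0 s with h0 | h0 <;> rcases le_total p s with h1 | h1 <;> simp [h0, h1]
      all_goals grind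
    · exact (le_min (le_max_right _ _) (le_max_right _ _)).trans hσ.1
  calc _ ≤ _ := norm_add_le _ _
    _ ≤ _ := add_le_add h1 h2
    _ = _ := by ring

/-- The threshold enters only through its projection to the range of integration. -/
theorem splitInt_eq_add {s p : ℝ} {g h : ℝ → ℂ} (hg : Continuous g) (hh : Continuous h) :
    splitInt s g h p = (∫ σ in 0..p, h σ) +
      (∫ σ in (min 0 p)..max (min 0 p) (min s (max 0 p)), (g σ - h σ)) * (if 0 ≤ p then 1 else -1) := by
  have hi : ∀ a b : ℝ, IntervalIntegrable g volume a b := fun a b => hg.intervalIntegrable a b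
  have hj : ∀ a b : ℝ, IntervalIntegrable h volume a b := fun a b => hh.intervalIntegrable a b
  simp only [intervalIntegral.integral_sub (hi _ _) (hj _ _)]
  have cg : ∀ a b : ℝ, ∫ σ in a..b, g σ = (∫ σ in 0..b, g σ) - ∫ σ in 0..a, g σ := fun a b =>
    (intervalIntegral.integral_interval_sub_left (hi _ _) (hi _ _)).symm
  have ch : ∀ a b : ℝ, ∫ σ in a..b, h σ = (∫ σ in 0..b, h σ) - ∫ σ in 0..a, h σ := fun a b =>
    (intervalIntegral.integral_interval_sub_left (hj _ _) (hj _ _)).symm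
  unfold splitInt
  rw [cg (min 0 s), ch (max 0 s), cg (min 0 p), ch (min 0 p)]
  rcases le_or_gt 0 p with h0 | h0
  · rcases le_total 0 s with h1 | h1 <;> rcases le_total p s with h2 | h2 <;>
      simp [h0, h1, h2] <;> try ring1
    · have : p = 0 := by linarith
      have : s = 0 := by linarith
      subst_vars; simp
  · rcases le_total 0 s with h1 | h1 <;> rcases le_total p s with h2 | h2 <;>
      simp [h0.le, h1, h2, not_le.2 h0] <;> try ring1
    · linarith

/-- Dependence of `splitInt` on the threshold. -/
theorem norm_splitInt_threshold_le {s s' p C : ℝ} {g h : ℝ → ℂ} (hg : Continuous g)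
    (hh : Continuous h) (hgC : ∀ σ ∈ uIcc 0 p, ‖g σ‖ ≤ C) (hhC : ∀ σ ∈ uIcc 0 p, ‖h σ‖ ≤ C) :
    ‖splitInt s g h p - splitInt s' g h p‖ ≤ 2 * C * |s - s'| := by
  have hC : 0 ≤ C := (norm_nonneg _).trans (hgC 0 left_mem_uIcc)
  set κ : ℝ → ℝ := fun s => max (min 0 p) (min s (max 0 p)) with hκ
  have hκm : ∀ s, κ s ∈ uIcc 0 p := fun s =>
    ⟨le_max_left _ _, max_le min_le_max (min_le_right _ _)⟩
  have hκl : |κ s - κ s'| ≤ |s - s'| := by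
    calc _ ≤ max |min 0 p - min 0 p| |min s (max 0 p) - min s' (max 0 p)| :=
          abs_max_sub_max_le_max _ _ _ _
      _ ≤ _ := by
        simp only [sub_self, abs_zero]
        refine max_le (abs_nonneg _) ((abs_min_sub_min_le_max _ _ _ _).trans ?_)
        simp
  have hd : ‖splitInt s g h p - splitInt s' g h p‖ = ‖∫ σ in κ s'..κ s, (g σ - h σ)‖ := by
    have hi : ∀ a b : ℝ, IntervalIntegrable (fun σ => g σ - h σ) volume a b :=
      fun a b => (hg.sub hh).intervalIntegrable a b
    rw [splitInt_eq_add hg hh, splitInt_eq_add hg hh,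
      show (∫ σ in κ s'..κ s, (g σ - h σ)) = (∫ σ in min 0 p..κ s, (g σ - h σ)) -
        ∫ σ in min 0 p..κ s', (g σ - h σ) from
        (intervalIntegral.integral_interval_sub_left (hi _ _) (hi _ _)).symm]
    split_ifs
    · congr 1; ring
    · rw [← norm_neg]; congr 1; ring
  rw [hd]
  calc _ ≤ (C + C) * |κ s - κ s'| := by
        refine intervalIntegral.norm_integral_le_of_norm_le_const fun σ hσ => ?_
        have := uIcc_subset_uIcc (hκm _) (hκm _) (uIoc_subset_uIcc hσ)
        exact (norm_sub_le _ _).trans (add_le_add (hgC _ this) (hhC _ this))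
    _ ≤ _ := by rw [← two_mul]; gcongr

/-- Dependence of `splitInt` on the endpoint. -/
theorem norm_splitInt_endpoint_le {s p p' C : ℝ} {g h : ℝ → ℂ} (hg : Continuous g)
    (hh : Continuous h) (hgC : ∀ σ ∈ uIcc p p', ‖g σ‖ ≤ C) (hhC : ∀ σ ∈ uIcc p p', ‖h σ‖ ≤ C) :
    ‖splitInt s g h p - splitInt s g h p'‖ ≤ 2 * C * |p - p'| := by
  have hC : 0 ≤ C := (norm_nonneg _).trans (hgC p left_mem_uIcc)
  have hd : splitInt s g h p - splitInt s g h p' =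
      (∫ σ in min p' s..min p s, g σ) + ∫ σ in max p' s..max p s, h σ := by
    simp only [splitInt]
    rw [← intervalIntegral.integral_interval_sub_left (a := min 0 s) (b := min p s)
      (c := min p' s) (hg.intervalIntegrable _ _) (hg.intervalIntegrable _ _),
      ← intervalIntegral.integral_interval_sub_left (a := max 0 s) (b := max p s)
      (c := max p' s) (hh.intervalIntegrable _ _) (hh.intervalIntegrable _ _)]
    ring
  rw [hd, two_mul, add_mul]
  refine (norm_add_le _ _).trans (add_le_add ?_ ?_)
  · refine (intervalIntegral.norm_integral_le_of_norm_le_const (C := C) fun σ hσ => hgC σ ?_).trans ?_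
    · rw [mem_uIoc] at hσ
      rw [mem_uIcc]
      grind
    · refine mul_le_mul_of_nonneg_left ?_ hC
      refine (abs_min_sub_min_le_max _ _ _ _).trans ?_
      simp
  · refine (intervalIntegral.norm_integral_le_of_norm_le_const (C := C) fun σ hσ => hhC σ ?_).trans ?_
    · rw [mem_uIoc] at hσ
      rw [mem_uIcc]
      grind
    · refine mul_le_mul_of_nonneg_left ?_ hC
      refine (abs_max_sub_max_le_max _ _ _ _).trans ?_
      simp

theorem continuous_splitInt {X : Type*} [TopologicalSpace X] [FirstCountableTopology X]
    {s p : X → ℝ} {g h : X → ℝ → ℂ} (hs : Continuous s) (hp : Continuous p)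
    (hg : Continuous fun y : X × ℝ => g y.1 y.2) (hh : Continuous fun y : X × ℝ => h y.1 y.2) :
    Continuous fun x => splitInt (s x) (g x) (h x) (p x) := by
  have key : ∀ (f : X → ℝ → ℂ), (Continuous fun y : X × ℝ => f y.1 y.2) → ∀ a b : X → ℝ,
      Continuous a → Continuous b → Continuous fun x => ∫ σ in a x..b x, f x σ := by
    intro f hf a b ha hb
    have hi : ∀ x (c d : ℝ), IntervalIntegrable (f x) volume c d := fun x c d =>
      (hf.comp (by fun_prop : Continuous fun σ : ℝ => (x, σ))).intervalIntegrable c d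
    have : (fun x => ∫ σ in a x..b x, f x σ) =
        fun x => (∫ σ in (0 : ℝ)..b x, f x σ) - ∫ σ in (0 : ℝ)..a x, f x σ := by
      ext x
      exact (intervalIntegral.integral_interval_sub_left (hi _ _ _) (hi _ _ _)).symm
    rw [this]
    exact (intervalIntegral.continuous_parametric_intervalIntegral_of_continuous hf hb).sub
      (intervalIntegral.continuous_parametric_intervalIntegral_of_continuous hf ha)
  unfold splitInt
  exact (key g hg _ _ (by fun_prop) (by fun_prop)).add (key h hh _ _ (by fun_prop) (by fun_prop))

/-! ### The system for the amplitudes -/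

/-- The two kinds of triples of light rays: three rays with the same velocity, or two with one
velocity and the third with the opposite one. -/
inductive Kind
  | uniform
  | mixed

/-- Families of functions of three ray labels and two times, indexed by the kind of the triple of
rays and by the velocity of the majority of them. The arguments are `(x, y, z, p, q)` for the kind
`uniform`, with the rays `x ≤ y ≤ z`, and `(x, z, y, p, q)` for the kind `mixed`, with `x ≤ z` the two
rays of equal velocity. Here `p` and `q` are the times of the two electrons up to the factor `±2`, so
that a ray `x` of majority velocity meets the ray `y` of opposite velocity at time `y - x`. -/
abbrev Amp : Type := Kind → Bool → ℝ × ℝ × ℝ × ℝ × ℝ → ℂ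

/-- Coefficients of the system for the amplitudes, with the integrability conditions that make the
evolutions in the two times commute. -/
structure Coeffs where
  (a a' b b' d d' : Bool → ℂ)
  comm_uniform : ∀ v, a v * b' v = a' v * b v
  comm_le_ge : ∀ v, b v * d' (!v) = b' v * d (!v)
  comm_ge_ge : ∀ v, d v * a' v = -(b' v * b (!v))
  comm_le_le : ∀ v, d' v * a v = -(b v * b' (!v))

namespace Coeffs

section

variable (K : Coeffs) (f : Amp) (v : Bool)

/-- `∂_p` of the uniform amplitude: the first electron leaves the ray `x`. -/
noncomputable def u₁ (x y z p q : ℝ) : ℂ := K.a v * f .mixed v (y, z, x + p, p, q)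

/-- `∂_q` of the uniform amplitude: the second electron leaves the ray `z`. -/
noncomputable def u₂ (x y z p q : ℝ) : ℂ := K.a' v * f .mixed v (x, y, z + q, p, q)

/-- `∂_p` of the mixed amplitude for `p ≤ y - x`, where the first electron is on the ray `x`. -/
noncomputable def m₁le (x z y p q : ℝ) : ℂ := K.b v * f .mixed (!v) (x + p, y, z, -p, -q)

/-- `∂_p` of the mixed amplitude for `y - x ≤ p`, where the first electron is on the ray `y`. -/
noncomputable def m₁ge (x z y p q : ℝ) : ℂ := K.d v * f .uniform v (y - p, x, z, p, q)

/-- `∂_q` of the mixed amplitude for `q ≤ y - z`, where the second electron is on the ray `y`. -/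
noncomputable def m₂le (x z y p q : ℝ) : ℂ := K.d' v * f .uniform v (x, z, y - q, p, q)

/-- `∂_q` of the mixed amplitude for `y - z ≤ q`, where the second electron is on the ray `z`. -/
noncomputable def m₂ge (x z y p q : ℝ) : ℂ := K.b' v * f .mixed (!v) (y, z + q, x, -p, -q)

end

/-- The amplitudes `f` satisfy the system with the amplitudes `g` on the right hand side, in
integrated form. The rays have to be in order, and the two electrons space-like: this excludes
`y - x < p ∧ q < y - z` for the kind `mixed`, where both would be on the ray `y`. -/
structure Solves (K : Coeffs) (g f : Amp) : Prop where
  uniform₁ : ∀ v x y z p p' q, x ≤ y → y ≤ z → x + p ≤ z + q → x + p' ≤ z + q →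
    f .uniform v (x, y, z, p', q) - f .uniform v (x, y, z, p, q) =
      ∫ σ in p..p', K.u₁ g v x y z σ q
  uniform₂ : ∀ v x y z p q q', x ≤ y → y ≤ z → x + p ≤ z + q → x + p ≤ z + q' →
    f .uniform v (x, y, z, p, q') - f .uniform v (x, y, z, p, q) =
      ∫ σ in q..q', K.u₂ g v x y z p σ
  mixed₁le : ∀ v x z y p p' q, x ≤ z → p ≤ y - x → p' ≤ y - x →
    f .mixed v (x, z, y, p', q) - f .mixed v (x, z, y, p, q) =
      ∫ σ in p..p', K.m₁le g v x z y σ q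
  mixed₁ge : ∀ v x z y p p' q, x ≤ z → y - x ≤ p → y - x ≤ p' → y - z ≤ q →
    f .mixed v (x, z, y, p', q) - f .mixed v (x, z, y, p, q) =
      ∫ σ in p..p', K.m₁ge g v x z y σ q
  mixed₂le : ∀ v x z y p q q', x ≤ z → q ≤ y - z → q' ≤ y - z → p ≤ y - x →
    f .mixed v (x, z, y, p, q') - f .mixed v (x, z, y, p, q) =
      ∫ σ in q..q', K.m₂le g v x z y p σ
  mixed₂ge : ∀ v x z y p q q', x ≤ z → y - z ≤ q → y - z ≤ q' →
    f .mixed v (x, z, y, p, q') - f .mixed v (x, z, y, p, q) =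
      ∫ σ in q..q', K.m₂ge g v x z y p σ

end Coeffs

/-! ### One step of the Picard iteration -/

/-- The integral of the form `(g₁ or h₁) dp + (g₂ or h₂) dq` from `(0, 0)` to `(p, q)`, where the
integrands switch at `p = s₁` and `q = s₂`. The path runs through `(0, q)` if `0 ≤ q` and through
`(p, 0)` if `q ≤ 0`. For both kinds of triples this path stays among the space-like pairs of times. -/
noncomputable def pathInt (s₁ s₂ : ℝ) (g₁ h₁ g₂ h₂ : ℝ → ℝ → ℂ) (p q : ℝ) : ℂ :=
  splitInt s₂ (g₂ 0) (h₂ 0) (max q 0) +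
    splitInt s₁ (fun σ => g₁ σ (max q 0)) (fun σ => h₁ σ (max q 0)) p +
    splitInt s₂ (g₂ p) (h₂ p) (min q 0)

theorem pathInt_of_nonneg {s₁ s₂ : ℝ} {g₁ h₁ g₂ h₂ : ℝ → ℝ → ℂ} {p q : ℝ} (hq : 0 ≤ q) :
    pathInt s₁ s₂ g₁ h₁ g₂ h₂ p q = splitInt s₂ (g₂ 0) (h₂ 0) q +
      splitInt s₁ (fun σ => g₁ σ q) (fun σ => h₁ σ q) p := by
  simp [pathInt, hq]

theorem pathInt_of_nonpos {s₁ s₂ : ℝ} {g₁ h₁ g₂ h₂ : ℝ → ℝ → ℂ} {p q : ℝ} (hq : q ≤ 0) :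
    pathInt s₁ s₂ g₁ h₁ g₂ h₂ p q = splitInt s₁ (fun σ => g₁ σ 0) (fun σ => h₁ σ 0) p +
      splitInt s₂ (g₂ p) (h₂ p) q := by
  simp [pathInt, hq]

@[simp] theorem pathInt_zero {s₁ s₂ : ℝ} {g₁ h₁ g₂ h₂ : ℝ → ℝ → ℂ} :
    pathInt s₁ s₂ g₁ h₁ g₂ h₂ 0 0 = 0 := by
  simp [pathInt]

/-- One step of the Picard iteration: the integral of the right hand side of the system. -/
noncomputable def Coeffs.step (K : Coeffs) (f : Amp) : Amp
  | .uniform, v, (x, y, z, p, q) => pathInt 0 0 (K.u₁ f v x y z) (K.u₁ f v x y z)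
      (K.u₂ f v x y z) (K.u₂ f v x y z) p q
  | .mixed, v, (x, z, y, p, q) => pathInt (y - x) (y - z) (K.m₁le f v x z y) (K.m₁ge f v x z y)
      (K.m₂le f v x z y) (K.m₂ge f v x z y) p q

/-- Continuity of all amplitudes. -/
def Amp.Cont (f : Amp) : Prop := ∀ k v, Continuous (f k v)

section

variable {K : Coeffs} {f g : Amp} {v : Bool}

theorem Amp.Cont.comp (hf : f.Cont) (k : Kind) (v : Bool) {X : Type*} [TopologicalSpace X]
    {φ : X → ℝ × ℝ × ℝ × ℝ × ℝ} (hφ : Continuous φ) : Continuous fun x => f k v (φ x) :=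
  (hf k v).comp hφ

theorem continuous_pathInt {X : Type*} [TopologicalSpace X] [FirstCountableTopology X]
    {s₁ s₂ p q : X → ℝ} {g₁ h₁ g₂ h₂ : X → ℝ → ℝ → ℂ} (hs₁ : Continuous s₁) (hs₂ : Continuous s₂)
    (hp : Continuous p) (hq : Continuous q)
    (hg₁ : Continuous fun y : X × ℝ × ℝ => g₁ y.1 y.2.1 y.2.2)
    (hh₁ : Continuous fun y : X × ℝ × ℝ => h₁ y.1 y.2.1 y.2.2)
    (hg₂ : Continuous fun y : X × ℝ × ℝ => g₂ y.1 y.2.1 y.2.2)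
    (hh₂ : Continuous fun y : X × ℝ × ℝ => h₂ y.1 y.2.1 y.2.2) :
    Continuous fun x => pathInt (s₁ x) (s₂ x) (g₁ x) (h₁ x) (g₂ x) (h₂ x) (p x) (q x) := by
  have e0 : Continuous fun y : X × ℝ => (y.1, (0 : ℝ), y.2) := by fun_prop
  have e1 : Continuous fun y : X × ℝ => (y.1, y.2, max (q y.1) 0) := by fun_prop
  have e2 : Continuous fun y : X × ℝ => (y.1, p y.1, y.2) := by fun_prop
  unfold pathInt
  exact ((continuous_splitInt hs₂ (by fun_prop) (hg₂.comp e0) (hh₂.comp e0)).add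
    (continuous_splitInt hs₁ hp (hg₁.comp e1) (hh₁.comp e1))).add
    (continuous_splitInt hs₂ (by fun_prop) (hg₂.comp e2) (hh₂.comp e2))

theorem Amp.Cont.step (hf : f.Cont) : (K.step f).Cont := by
  rintro (_ | _) v
  · have : Continuous fun X : ℝ × ℝ × ℝ × ℝ × ℝ =>
        pathInt 0 0 (K.u₁ f v X.1 X.2.1 X.2.2.1) (K.u₁ f v X.1 X.2.1 X.2.2.1)
          (K.u₂ f v X.1 X.2.1 X.2.2.1) (K.u₂ f v X.1 X.2.1 X.2.2.1) X.2.2.2.1 X.2.2.2.2 := by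
      refine continuous_pathInt ?_ ?_ ?_ ?_ ?_ ?_ ?_ ?_
      · fun_prop
      · fun_prop
      · fun_prop
      · fun_prop
      all_goals exact continuous_const.mul (hf.comp _ _ (by fun_prop))
    exact this
  · have : Continuous fun X : ℝ × ℝ × ℝ × ℝ × ℝ =>
        pathInt (X.2.2.1 - X.1) (X.2.2.1 - X.2.1) (K.m₁le f v X.1 X.2.1 X.2.2.1)
          (K.m₁ge f v X.1 X.2.1 X.2.2.1) (K.m₂le f v X.1 X.2.1 X.2.2.1)
          (K.m₂ge f v X.1 X.2.1 X.2.2.1) X.2.2.2.1 X.2.2.2.2 := by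
      refine continuous_pathInt ?_ ?_ ?_ ?_ ?_ ?_ ?_ ?_
      · fun_prop
      · fun_prop
      · fun_prop
      · fun_prop
      all_goals exact continuous_const.mul (hf.comp _ _ (by fun_prop))
    exact this

theorem integral_neg_neg (F : ℝ → ℂ) (a b : ℝ) :
    ∫ σ in -a..-b, F σ = ∫ σ in a..b, -F (-σ) := by
  rw [intervalIntegral.integral_neg, intervalIntegral.integral_comp_neg,
    intervalIntegral.integral_symm]

/-- The two ways around a rectangle agree if the cross derivatives do. -/
theorem integral_rect {g₁ g₂ C : ℝ → ℝ → ℂ} {a b q q' : ℝ}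
    (hC : Continuous fun y : ℝ × ℝ => C y.1 y.2)
    (h₁ : ∀ p ∈ uIcc a b, g₁ p q' - g₁ p q = ∫ σ in q..q', C p σ)
    (h₂ : ∀ r ∈ uIcc q q', g₂ b r - g₂ a r = ∫ σ in a..b, C σ r) :
    ∫ σ in a..b, (g₁ σ q' - g₁ σ q) = ∫ σ in q..q', (g₂ b σ - g₂ a σ) := by
  rw [intervalIntegral.integral_congr h₁, intervalIntegral.integral_congr h₂]
  refine intervalIntegral_intervalIntegral_swap ?_
  have hK : IsCompact (uIcc a b ×ˢ uIcc q q') := isCompact_uIcc.prod isCompact_uIcc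
  have hi : IntegrableOn (Function.uncurry C) (uIcc a b ×ˢ uIcc q q') :=
    ContinuousOn.integrableOn_compact hK hC.continuousOn
  exact hi.mono_set (prod_mono uIoc_subset_uIcc uIoc_subset_uIcc)

end

/-! ### The two time evolutions commute -/

section

variable {K : Coeffs} {f g : Amp}

theorem Coeffs.Solves.rect_uniform (h : K.Solves g f) (hg : g.Cont) (v : Bool)
    {x y z a b q q' : ℝ} (hxy : x ≤ y) (hyz : y ≤ z) (haq : x + a ≤ z + q) (haq' : x + a ≤ z + q')
    (hbq : x + b ≤ z + q) (hbq' : x + b ≤ z + q') :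
    ∫ σ in a..b, (K.u₁ f v x y z σ q' - K.u₁ f v x y z σ q) =
      ∫ σ in q..q', (K.u₂ f v x y z b σ - K.u₂ f v x y z a σ) := by
  refine integral_rect (C := fun p σ =>
    K.a v * (K.b' v * g .mixed (!v) (x + p, z + σ, y, -p, -σ))) ?_ ?_ ?_
  · exact continuous_const.mul (continuous_const.mul (hg.comp _ _ (by fun_prop)))
  · intro p hp
    rw [mem_uIcc] at hp
    simp only [Coeffs.u₁, ← mul_sub]
    rw [h.mixed₂ge v y z (x + p) p q q' hyz (by grind) (by grind),
      ← intervalIntegral.integral_const_mul]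
    rfl
  · intro r hr
    rw [mem_uIcc] at hr
    simp only [Coeffs.u₂, ← mul_sub]
    rw [h.mixed₁le v x y (z + r) a b r hxy (by grind) (by grind),
      ← intervalIntegral.integral_const_mul]
    refine intervalIntegral.integral_congr fun σ _ => ?_
    simp only [Coeffs.m₁le, ← mul_assoc, K.comm_uniform]

theorem Coeffs.Solves.rect_le_ge (h : K.Solves g f) (hg : g.Cont) (v : Bool)
    {x z y a b q q' : ℝ} (hxz : x ≤ z) (ha : a ≤ y - x) (hb : b ≤ y - x) (hq : y - z ≤ q)
    (hq' : y - z ≤ q') :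
    ∫ σ in a..b, (K.m₁le f v x z y σ q' - K.m₁le f v x z y σ q) =
      ∫ σ in q..q', (K.m₂ge f v x z y b σ - K.m₂ge f v x z y a σ) := by
  refine integral_rect (C := fun p σ =>
    -(K.b v * (K.d' (!v) * g .uniform (!v) (x + p, y, z + σ, -p, -σ)))) ?_ ?_ ?_
  · exact (continuous_const.mul (continuous_const.mul (hg.comp _ _ (by fun_prop)))).neg
  · intro p hp
    rw [mem_uIcc] at hp
    simp only [Coeffs.m₁le, ← mul_sub]
    rw [h.mixed₂le (!v) (x + p) y z (-p) (-q) (-q') (by grind) (by grind) (by grind) (by grind),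
      ← intervalIntegral.integral_const_mul, integral_neg_neg]
    simp only [Coeffs.m₂le, sub_neg_eq_add]
  · intro r hr
    rw [mem_uIcc] at hr
    simp only [Coeffs.m₂ge, ← mul_sub]
    rw [h.mixed₁ge (!v) y (z + r) x (-a) (-b) (-r) (by grind) (by grind) (by grind) (by grind),
      ← intervalIntegral.integral_const_mul, integral_neg_neg]
    simp only [Coeffs.m₁ge, sub_neg_eq_add, ← mul_assoc, K.comm_le_ge]

theorem Coeffs.Solves.rect_ge_ge (h : K.Solves g f) (hg : g.Cont) (v : Bool)
    {x z y a b q q' : ℝ} (hxz : x ≤ z) (ha : y - x ≤ a) (hb : y - x ≤ b) (hq : y - z ≤ q)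
    (hq' : y - z ≤ q') :
    ∫ σ in a..b, (K.m₁ge f v x z y σ q' - K.m₁ge f v x z y σ q) =
      ∫ σ in q..q', (K.m₂ge f v x z y b σ - K.m₂ge f v x z y a σ) := by
  refine integral_rect (C := fun p σ =>
    K.d v * (K.a' v * g .mixed v (y - p, x, z + σ, p, σ))) ?_ ?_ ?_
  · exact continuous_const.mul (continuous_const.mul (hg.comp _ _ (by fun_prop)))
  · intro p hp
    rw [mem_uIcc] at hp
    simp only [Coeffs.m₁ge, ← mul_sub]
    rw [h.uniform₂ v (y - p) x z p q q' (by grind) (by grind) (by grind) (by grind),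
      ← intervalIntegral.integral_const_mul]
    rfl
  · intro r hr
    rw [mem_uIcc] at hr
    simp only [Coeffs.m₂ge, ← mul_sub]
    rw [h.mixed₁le (!v) y (z + r) x (-a) (-b) (-r) (by grind) (by grind) (by grind),
      ← intervalIntegral.integral_const_mul, integral_neg_neg]
    refine intervalIntegral.integral_congr fun σ _ => ?_
    simp only [Coeffs.m₁le, ← mul_assoc, K.comm_ge_ge, Bool.not_not, neg_neg, neg_mul,
      ← sub_eq_add_neg]

theorem Coeffs.Solves.rect_le_le (h : K.Solves g f) (hg : g.Cont) (v : Bool)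
    {x z y a b q q' : ℝ} (hxz : x ≤ z) (ha : a ≤ y - x) (hb : b ≤ y - x) (hq : q ≤ y - z)
    (hq' : q' ≤ y - z) :
    ∫ σ in a..b, (K.m₁le f v x z y σ q' - K.m₁le f v x z y σ q) =
      ∫ σ in q..q', (K.m₂le f v x z y b σ - K.m₂le f v x z y a σ) := by
  refine integral_rect (C := fun p σ =>
    K.d' v * (K.a v * g .mixed v (z, y - σ, x + p, p, σ))) ?_ ?_ ?_
  · exact continuous_const.mul (continuous_const.mul (hg.comp _ _ (by fun_prop)))
  · intro p hp
    rw [mem_uIcc] at hp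
    simp only [Coeffs.m₁le, ← mul_sub]
    rw [h.mixed₂ge (!v) (x + p) y z (-p) (-q) (-q') (by grind) (by grind) (by grind),
      ← intervalIntegral.integral_const_mul, integral_neg_neg]
    refine intervalIntegral.integral_congr fun σ _ => ?_
    simp only [Coeffs.m₂ge, ← mul_assoc, K.comm_le_le, Bool.not_not, neg_neg, neg_mul,
      ← sub_eq_add_neg]
  · intro r hr
    rw [mem_uIcc] at hr
    simp only [Coeffs.m₂le, ← mul_sub]
    rw [h.uniform₁ v x z (y - r) a b r (by grind) (by grind) (by grind) (by grind),
      ← intervalIntegral.integral_const_mul]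
    rfl

theorem Amp.Cont.u₁ (hf : f.Cont) (v : Bool) (x y z q : ℝ) :
    Continuous fun σ => K.u₁ f v x y z σ q :=
  continuous_const.mul (hf.comp _ _ (by fun_prop))

theorem Amp.Cont.u₂ (hf : f.Cont) (v : Bool) (x y z p : ℝ) : Continuous (K.u₂ f v x y z p) :=
  continuous_const.mul (hf.comp _ _ (by fun_prop))

theorem Amp.Cont.m₁le (hf : f.Cont) (v : Bool) (x z y q : ℝ) :
    Continuous fun σ => K.m₁le f v x z y σ q :=
  continuous_const.mul (hf.comp _ _ (by fun_prop))

theorem Amp.Cont.m₁ge (hf : f.Cont) (v : Bool) (x z y q : ℝ) :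
    Continuous fun σ => K.m₁ge f v x z y σ q :=
  continuous_const.mul (hf.comp _ _ (by fun_prop))

theorem Amp.Cont.m₂le (hf : f.Cont) (v : Bool) (x z y p : ℝ) :
    Continuous (K.m₂le f v x z y p) :=
  continuous_const.mul (hf.comp _ _ (by fun_prop))

theorem Amp.Cont.m₂ge (hf : f.Cont) (v : Bool) (x z y p : ℝ) :
    Continuous (K.m₂ge f v x z y p) :=
  continuous_const.mul (hf.comp _ _ (by fun_prop))

/-- To find the increments of a function on an interval, it is enough to consider points on the same
side of `0`. -/
theorem sub_eq_integral_of_same_sign {φ F : ℝ → ℂ} (hF : Continuous F) {D : Set ℝ}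
    (hD : D.OrdConnected)
    (hpos : ∀ q ∈ D, ∀ q' ∈ D, 0 ≤ q → 0 ≤ q' → φ q' - φ q = ∫ σ in q..q', F σ)
    (hneg : ∀ q ∈ D, ∀ q' ∈ D, q ≤ 0 → q' ≤ 0 → φ q' - φ q = ∫ σ in q..q', F σ)
    {q q' : ℝ} (hq : q ∈ D) (hq' : q' ∈ D) : φ q' - φ q = ∫ σ in q..q', F σ := by
  rcases le_total 0 q with h | h <;> rcases le_total 0 q' with h' | h'
  · exact hpos q hq q' hq' h h'
  · have h0 : (0 : ℝ) ∈ D := hD.out hq' hq ⟨h', h⟩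
    rw [← intervalIntegral.integral_add_adjacent_intervals (hF.intervalIntegrable q 0)
      (hF.intervalIntegrable 0 q'), ← hpos q hq 0 h0 h le_rfl, ← hneg 0 h0 q' hq' le_rfl h']
    ring
  · have h0 : (0 : ℝ) ∈ D := hD.out hq hq' ⟨h, h'⟩
    rw [← intervalIntegral.integral_add_adjacent_intervals (hF.intervalIntegrable q 0)
      (hF.intervalIntegrable 0 q'), ← hneg q hq 0 h0 h le_rfl, ← hpos 0 h0 q' hq' le_rfl h']
    ring
  · exact hneg q hq q' hq' h h'

theorem Coeffs.Solves.step_uniform₁ (h : K.Solves g f) (hf : f.Cont) (hg : g.Cont) (v : Bool)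
    (x y z p p' q : ℝ) (hxy : x ≤ y) (hyz : y ≤ z) (hp : x + p ≤ z + q) (hp' : x + p' ≤ z + q) :
    K.step f .uniform v (x, y, z, p', q) - K.step f .uniform v (x, y, z, p, q) =
      ∫ σ in p..p', K.u₁ f v x y z σ q := by
  have i₁ : ∀ q a b, IntervalIntegrable (fun σ => K.u₁ f v x y z σ q) volume a b :=
    fun q a b => (hf.u₁ v x y z q).intervalIntegrable a b
  have i₂ : ∀ p a b, IntervalIntegrable (K.u₂ f v x y z p) volume a b :=
    fun p a b => (hf.u₂ v x y z p).intervalIntegrable a b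
  simp only [Coeffs.step]
  rcases le_total 0 q with hq | hq
  · simp only [pathInt_of_nonneg hq, splitInt_self (hf.u₁ _ _ _ _ _)]
    rw [add_sub_add_left_eq_sub, intervalIntegral.integral_interval_sub_left (i₁ _ _ _) (i₁ _ _ _)]
  · simp only [pathInt_of_nonpos hq, splitInt_self (hf.u₁ _ _ _ _ _), splitInt_self (hf.u₂ _ _ _ _ _)]
    have hr := h.rect_uniform hg v (a := p) (b := p') (q := 0) (q' := q) hxy hyz
      (by linarith) hp (by linarith) hp'
    rw [intervalIntegral.integral_sub (i₁ _ _ _) (i₁ _ _ _),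
      intervalIntegral.integral_sub (i₂ _ _ _) (i₂ _ _ _)] at hr
    have := intervalIntegral.integral_interval_sub_left (i₁ 0 0 p') (i₁ 0 0 p)
    linear_combination this - hr

theorem Coeffs.Solves.step_uniform₂ (h : K.Solves g f) (hf : f.Cont) (hg : g.Cont) (v : Bool)
    (x y z p q q' : ℝ) (hxy : x ≤ y) (hyz : y ≤ z) (hq : x + p ≤ z + q) (hq' : x + p ≤ z + q') :
    K.step f .uniform v (x, y, z, p, q') - K.step f .uniform v (x, y, z, p, q) =
      ∫ σ in q..q', K.u₂ f v x y z p σ := by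
  have i₁ : ∀ q a b, IntervalIntegrable (fun σ => K.u₁ f v x y z σ q) volume a b :=
    fun q a b => (hf.u₁ v x y z q).intervalIntegrable a b
  have i₂ : ∀ p a b, IntervalIntegrable (K.u₂ f v x y z p) volume a b :=
    fun p a b => (hf.u₂ v x y z p).intervalIntegrable a b
  refine sub_eq_integral_of_same_sign (φ := fun q => K.step f .uniform v (x, y, z, p, q))
    (D := {q | x + p ≤ z + q}) (hf.u₂ v x y z p) ⟨fun a ha b _ c hc => ?_⟩ ?_ ?_ hq hq'
  · simp only [mem_ofPred_eq] at ha ⊢; linarith [hc.1]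
  · intro q hq q' hq' h0 h0'
    simp only [mem_ofPred_eq] at hq hq'
    simp only [Coeffs.step, pathInt_of_nonneg h0, pathInt_of_nonneg h0',
      splitInt_self (hf.u₁ _ _ _ _ _), splitInt_self (hf.u₂ _ _ _ _ _)]
    have hr := h.rect_uniform hg v (a := 0) (b := p) (q := q) (q' := q') hxy hyz
      (by linarith) (by linarith) hq hq'
    rw [intervalIntegral.integral_sub (i₁ _ _ _) (i₁ _ _ _),
      intervalIntegral.integral_sub (i₂ _ _ _) (i₂ _ _ _)] at hr
    have := intervalIntegral.integral_interval_sub_left (i₂ 0 0 q') (i₂ 0 0 q)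
    linear_combination hr + this
  · intro q _ q' _ h0 h0'
    simp only [Coeffs.step, pathInt_of_nonpos h0, pathInt_of_nonpos h0',
      splitInt_self (hf.u₂ _ _ _ _ _)]
    rw [add_sub_add_left_eq_sub, intervalIntegral.integral_interval_sub_left (i₂ _ _ _) (i₂ _ _ _)]

/-- The increment of an integral with switching integrand is computed from rectangles on both sides
of the threshold. -/
theorem splitInt_sub_eq_of_rect {s p q q' : ℝ} {g g' h h' : ℝ → ℂ} {G : ℝ → ℝ → ℂ}
    (hg : Continuous g) (hg' : Continuous g') (hh : Continuous h) (hh' : Continuous h')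
    (hG : ∀ a, Continuous (G a))
    (hle : ∀ a ≤ s, ∀ b ≤ s, ∫ σ in a..b, (g' σ - g σ) = ∫ σ in q..q', (G b σ - G a σ))
    (hge : ∀ a, s ≤ a → ∀ b, s ≤ b →
      ∫ σ in a..b, (h' σ - h σ) = ∫ σ in q..q', (G b σ - G a σ)) :
    splitInt s g' h' p - splitInt s g h p =
      (∫ σ in q..q', G p σ) - ∫ σ in q..q', G 0 σ := by
  have hi : ∀ a, IntervalIntegrable (G a) volume q q' := fun a => (hG a).intervalIntegrable _ _
  have e : ∀ a b, ∫ σ in q..q', (G b σ - G a σ) =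
      (∫ σ in q..q', G b σ) - ∫ σ in q..q', G a σ :=
    fun a b => intervalIntegral.integral_sub (hi b) (hi a)
  simp only [e] at hle hge
  rw [splitInt_sub_splitInt hg' hh' hg hh]
  exact splitInt_eq_of_primitive (φ := fun a => ∫ σ in q..q', G a σ) hle hge

theorem Coeffs.Solves.step_mixed₁le (h : K.Solves g f) (hf : f.Cont) (hg : g.Cont) (v : Bool)
    (x z y p p' q : ℝ) (hxz : x ≤ z) (hp : p ≤ y - x) (hp' : p' ≤ y - x) :
    K.step f .mixed v (x, z, y, p', q) - K.step f .mixed v (x, z, y, p, q) =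
      ∫ σ in p..p', K.m₁le f v x z y σ q := by
  simp only [Coeffs.step]
  rcases le_total 0 q with hq | hq
  · simp only [pathInt_of_nonneg hq]
    rw [add_sub_add_left_eq_sub, splitInt_sub_of_le (hf.m₁le _ _ _ _ _) hp hp']
  · simp only [pathInt_of_nonpos hq]
    have hd := splitInt_sub_of_le (h := fun σ => K.m₁ge f v x z y σ 0) (hf.m₁le (K := K) v x z y 0) hp hp'
    have i₁ : ∀ q, IntervalIntegrable (fun σ => K.m₁le f v x z y σ q) volume p p' :=
      fun q => (hf.m₁le v x z y q).intervalIntegrable _ _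
    -- The roles of the two times are exchanged: the rectangles have the side `[p, p']`.
    have hr := splitInt_sub_eq_of_rect (s := y - z) (p := q) (q := p) (q' := p')
      (G := fun r σ => K.m₁le f v x z y σ r) (hf.m₂le v x z y p) (hf.m₂le v x z y p')
      (hf.m₂ge v x z y p) (hf.m₂ge v x z y p') (fun r => hf.m₁le v x z y r)
      (fun a ha b hb => (h.rect_le_le hg v hxz hp hp' ha hb).symm)
      (fun a ha b hb => (h.rect_le_ge hg v hxz hp hp' ha hb).symm)
    linear_combination hd + hr

theorem Coeffs.Solves.step_mixed₁ge (h : K.Solves g f) (hf : f.Cont) (hg : g.Cont) (v : Bool)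
    (x z y p p' q : ℝ) (hxz : x ≤ z) (hp : y - x ≤ p) (hp' : y - x ≤ p') (hq : y - z ≤ q) :
    K.step f .mixed v (x, z, y, p', q) - K.step f .mixed v (x, z, y, p, q) =
      ∫ σ in p..p', K.m₁ge f v x z y σ q := by
  simp only [Coeffs.step]
  rcases le_total 0 q with hq0 | hq0
  · simp only [pathInt_of_nonneg hq0]
    rw [add_sub_add_left_eq_sub, splitInt_sub_of_ge (hf.m₁ge _ _ _ _ _) hp hp']
  · simp only [pathInt_of_nonpos hq0, splitInt_of_ge (hq.trans hq0) hq]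
    have hd := splitInt_sub_of_ge (g := fun σ => K.m₁le f v x z y σ 0) (hf.m₁ge (K := K) v x z y 0) hp hp'
    have hr := h.rect_ge_ge hg v hxz hp hp' (hq.trans hq0) hq
    rw [intervalIntegral.integral_sub ((hf.m₁ge v x z y q).intervalIntegrable _ _)
      ((hf.m₁ge v x z y 0).intervalIntegrable _ _),
      intervalIntegral.integral_sub ((hf.m₂ge v x z y p').intervalIntegrable _ _)
      ((hf.m₂ge v x z y p).intervalIntegrable _ _)] at hr
    linear_combination hd - hr

theorem Coeffs.Solves.step_mixed₂le (h : K.Solves g f) (hf : f.Cont) (hg : g.Cont) (v : Bool)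
    (x z y p q q' : ℝ) (hxz : x ≤ z) (hq : q ≤ y - z) (hq' : q' ≤ y - z) (hp : p ≤ y - x) :
    K.step f .mixed v (x, z, y, p, q') - K.step f .mixed v (x, z, y, p, q) =
      ∫ σ in q..q', K.m₂le f v x z y p σ := by
  refine sub_eq_integral_of_same_sign (φ := fun q => K.step f .mixed v (x, z, y, p, q))
    (hf.m₂le v x z y p) (ordConnected_Iic (a := y - z)) ?_ ?_ hq hq'
  · intro q hq q' hq' h0 h0'
    have hx : 0 ≤ y - x := by linarith [mem_Iic.1 hq]
    simp only [Coeffs.step, pathInt_of_nonneg h0, pathInt_of_nonneg h0', splitInt_of_le hx hp]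
    have hd := splitInt_sub_of_le (h := K.m₂ge f v x z y 0) (hf.m₂le (K := K) v x z y 0) hq hq'
    have hr := h.rect_le_le hg v hxz hx hp hq hq'
    rw [intervalIntegral.integral_sub ((hf.m₁le v x z y q').intervalIntegrable _ _)
      ((hf.m₁le v x z y q).intervalIntegrable _ _),
      intervalIntegral.integral_sub ((hf.m₂le v x z y p).intervalIntegrable _ _)
      ((hf.m₂le v x z y 0).intervalIntegrable _ _)] at hr
    linear_combination hd + hr
  · intro q hq q' hq' h0 h0'
    simp only [Coeffs.step, pathInt_of_nonpos h0, pathInt_of_nonpos h0']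
    rw [add_sub_add_left_eq_sub, splitInt_sub_of_le (hf.m₂le _ _ _ _ _) hq hq']

theorem Coeffs.Solves.step_mixed₂ge (h : K.Solves g f) (hf : f.Cont) (hg : g.Cont) (v : Bool)
    (x z y p q q' : ℝ) (hxz : x ≤ z) (hq : y - z ≤ q) (hq' : y - z ≤ q') :
    K.step f .mixed v (x, z, y, p, q') - K.step f .mixed v (x, z, y, p, q) =
      ∫ σ in q..q', K.m₂ge f v x z y p σ := by
  refine sub_eq_integral_of_same_sign (φ := fun q => K.step f .mixed v (x, z, y, p, q))
    (hf.m₂ge v x z y p) (ordConnected_Ici (a := y - z)) ?_ ?_ hq hq'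
  · intro q hq q' hq' h0 h0'
    simp only [Coeffs.step, pathInt_of_nonneg h0, pathInt_of_nonneg h0']
    have hd := splitInt_sub_of_ge (g := K.m₂le f v x z y 0) (hf.m₂ge (K := K) v x z y 0) hq hq'
    have hr := splitInt_sub_eq_of_rect (s := y - x) (p := p) (q := q) (q' := q')
      (G := K.m₂ge f v x z y) (hf.m₁le v x z y q) (hf.m₁le v x z y q')
      (hf.m₁ge v x z y q) (hf.m₁ge v x z y q') (fun r => hf.m₂ge v x z y r)
      (fun a ha b hb => h.rect_le_ge hg v hxz ha hb hq hq')
      (fun a ha b hb => h.rect_ge_ge hg v hxz ha hb hq hq')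
    linear_combination hd + hr
  · intro q hq q' hq' h0 h0'
    simp only [Coeffs.step, pathInt_of_nonpos h0, pathInt_of_nonpos h0']
    rw [add_sub_add_left_eq_sub, splitInt_sub_of_ge (hf.m₂ge _ _ _ _ _) hq hq']

/-- A Picard step turns amplitudes that solve the system into amplitudes that solve it with the
former ones on the right hand side: the form that is integrated is closed. -/
theorem Coeffs.Solves.step (h : K.Solves g f) (hf : f.Cont) (hg : g.Cont) :
    K.Solves f (K.step f) where
  uniform₁ := h.step_uniform₁ hf hg
  uniform₂ := h.step_uniform₂ hf hg
  mixed₁le := h.step_mixed₁le hf hg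
  mixed₁ge := h.step_mixed₁ge hf hg
  mixed₂le := h.step_mixed₂le hf hg
  mixed₂ge := h.step_mixed₂ge hf hg

end

/-! ### Weighted estimates for the Picard step -/

theorem exp_weight_add (l a b : ℝ) :
    Real.exp (l * (a + b)) = Real.exp (l * a) * Real.exp (l * b) := by
  rw [mul_add, Real.exp_add]

theorem abs_max_zero_le (q : ℝ) : |max q 0| ≤ |q| := by
  rcases le_total 0 q with h | h <;> simp [h]

theorem abs_min_zero_le (q : ℝ) : |min q 0| ≤ |q| := by
  rcases le_total 0 q with h | h <;> simp [h]

theorem norm_splitInt_sub_le {l C D S s s' p : ℝ} {g h g' h' : ℝ → ℂ} (hl : 0 < l) (hC : 0 ≤ C)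
    (hD : 0 ≤ D) (hg : Continuous g) (hh : Continuous h) (hg' : Continuous g')
    (hh' : Continuous h') (hs : |s - s'| ≤ S)
    (hgC : ∀ σ, ‖g' σ‖ ≤ C * Real.exp (l * |σ|)) (hhC : ∀ σ, ‖h' σ‖ ≤ C * Real.exp (l * |σ|))
    (hgD : ∀ σ, ‖g σ - g' σ‖ ≤ D * Real.exp (l * |σ|))
    (hhD : ∀ σ, ‖h σ - h' σ‖ ≤ D * Real.exp (l * |σ|)) :
    ‖splitInt s g h p - splitInt s' g' h' p‖ ≤ (4 * D / l + 2 * C * S) * Real.exp (l * |p|) := by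
  have h1 : ‖splitInt s g h p - splitInt s g' h' p‖ ≤ 4 * D / l * Real.exp (l * |p|) := by
    rw [splitInt_sub_splitInt hg hh hg' hh']
    exact norm_splitInt_le hl hD (fun σ _ _ => hgD σ) (fun σ _ _ => hhD σ)
  have hb : ∀ σ ∈ uIcc 0 p, C * Real.exp (l * |σ|) ≤ C * Real.exp (l * |p|) := by
    intro σ hσ
    have : |σ| ≤ |p| := by simpa using abs_sub_left_of_mem_uIcc hσ
    gcongr
  have h2 : ‖splitInt s g' h' p - splitInt s' g' h' p‖ ≤
      2 * (C * Real.exp (l * |p|)) * |s - s'| :=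
    norm_splitInt_threshold_le hg' hh' (fun σ hσ => (hgC σ).trans (hb σ hσ))
      (fun σ hσ => (hhC σ).trans (hb σ hσ))
  calc ‖splitInt s g h p - splitInt s' g' h' p‖
      = ‖(splitInt s g h p - splitInt s g' h' p) +
          (splitInt s g' h' p - splitInt s' g' h' p)‖ := by congr 1; ring
    _ ≤ 4 * D / l * Real.exp (l * |p|) + 2 * (C * Real.exp (l * |p|)) * |s - s'| :=
        (norm_add_le _ _).trans (add_le_add h1 h2)
    _ ≤ 4 * D / l * Real.exp (l * |p|) + 2 * (C * Real.exp (l * |p|)) * S := by gcongr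
    _ = _ := by ring

section

variable {l C D : ℝ} {s₁ s₂ : ℝ} {g₁ h₁ g₂ h₂ : ℝ → ℝ → ℂ}

theorem norm_pathInt_le (hl : 0 < l) (hC : 0 ≤ C)
    (bg₁ : ∀ p q, ‖g₁ p q‖ ≤ C * Real.exp (l * (|p| + |q|)))
    (bh₁ : ∀ p q, ‖h₁ p q‖ ≤ C * Real.exp (l * (|p| + |q|)))
    (bg₂ : ∀ p q, ‖g₂ p q‖ ≤ C * Real.exp (l * (|p| + |q|)))
    (bh₂ : ∀ p q, ‖h₂ p q‖ ≤ C * Real.exp (l * (|p| + |q|))) (p q : ℝ) :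
    ‖pathInt s₁ s₂ g₁ h₁ g₂ h₂ p q‖ ≤ 12 * C / l * Real.exp (l * (|p| + |q|)) := by
  simp only [exp_weight_add] at bg₁ bh₁ bg₂ bh₂ ⊢
  have e1 : Real.exp (l * |max q 0|) ≤ Real.exp (l * |q|) :=
    Real.exp_le_exp.2 (mul_le_mul_of_nonneg_left (abs_max_zero_le q) hl.le)
  have e2 : Real.exp (l * |min q 0|) ≤ Real.exp (l * |q|) :=
    Real.exp_le_exp.2 (mul_le_mul_of_nonneg_left (abs_min_zero_le q) hl.le)
  have e3 : 1 ≤ Real.exp (l * |p|) := Real.one_le_exp (by positivity)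
  have t1 := norm_splitInt_le (s := s₂) (p := max q 0) (g := g₂ 0) (h := h₂ 0) hl hC
    (fun σ _ _ => by simpa using bg₂ 0 σ) (fun σ _ _ => by simpa using bh₂ 0 σ)
  have t2 := norm_splitInt_le (s := s₁) (p := p) (g := fun σ => g₁ σ (max q 0))
    (h := fun σ => h₁ σ (max q 0)) (C := C * Real.exp (l * |max q 0|)) hl (by positivity)
    (fun σ _ _ => (bg₁ σ _).trans_eq (by ring)) (fun σ _ _ => (bh₁ σ _).trans_eq (by ring))
  have t3 := norm_splitInt_le (s := s₂) (p := min q 0) (g := g₂ p) (h := h₂ p)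
    (C := C * Real.exp (l * |p|)) hl (by positivity)
    (fun σ _ _ => (bg₂ p σ).trans_eq (by ring)) (fun σ _ _ => (bh₂ p σ).trans_eq (by ring))
  calc _ ≤ _ := (norm_add_le _ _).trans (add_le_add_left (norm_add_le _ _) _)
    _ ≤ 4 * C / l * (Real.exp (l * |p|) * Real.exp (l * |q|)) +
        4 * C / l * (Real.exp (l * |p|) * Real.exp (l * |q|)) +
        4 * C / l * (Real.exp (l * |p|) * Real.exp (l * |q|)) := by
      refine add_le_add (add_le_add (t1.trans ?_) (t2.trans ?_)) (t3.trans ?_)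
      · gcongr
        exact e1.trans (le_mul_of_one_le_left (by positivity) e3)
      · calc _ = 4 * C / l * (Real.exp (l * |p|) * Real.exp (l * |max q 0|)) := by ring
          _ ≤ _ := by gcongr
      · calc _ = 4 * C / l * (Real.exp (l * |p|) * Real.exp (l * |min q 0|)) := by ring
          _ ≤ _ := by gcongr
    _ = _ := by ring

/-- Dependence of `pathInt` on the thresholds and the integrands. -/
theorem norm_pathInt_sub_le {S s₁' s₂' : ℝ} {g₁' h₁' g₂' h₂' : ℝ → ℝ → ℂ} (hl : 0 < l)
    (hC : 0 ≤ C) (hD : 0 ≤ D)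
    (cg₁ : ∀ q, Continuous fun σ => g₁ σ q) (ch₁ : ∀ q, Continuous fun σ => h₁ σ q)
    (cg₂ : ∀ p, Continuous (g₂ p)) (ch₂ : ∀ p, Continuous (h₂ p))
    (cg₁' : ∀ q, Continuous fun σ => g₁' σ q) (ch₁' : ∀ q, Continuous fun σ => h₁' σ q)
    (cg₂' : ∀ p, Continuous (g₂' p)) (ch₂' : ∀ p, Continuous (h₂' p))
    (hs₁ : |s₁ - s₁'| ≤ S) (hs₂ : |s₂ - s₂'| ≤ S)
    (bg₁ : ∀ p q, ‖g₁' p q‖ ≤ C * Real.exp (l * (|p| + |q|)))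
    (bh₁ : ∀ p q, ‖h₁' p q‖ ≤ C * Real.exp (l * (|p| + |q|)))
    (bg₂ : ∀ p q, ‖g₂' p q‖ ≤ C * Real.exp (l * (|p| + |q|)))
    (bh₂ : ∀ p q, ‖h₂' p q‖ ≤ C * Real.exp (l * (|p| + |q|)))
    (dg₁ : ∀ p q, ‖g₁ p q - g₁' p q‖ ≤ D * Real.exp (l * (|p| + |q|)))
    (dh₁ : ∀ p q, ‖h₁ p q - h₁' p q‖ ≤ D * Real.exp (l * (|p| + |q|)))
    (dg₂ : ∀ p q, ‖g₂ p q - g₂' p q‖ ≤ D * Real.exp (l * (|p| + |q|)))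
    (dh₂ : ∀ p q, ‖h₂ p q - h₂' p q‖ ≤ D * Real.exp (l * (|p| + |q|))) (p q : ℝ) :
    ‖pathInt s₁ s₂ g₁ h₁ g₂ h₂ p q - pathInt s₁' s₂' g₁' h₁' g₂' h₂' p q‖ ≤
      (12 * D / l + 6 * C * S) * Real.exp (l * (|p| + |q|)) := by
  have hS : 0 ≤ S := (abs_nonneg _).trans hs₁
  simp only [exp_weight_add] at bg₁ bh₁ bg₂ bh₂ dg₁ dh₁ dg₂ dh₂ ⊢
  have e1 : Real.exp (l * |max q 0|) ≤ Real.exp (l * |q|) :=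
    Real.exp_le_exp.2 (mul_le_mul_of_nonneg_left (abs_max_zero_le q) hl.le)
  have e2 : Real.exp (l * |min q 0|) ≤ Real.exp (l * |q|) :=
    Real.exp_le_exp.2 (mul_le_mul_of_nonneg_left (abs_min_zero_le q) hl.le)
  have e3 : 1 ≤ Real.exp (l * |p|) := Real.one_le_exp (by positivity)
  have t1 := norm_splitInt_sub_le (p := max q 0) hl hC hD (cg₂ 0) (ch₂ 0) (cg₂' 0) (ch₂' 0) hs₂
    (fun σ => by simpa using bg₂ 0 σ) (fun σ => by simpa using bh₂ 0 σ)
    (fun σ => by simpa using dg₂ 0 σ) (fun σ => by simpa using dh₂ 0 σ)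
  have t2 := norm_splitInt_sub_le (p := p) (C := C * Real.exp (l * |max q 0|))
    (D := D * Real.exp (l * |max q 0|)) hl (by positivity) (by positivity) (cg₁ (max q 0))
    (ch₁ (max q 0)) (cg₁' (max q 0)) (ch₁' (max q 0)) hs₁
    (fun σ => (bg₁ σ _).trans_eq (by ring)) (fun σ => (bh₁ σ _).trans_eq (by ring))
    (fun σ => (dg₁ σ _).trans_eq (by ring)) (fun σ => (dh₁ σ _).trans_eq (by ring))
  have t3 := norm_splitInt_sub_le (p := min q 0) (C := C * Real.exp (l * |p|))
    (D := D * Real.exp (l * |p|)) hl (by positivity) (by positivity) (cg₂ p) (ch₂ p) (cg₂' p)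
    (ch₂' p) hs₂
    (fun σ => (bg₂ p σ).trans_eq (by ring)) (fun σ => (bh₂ p σ).trans_eq (by ring))
    (fun σ => (dg₂ p σ).trans_eq (by ring)) (fun σ => (dh₂ p σ).trans_eq (by ring))
  have hsplit : ∀ a b c a' b' c' : ℂ, ‖(a + b + c) - (a' + b' + c')‖ ≤
      ‖a - a'‖ + ‖b - b'‖ + ‖c - c'‖ := by
    intro a b c a' b' c'
    calc _ = ‖(a - a') + (b - b') + (c - c')‖ := by congr 1; ring
      _ ≤ _ := (norm_add_le _ _).trans (add_le_add_left (norm_add_le _ _) _)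
  refine (hsplit _ _ _ _ _ _).trans ?_
  calc
    _ ≤ (4 * D / l + 2 * C * S) * (Real.exp (l * |p|) * Real.exp (l * |q|)) +
        (4 * D / l + 2 * C * S) * (Real.exp (l * |p|) * Real.exp (l * |q|)) +
        (4 * D / l + 2 * C * S) * (Real.exp (l * |p|) * Real.exp (l * |q|)) := by
      refine add_le_add (add_le_add (t1.trans ?_) (t2.trans ?_)) (t3.trans ?_)
      · gcongr
        exact e1.trans (le_mul_of_one_le_left (by positivity) e3)
      · calc _ = (4 * D / l + 2 * C * S) * (Real.exp (l * |p|) * Real.exp (l * |max q 0|)) := by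
              ring
          _ ≤ _ := by gcongr
      · calc _ = (4 * D / l + 2 * C * S) * (Real.exp (l * |p|) * Real.exp (l * |min q 0|)) := by
              ring
          _ ≤ _ := by gcongr
    _ = _ := by ring

/-- Dependence of `pathInt` on its first endpoint. -/
theorem norm_pathInt_sub_left_le (hl : 0 < l) (hC : 0 ≤ C) (hD : 0 ≤ D)
    (cg₁ : ∀ q, Continuous fun σ => g₁ σ q) (ch₁ : ∀ q, Continuous fun σ => h₁ σ q)
    (cg₂ : ∀ p, Continuous (g₂ p)) (ch₂ : ∀ p, Continuous (h₂ p))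
    (bg₁ : ∀ p q, ‖g₁ p q‖ ≤ C * Real.exp (l * (|p| + |q|)))
    (bh₁ : ∀ p q, ‖h₁ p q‖ ≤ C * Real.exp (l * (|p| + |q|)))
    {p p' P : ℝ} (hp : |p| ≤ P) (hp' : |p'| ≤ P)
    (dg₂ : ∀ q, ‖g₂ p q - g₂ p' q‖ ≤ D * Real.exp (l * (P + |q|)))
    (dh₂ : ∀ q, ‖h₂ p q - h₂ p' q‖ ≤ D * Real.exp (l * (P + |q|))) (q : ℝ) :
    ‖pathInt s₁ s₂ g₁ h₁ g₂ h₂ p q - pathInt s₁ s₂ g₁ h₁ g₂ h₂ p' q‖ ≤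
      (4 * D / l + 2 * C * |p - p'|) * Real.exp (l * (P + |q|)) := by
  simp only [exp_weight_add] at bg₁ bh₁ dg₂ dh₂ ⊢
  have e1 : Real.exp (l * |max q 0|) ≤ Real.exp (l * |q|) :=
    Real.exp_le_exp.2 (mul_le_mul_of_nonneg_left (abs_max_zero_le q) hl.le)
  have e2 : Real.exp (l * |min q 0|) ≤ Real.exp (l * |q|) :=
    Real.exp_le_exp.2 (mul_le_mul_of_nonneg_left (abs_min_zero_le q) hl.le)
  have hσ : ∀ σ ∈ uIcc p p', |σ| ≤ P := by
    intro σ hσ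
    rw [mem_uIcc] at hσ
    rw [abs_le] at *
    constructor <;> rcases hσ with h | h <;> linarith [h.1, h.2]
  have hb : ∀ σ ∈ uIcc p p', C * (Real.exp (l * |σ|) * Real.exp (l * |max q 0|)) ≤
      C * (Real.exp (l * P) * Real.exp (l * |q|)) := by
    intro σ hσ'
    have := hσ σ hσ'
    gcongr
  have t2 := norm_splitInt_endpoint_le (s := s₁) (cg₁ (max q 0)) (ch₁ (max q 0))
    (fun σ hσ => (bg₁ σ _).trans (hb σ hσ)) (fun σ hσ => (bh₁ σ _).trans (hb σ hσ))
  have t3 := norm_splitInt_le (s := s₂) (p := min q 0) (g := fun σ => g₂ p σ - g₂ p' σ)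
    (h := fun σ => h₂ p σ - h₂ p' σ) (C := D * Real.exp (l * P)) hl (by positivity)
    (fun σ _ _ => (dg₂ σ).trans_eq (by ring)) (fun σ _ _ => (dh₂ σ).trans_eq (by ring))
  rw [← splitInt_sub_splitInt (cg₂ p) (ch₂ p) (cg₂ p') (ch₂ p')] at t3
  have hsplit : ∀ a b c b' c' : ℂ, ‖(a + b + c) - (a + b' + c')‖ ≤ ‖b - b'‖ + ‖c - c'‖ := by
    intro a b c b' c'
    calc _ = ‖(b - b') + (c - c')‖ := by congr 1; ring
      _ ≤ _ := norm_add_le _ _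
  refine (hsplit _ _ _ _ _).trans ?_
  calc
    _ ≤ 2 * (C * (Real.exp (l * P) * Real.exp (l * |q|))) * |p - p'| +
        4 * (D * Real.exp (l * P)) / l * Real.exp (l * |q|) := by
      refine add_le_add t2 (t3.trans ?_)
      gcongr
    _ = _ := by ring

/-- Dependence of `pathInt` on its second endpoint. -/
theorem norm_pathInt_sub_right_le (hl : 0 < l) (hC : 0 ≤ C) (hD : 0 ≤ D)
    (cg₁ : ∀ q, Continuous fun σ => g₁ σ q) (ch₁ : ∀ q, Continuous fun σ => h₁ σ q)
    (cg₂ : ∀ p, Continuous (g₂ p)) (ch₂ : ∀ p, Continuous (h₂ p))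
    (bg₂ : ∀ p q, ‖g₂ p q‖ ≤ C * Real.exp (l * (|p| + |q|)))
    (bh₂ : ∀ p q, ‖h₂ p q‖ ≤ C * Real.exp (l * (|p| + |q|)))
    {q q' Q : ℝ} (hq : |q| ≤ Q) (hq' : |q'| ≤ Q)
    (dg₁ : ∀ p, ‖g₁ p (max q 0) - g₁ p (max q' 0)‖ ≤ D * Real.exp (l * (|p| + Q)))
    (dh₁ : ∀ p, ‖h₁ p (max q 0) - h₁ p (max q' 0)‖ ≤ D * Real.exp (l * (|p| + Q))) (p : ℝ) :
    ‖pathInt s₁ s₂ g₁ h₁ g₂ h₂ p q - pathInt s₁ s₂ g₁ h₁ g₂ h₂ p q'‖ ≤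
      (4 * D / l + 4 * C * |q - q'|) * Real.exp (l * (|p| + Q)) := by
  simp only [exp_weight_add] at bg₂ bh₂ dg₁ dh₁ ⊢
  have e0 : Real.exp (l * |(0 : ℝ)|) ≤ Real.exp (l * |p|) := by
    simpa using mul_nonneg hl.le (abs_nonneg p)
  have m1 : |max q 0 - max q' 0| ≤ |q - q'| := by
    simpa using abs_max_sub_max_le_max q 0 q' 0
  have m2 : |min q 0 - min q' 0| ≤ |q - q'| := by
    simpa using abs_min_sub_min_le_max q 0 q' 0
  have hσ : ∀ a b, |a| ≤ Q → |b| ≤ Q → ∀ σ ∈ uIcc a b, |σ| ≤ Q := by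
    intro a b ha hb σ hσ
    rw [mem_uIcc] at hσ
    rw [abs_le] at *
    constructor <;> rcases hσ with h | h <;> linarith [h.1, h.2]
  have hb : ∀ r σ, |σ| ≤ Q → C * (Real.exp (l * r) * Real.exp (l * |σ|)) ≤
      C * (Real.exp (l * r) * Real.exp (l * Q)) := by
    intro r σ hσ'
    gcongr
  have h1 := hσ (max q 0) (max q' 0) ((abs_max_zero_le q).trans hq) ((abs_max_zero_le q').trans hq')
  have h2 := hσ (min q 0) (min q' 0) ((abs_min_zero_le q).trans hq) ((abs_min_zero_le q').trans hq')
  have t1 := norm_splitInt_endpoint_le (s := s₂) (cg₂ 0) (ch₂ 0)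
    (fun σ hσ => (bg₂ 0 _).trans (hb _ σ (h1 σ hσ))) (fun σ hσ => (bh₂ 0 _).trans (hb _ σ (h1 σ hσ)))
  have t3 := norm_splitInt_endpoint_le (s := s₂) (cg₂ p) (ch₂ p)
    (fun σ hσ => (bg₂ p _).trans (hb _ σ (h2 σ hσ))) (fun σ hσ => (bh₂ p _).trans (hb _ σ (h2 σ hσ)))
  have t2 := norm_splitInt_le (s := s₁) (p := p) (g := fun σ => g₁ σ (max q 0) - g₁ σ (max q' 0))
    (h := fun σ => h₁ σ (max q 0) - h₁ σ (max q' 0)) (C := D * Real.exp (l * Q)) hl (by positivity)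
    (fun σ _ _ => (dg₁ σ).trans_eq (by ring)) (fun σ _ _ => (dh₁ σ).trans_eq (by ring))
  rw [← splitInt_sub_splitInt (cg₁ _) (ch₁ _) (cg₁ _) (ch₁ _)] at t2
  have hsplit : ∀ a b c a' b' c' : ℂ, ‖(a + b + c) - (a' + b' + c')‖ ≤
      ‖a - a'‖ + ‖b - b'‖ + ‖c - c'‖ := by
    intro a b c a' b' c'
    calc _ = ‖(a - a') + (b - b') + (c - c')‖ := by congr 1; ring
      _ ≤ _ := (norm_add_le _ _).trans (add_le_add_left (norm_add_le _ _) _)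
  refine (hsplit _ _ _ _ _ _).trans ?_
  calc
    _ ≤ 2 * (C * (Real.exp (l * |p|) * Real.exp (l * Q))) * |q - q'| +
        4 * (D * Real.exp (l * Q)) / l * Real.exp (l * |p|) +
        2 * (C * (Real.exp (l * |p|) * Real.exp (l * Q))) * |q - q'| := by
      refine add_le_add (add_le_add (t1.trans ?_) t2) (t3.trans ?_)
      · gcongr 2 * (C * (?_ * _)) * ?_
      · gcongr
    _ = _ := by ring

end

/-- Exponentially weighted bound on all amplitudes. -/
def Amp.Bound (f : Amp) (l C : ℝ) : Prop :=
  ∀ k v x y z p q, ‖f k v (x, y, z, p, q)‖ ≤ C * Real.exp (l * (|p| + |q|))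

/-- Exponentially weighted Lipschitz bound on all amplitudes, in the labels at fixed times, and in
each time separately. -/
structure Amp.Lip (f : Amp) (l C : ℝ) : Prop where
  label : ∀ k v x y z x' y' z' p q D, |x - x'| ≤ D → |y - y'| ≤ D → |z - z'| ≤ D →
    ‖f k v (x, y, z, p, q) - f k v (x', y', z', p, q)‖ ≤ C * D * Real.exp (l * (|p| + |q|))
  left : ∀ k v x y z p p' P q, |p| ≤ P → |p'| ≤ P →
    ‖f k v (x, y, z, p, q) - f k v (x, y, z, p', q)‖ ≤
      C * |p - p'| * Real.exp (l * (P + |q|))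
  right : ∀ k v x y z p q q' Q, |q| ≤ Q → |q'| ≤ Q →
    ‖f k v (x, y, z, p, q) - f k v (x, y, z, p, q')‖ ≤
      C * |q - q'| * Real.exp (l * (|p| + Q))

/-- Bound on the coefficients. -/
structure Coeffs.Bound (K : Coeffs) (c : ℝ) : Prop where
  a : ∀ v, ‖K.a v‖ ≤ c
  a' : ∀ v, ‖K.a' v‖ ≤ c
  b : ∀ v, ‖K.b v‖ ≤ c
  b' : ∀ v, ‖K.b' v‖ ≤ c
  d : ∀ v, ‖K.d v‖ ≤ c
  d' : ∀ v, ‖K.d' v‖ ≤ c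

section

variable {K : Coeffs} {f : Amp} {l c C L : ℝ}

theorem norm_mul_le_mul_mul {k w : ℂ} {c B E : ℝ} (hk : ‖k‖ ≤ c) (hw : ‖w‖ ≤ B * E) :
    ‖k * w‖ ≤ c * B * E := by
  rw [norm_mul, mul_assoc]
  exact mul_le_mul hk hw (norm_nonneg _) ((norm_nonneg _).trans hk)

theorem Amp.Bound.step (hf : f.Bound l C) (hK : K.Bound c) (hl : 0 < l) (hc : 0 ≤ c)
    (hC : 0 ≤ C) : (K.step f).Bound l (12 * (c * C) / l) := by
  rintro (_ | _) v x y z p q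
  · refine norm_pathInt_le hl (by positivity) ?_ ?_ ?_ ?_ p q <;> intro p q
    · exact norm_mul_le_mul_mul (hK.a v) (hf _ _ _ _ _ _ _)
    · exact norm_mul_le_mul_mul (hK.a v) (hf _ _ _ _ _ _ _)
    · exact norm_mul_le_mul_mul (hK.a' v) (hf _ _ _ _ _ _ _)
    · exact norm_mul_le_mul_mul (hK.a' v) (hf _ _ _ _ _ _ _)
  · refine norm_pathInt_le hl (by positivity) ?_ ?_ ?_ ?_ p q <;> intro p q
    · exact norm_mul_le_mul_mul (hK.b v) (by simpa using hf .mixed (!v) (x + p) z y (-p) (-q))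
    · exact norm_mul_le_mul_mul (hK.d v) (hf _ _ _ _ _ _ _)
    · exact norm_mul_le_mul_mul (hK.d' v) (hf _ _ _ _ _ _ _)
    · exact norm_mul_le_mul_mul (hK.b' v) (by simpa using hf .mixed (!v) z (y + q) x (-p) (-q))

theorem norm_mul_sub_le {k w w' : ℂ} {c B D E : ℝ} (hk : ‖k‖ ≤ c) (hw : ‖w - w'‖ ≤ B * D * E) :
    ‖k * w - k * w'‖ ≤ c * B * D * E := by
  rw [← mul_sub, mul_assoc c]
  exact norm_mul_le_mul_mul hk hw

theorem Amp.Lip.step (hL : f.Lip l L) (hf : f.Bound l C) (hcont : f.Cont) (hK : K.Bound c)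
    (hl : 0 < l) (hc : 0 ≤ c) (hC : 0 ≤ C) (hL0 : 0 ≤ L) :
    (K.step f).Lip l (12 * (c * L) / l + 12 * (c * C)) where
  label := by
    rintro (_ | _) v x y z x' y' z' p q D hx hy hz
    · have hD : 0 ≤ D := (abs_nonneg _).trans hx
      refine (norm_pathInt_sub_le (C := c * C) (D := c * L * D) (S := 0) hl (by positivity)
        (by positivity) (hcont.u₁ v x y z) (hcont.u₁ v x y z) (hcont.u₂ v x y z) (hcont.u₂ v x y z)
        (hcont.u₁ v x' y' z') (hcont.u₁ v x' y' z') (hcont.u₂ v x' y' z') (hcont.u₂ v x' y' z')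
        (by simp) (by simp) ?_ ?_ ?_ ?_ ?_ ?_ ?_ ?_ p q).trans ?_
      on_goal 9 =>
        gcongr
        simp only [mul_zero, add_zero, add_mul]
        rw [div_mul_eq_mul_div, mul_assoc 12]
        exact le_add_of_nonneg_right (by positivity)
      all_goals intro p q
      · exact norm_mul_le_mul_mul (hK.a v) (hf _ _ _ _ _ _ _)
      · exact norm_mul_le_mul_mul (hK.a v) (hf _ _ _ _ _ _ _)
      · exact norm_mul_le_mul_mul (hK.a' v) (hf _ _ _ _ _ _ _)
      · exact norm_mul_le_mul_mul (hK.a' v) (hf _ _ _ _ _ _ _)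
      · exact norm_mul_sub_le (hK.a v) (hL.label _ _ _ _ _ _ _ _ _ _ _ hy hz (by simpa using hx))
      · exact norm_mul_sub_le (hK.a v) (hL.label _ _ _ _ _ _ _ _ _ _ _ hy hz (by simpa using hx))
      · exact norm_mul_sub_le (hK.a' v) (hL.label _ _ _ _ _ _ _ _ _ _ _ hx hy (by simpa using hz))
      · exact norm_mul_sub_le (hK.a' v) (hL.label _ _ _ _ _ _ _ _ _ _ _ hx hy (by simpa using hz))
    · have hD : 0 ≤ D := (abs_nonneg _).trans hx
      rw [abs_le] at hx hy hz
      refine (norm_pathInt_sub_le (C := c * C) (D := c * L * D) (S := 2 * D) hl (by positivity)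
        (by positivity) (hcont.m₁le v x y z) (hcont.m₁ge v x y z) (hcont.m₂le v x y z)
        (hcont.m₂ge v x y z) (hcont.m₁le v x' y' z') (hcont.m₁ge v x' y' z')
        (hcont.m₂le v x' y' z') (hcont.m₂ge v x' y' z')
        (by rw [abs_le]; constructor <;> linarith) (by rw [abs_le]; constructor <;> linarith)
        ?_ ?_ ?_ ?_ ?_ ?_ ?_ ?_ p q).trans ?_
      on_goal 9 =>
        gcongr
        apply le_of_eq
        ring
      all_goals intro p q
      · exact norm_mul_le_mul_mul (hK.b v) (by simpa using hf .mixed (!v) (x' + p) z' y' (-p) (-q))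
      · exact norm_mul_le_mul_mul (hK.d v) (hf _ _ _ _ _ _ _)
      · exact norm_mul_le_mul_mul (hK.d' v) (hf _ _ _ _ _ _ _)
      · exact norm_mul_le_mul_mul (hK.b' v) (by simpa using hf .mixed (!v) z' (y' + q) x' (-p) (-q))
      · refine norm_mul_sub_le (hK.b v) ?_
        rw [← abs_neg p, ← abs_neg q]
        refine hL.label _ _ _ _ _ _ _ _ _ _ _ ?_ ?_ ?_ <;> rw [abs_le] <;> constructor <;> linarith
      · refine norm_mul_sub_le (hK.d v) ?_
        refine hL.label _ _ _ _ _ _ _ _ _ _ _ ?_ ?_ ?_ <;> rw [abs_le] <;> constructor <;> linarith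
      · refine norm_mul_sub_le (hK.d' v) ?_
        refine hL.label _ _ _ _ _ _ _ _ _ _ _ ?_ ?_ ?_ <;> rw [abs_le] <;> constructor <;> linarith
      · refine norm_mul_sub_le (hK.b' v) ?_
        rw [← abs_neg p, ← abs_neg q]
        refine hL.label _ _ _ _ _ _ _ _ _ _ _ ?_ ?_ ?_ <;> rw [abs_le] <;> constructor <;> linarith
  left := by
    have hfin : ∀ p p' : ℝ, 4 * (c * L * |p - p'|) / l + 2 * (c * C) * |p - p'| ≤
        (12 * (c * L) / l + 12 * (c * C)) * |p - p'| := by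
      intro p p'
      rw [mul_div_right_comm, ← mul_assoc, ← mul_div_right_comm, ← add_mul]
      gcongr <;> norm_num
    rintro (_ | _) v x y z p p' P q hp hp'
    · refine (norm_pathInt_sub_left_le (C := c * C) (D := c * L * |p - p'|) hl (by positivity)
        (by positivity) (hcont.u₁ v x y z) (hcont.u₁ v x y z) (hcont.u₂ v x y z) (hcont.u₂ v x y z)
        ?_ ?_ hp hp' ?_ ?_ q).trans (mul_le_mul_of_nonneg_right (hfin p p') (Real.exp_pos _).le)
      · exact fun p q => norm_mul_le_mul_mul (hK.a v) (hf _ _ _ _ _ _ _)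
      · exact fun p q => norm_mul_le_mul_mul (hK.a v) (hf _ _ _ _ _ _ _)
      · exact fun q => norm_mul_sub_le (hK.a' v) (hL.left _ _ _ _ _ _ _ _ _ hp hp')
      · exact fun q => norm_mul_sub_le (hK.a' v) (hL.left _ _ _ _ _ _ _ _ _ hp hp')
    · refine (norm_pathInt_sub_left_le (C := c * C) (D := c * L * |p - p'|) hl (by positivity)
        (by positivity) (hcont.m₁le v x y z) (hcont.m₁ge v x y z) (hcont.m₂le v x y z)
        (hcont.m₂ge v x y z) ?_ ?_ hp hp' ?_ ?_ q).trans
        (mul_le_mul_of_nonneg_right (hfin p p') (Real.exp_pos _).le)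
      · exact fun p q => norm_mul_le_mul_mul (hK.b v)
          (by simpa using hf .mixed (!v) (x + p) z y (-p) (-q))
      · exact fun p q => norm_mul_le_mul_mul (hK.d v) (hf _ _ _ _ _ _ _)
      · exact fun q => norm_mul_sub_le (hK.d' v) (hL.left _ _ _ _ _ _ _ _ _ hp hp')
      · refine fun q => norm_mul_sub_le (hK.b' v) ?_
        have := hL.left .mixed (!v) z (y + q) x (-p) (-p') P (-q) (by simpa using hp)
          (by simpa using hp')
        rwa [neg_sub_neg, abs_sub_comm p' p, abs_neg] at this
  right := by
    have hfin : ∀ q q' : ℝ, 4 * (c * L * |q - q'|) / l + 4 * (c * C) * |q - q'| ≤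
        (12 * (c * L) / l + 12 * (c * C)) * |q - q'| := by
      intro p p'
      rw [mul_div_right_comm, ← mul_assoc, ← mul_div_right_comm, ← add_mul]
      gcongr <;> norm_num
    have hmax : ∀ q q' : ℝ, |max q 0 - max q' 0| ≤ |q - q'| := fun q q' => by
      simpa using abs_max_sub_max_le_max q 0 q' 0
    have hr : ∀ k v x y z p q q' Q, |q| ≤ Q → |q'| ≤ Q →
        ‖f k v (x, y, z, p, max q 0) - f k v (x, y, z, p, max q' 0)‖ ≤
          L * |q - q'| * Real.exp (l * (|p| + Q)) := by
      intro k v x y z p q q' Q hq hq'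
      refine (hL.right k v x y z p _ _ Q ((abs_max_zero_le q).trans hq)
        ((abs_max_zero_le q').trans hq')).trans ?_
      have := hmax q q'
      gcongr
    rintro (_ | _) v x y z p q q' Q hq hq'
    · refine (norm_pathInt_sub_right_le (C := c * C) (D := c * L * |q - q'|) hl (by positivity)
        (by positivity) (hcont.u₁ v x y z) (hcont.u₁ v x y z) (hcont.u₂ v x y z) (hcont.u₂ v x y z)
        ?_ ?_ hq hq' ?_ ?_ p).trans (mul_le_mul_of_nonneg_right (hfin q q') (Real.exp_pos _).le)
      · exact fun p q => norm_mul_le_mul_mul (hK.a' v) (hf _ _ _ _ _ _ _)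
      · exact fun p q => norm_mul_le_mul_mul (hK.a' v) (hf _ _ _ _ _ _ _)
      · exact fun p => norm_mul_sub_le (hK.a v) (hr _ _ _ _ _ _ _ _ _ hq hq')
      · exact fun p => norm_mul_sub_le (hK.a v) (hr _ _ _ _ _ _ _ _ _ hq hq')
    · refine (norm_pathInt_sub_right_le (C := c * C) (D := c * L * |q - q'|) hl (by positivity)
        (by positivity) (hcont.m₁le v x y z) (hcont.m₁ge v x y z) (hcont.m₂le v x y z)
        (hcont.m₂ge v x y z) ?_ ?_ hq hq' ?_ ?_ p).trans
        (mul_le_mul_of_nonneg_right (hfin q q') (Real.exp_pos _).le)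
      · exact fun p q => norm_mul_le_mul_mul (hK.d' v) (hf _ _ _ _ _ _ _)
      · exact fun p q => norm_mul_le_mul_mul (hK.b' v)
          (by simpa using hf .mixed (!v) z (y + q) x (-p) (-q))
      · refine fun p => norm_mul_sub_le (hK.b v) ?_
        have := hL.right .mixed (!v) (x + p) z y (-p) (-max q 0) (-max q' 0) Q
          (by simpa using (abs_max_zero_le q).trans hq)
          (by simpa using (abs_max_zero_le q').trans hq')
        rw [neg_sub_neg, abs_sub_comm (max q' 0), abs_neg] at this
        refine this.trans ?_
        have := hmax q q'
        gcongr
      · exact fun p => norm_mul_sub_le (hK.d v) (hr _ _ _ _ _ _ _ _ _ hq hq')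

end

/-! ### The Picard series -/

/-- The sum of the Picard iterates of `f₀`. -/
noncomputable def Coeffs.picard (K : Coeffs) (f₀ : Amp) : Amp :=
  fun k v X => ∑' n, (K.step^[n] f₀) k v X

/-- Amplitudes that do not depend on the times. -/
def Amp.Static (f : Amp) : Prop := ∀ k v x y z p q, f k v (x, y, z, p, q) = f k v (x, y, z, 0, 0)

section

variable {K : Coeffs} {f₀ : Amp} {c C L : ℝ}

theorem Amp.Cont.iterate (h : f₀.Cont) : ∀ n, (K.step^[n] f₀).Cont
  | 0 => h
  | n + 1 => by rw [Function.iterate_succ_apply']; exact (h.iterate n).step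

theorem Amp.Cont.zero : Amp.Cont (fun _ _ _ => 0) := fun _ _ => continuous_const

theorem Amp.Static.solves (h : f₀.Static) : K.Solves (fun _ _ _ => 0) f₀ := by
  constructor <;> intros <;> rw [h _ _ _ _ _ _ _, sub_eq_zero_of_eq (h _ _ _ _ _ _ _).symm] <;>
    simp [Coeffs.u₁, Coeffs.u₂, Coeffs.m₁le, Coeffs.m₁ge, Coeffs.m₂le, Coeffs.m₂ge]

theorem Coeffs.solves_iterate (hs : f₀.Static) (h : f₀.Cont) (n : ℕ) :
    K.Solves (K.step^[n] f₀) (K.step^[n + 1] f₀) := by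
  induction n with
  | zero => exact hs.solves.step h .zero
  | succ n ih =>
    rw [Function.iterate_succ_apply' K.step (n + 1)]
    exact ih.step (h.iterate _) (h.iterate _)

/-- With the weight `48 * c`, each Picard step gains a factor `1 / 4` in the sup norm. -/
theorem Amp.Bound.iterate (hf : f₀.Bound (48 * c) C) (hK : K.Bound c) (hc : 0 < c) (hC : 0 ≤ C) :
    ∀ n, (K.step^[n] f₀).Bound (48 * c) (C * (1 / 4) ^ n)
  | 0 => by simpa using hf
  | n + 1 => by
    rw [Function.iterate_succ_apply']
    have := (hf.iterate hK hc hC n).step hK (by positivity) hc.le (by positivity)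
    have e : 12 * (c * (C * (1 / 4) ^ n)) / (48 * c) = C * (1 / 4) ^ (n + 1) := by
      field_simp; ring
    rwa [e] at this

theorem Amp.Lip.mono {f : Amp} {l C C' : ℝ} (h : f.Lip l C) (hC : C ≤ C') : f.Lip l C' where
  label k v x y z x' y' z' p q D hx hy hz := by
    have hD : 0 ≤ D := (abs_nonneg _).trans hx
    refine (h.label k v x y z x' y' z' p q D hx hy hz).trans ?_
    gcongr
  left k v x y z p p' P q hp hp' := by
    refine (h.left k v x y z p p' P q hp hp').trans ?_
    gcongr
  right k v x y z p q q' Q hq hq' := by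
    refine (h.right k v x y z p q q' Q hq hq').trans ?_
    gcongr

/-- The Lipschitz constant of a Picard step involves a quarter of the former one and the sup norm, because
the thresholds and the ends of the path move. Both decay, so that the iterates decay in the Lipschitz norm. -/
theorem Amp.Lip.iterate (hL : f₀.Lip (48 * c) L) (hf : f₀.Bound (48 * c) C) (h : f₀.Cont)
    (hK : K.Bound c) (hc : 0 < c) (hC : 0 ≤ C) (hL0 : 0 ≤ L) :
    ∀ n, (K.step^[n] f₀).Lip (48 * c) ((L + 48 * c * C) * (1 / 2) ^ n)
  | 0 => hL.mono (by simp; positivity)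
  | n + 1 => by
    rw [Function.iterate_succ_apply']
    refine ((hL.iterate hf h hK hc hC hL0 n).step (hf.iterate hK hc hC n) (h.iterate n) hK
      (by positivity) hc.le (by positivity) (by positivity)).mono ?_
    have e : 12 * (c * ((L + 48 * c * C) * (1 / 2) ^ n)) / (48 * c) =
        (L + 48 * c * C) * (1 / 2) ^ n / 4 := by
      field_simp; ring
    have h4 : (1 / 4 : ℝ) ^ n ≤ (1 / 2) ^ n := by gcongr; norm_num
    have h5 : c * C * (1 / 4 : ℝ) ^ n ≤ c * C * (1 / 2) ^ n := by gcongr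
    have h6 : 0 ≤ L * (1 / 2 : ℝ) ^ n := by positivity
    rw [e, pow_succ]
    nlinarith

theorem Amp.Bound.norm_iterate_le (hf : f₀.Bound (48 * c) C) (hK : K.Bound c) (hc : 0 < c)
    (hC : 0 ≤ C) (k : Kind) (v : Bool) (n : ℕ) (X : ℝ × ℝ × ℝ × ℝ × ℝ) :
    ‖(K.step^[n] f₀) k v X‖ ≤
      C * Real.exp (48 * c * (|X.2.2.2.1| + |X.2.2.2.2|)) * (1 / 2) ^ n := by
  refine (hf.iterate hK hc hC n k v _ _ _ _ _).trans ?_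
  rw [mul_right_comm]
  gcongr
  norm_num

theorem Amp.Bound.summable (hf : f₀.Bound (48 * c) C) (hK : K.Bound c) (hc : 0 < c)
    (hC : 0 ≤ C) (k : Kind) (v : Bool) (X : ℝ × ℝ × ℝ × ℝ × ℝ) :
    Summable fun n => (K.step^[n] f₀) k v X :=
  (summable_geometric_two.mul_left _).of_norm_bounded (hf.norm_iterate_le hK hc hC k v · X)

theorem norm_tsum_le_of_geometric {u : ℕ → ℂ} {B : ℝ} (h : ∀ n, ‖u n‖ ≤ B * (1 / 2) ^ n) :
    ‖∑' n, u n‖ ≤ 2 * B := by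
  rw [mul_comm]
  exact tsum_of_norm_bounded (hasSum_geometric_two.mul_left B) h

theorem Amp.Bound.picard (hf : f₀.Bound (48 * c) C) (hK : K.Bound c) (hc : 0 < c) (hC : 0 ≤ C) :
    (K.picard f₀).Bound (48 * c) (2 * C) := by
  intro k v x y z p q
  rw [mul_assoc]
  exact norm_tsum_le_of_geometric (hf.norm_iterate_le hK hc hC k v · (x, y, z, p, q))

theorem Amp.Lip.picard (hL : f₀.Lip (48 * c) L) (hf : f₀.Bound (48 * c) C) (h : f₀.Cont)
    (hK : K.Bound c) (hc : 0 < c) (hC : 0 ≤ C) (hL0 : 0 ≤ L) :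
    (K.picard f₀).Lip (48 * c) (2 * (L + 48 * c * C)) := by
  have hi := fun n => hL.iterate hf h hK hc hC hL0 n
  have key : ∀ k v X X' B, (∀ n, ‖(K.step^[n] f₀) k v X - (K.step^[n] f₀) k v X'‖ ≤
      (L + 48 * c * C) * (1 / 2) ^ n * B) →
      ‖K.picard f₀ k v X - K.picard f₀ k v X'‖ ≤ 2 * (L + 48 * c * C) * B := by
    intro k v X X' B hn
    rw [Coeffs.picard, Coeffs.picard, ← (hf.summable hK hc hC k v X).tsum_sub
      (hf.summable hK hc hC k v X'), mul_assoc]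
    exact norm_tsum_le_of_geometric fun n => (hn n).trans_eq (by ring)
  constructor
  · intro k v x y z x' y' z' p q D hx hy hz
    rw [mul_assoc]
    refine key _ _ _ _ _ fun n => ?_
    rw [← mul_assoc]
    exact (hi n).label k v x y z x' y' z' p q D hx hy hz
  · intro k v x y z p p' P q hp hp'
    rw [mul_assoc]
    refine key _ _ _ _ _ fun n => ?_
    rw [← mul_assoc]
    exact (hi n).left k v x y z p p' P q hp hp'
  · intro k v x y z p q q' Q hq hq'
    rw [mul_assoc]
    refine key _ _ _ _ _ fun n => ?_
    rw [← mul_assoc]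
    exact (hi n).right k v x y z p q q' Q hq hq'

theorem Amp.Bound.hasSum_integral (hf : f₀.Bound (48 * c) C) (h : f₀.Cont) (hK : K.Bound c)
    (hc : 0 < c) (hC : 0 ≤ C) (k : Kind) (v : Bool) (w : ℂ) {γ : ℝ → ℝ × ℝ × ℝ × ℝ × ℝ}
    (hγ : Continuous γ) (s t : ℝ) :
    HasSum (fun n => ∫ σ in s..t, w * (K.step^[n] f₀) k v (γ σ))
      (∫ σ in s..t, w * K.picard f₀ k v (γ σ)) := by
  set E : ℝ → ℝ := fun σ => ‖w‖ * (C * Real.exp (48 * c * (|(γ σ).2.2.2.1| + |(γ σ).2.2.2.2|)))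
    with hE
  have hEc : Continuous E := by fun_prop
  refine intervalIntegral.hasSum_integral_of_dominated_convergence
    (fun n σ => E σ * (1 / 2) ^ n) (fun n => ?_) (fun n => ?_) ?_ ?_ ?_
  · exact (continuous_const.mul ((h.iterate n).comp k v hγ)).aestronglyMeasurable
  · refine .of_forall fun σ _ => ?_
    rw [norm_mul, hE, mul_assoc]
    gcongr
    exact hf.norm_iterate_le hK hc hC k v n (γ σ)
  · exact .of_forall fun σ _ => summable_geometric_two.mul_left _
  · simp only [tsum_mul_left]
    exact (hEc.mul continuous_const).intervalIntegrable _ _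
  · exact .of_forall fun σ _ => ((hf.summable hK hc hC k v (γ σ)).hasSum).mul_left w

/-- The Picard series solves the system. -/
theorem Coeffs.solves_picard (hs : f₀.Static) (hf : f₀.Bound (48 * c) C) (h : f₀.Cont)
    (hK : K.Bound c) (hc : 0 < c) (hC : 0 ≤ C) : K.Solves (K.picard f₀) (K.picard f₀) := by
  have key : ∀ (k : Kind) (v : Bool) (x y z p q p' q' : ℝ) (k' : Kind) (v' : Bool) (w : ℂ)
      (γ : ℝ → ℝ × ℝ × ℝ × ℝ × ℝ) (s t : ℝ), Continuous γ →
      (∀ n, (K.step^[n + 1] f₀) k v (x, y, z, p', q') - (K.step^[n + 1] f₀) k v (x, y, z, p, q) =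
        ∫ σ in s..t, w * (K.step^[n] f₀) k' v' (γ σ)) →
      K.picard f₀ k v (x, y, z, p', q') - K.picard f₀ k v (x, y, z, p, q) =
        ∫ σ in s..t, w * K.picard f₀ k' v' (γ σ) := by
    intro k v x y z p q p' q' k' v' w γ s t hγ hn
    have h1 := hf.hasSum_integral h hK hc hC k' v' w hγ s t
    simp only [← hn] at h1
    have h2 := ((hf.summable hK hc hC k v (x, y, z, p', q')).sub
      (hf.summable hK hc hC k v (x, y, z, p, q)))
    have h3 := h2.tsum_eq_zero_add
    rw [(hf.summable hK hc hC k v (x, y, z, p', q')).tsum_sub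
      (hf.summable hK hc hC k v (x, y, z, p, q)), h1.tsum_eq] at h3
    rw [Coeffs.picard, Coeffs.picard, h3]
    simp [hs k v x y z p' q', hs k v x y z p q]
  have hi := fun n => Coeffs.solves_iterate (K := K) hs h n
  constructor
  · intro v x y z p p' q h1 h2 h3 h4
    exact key _ _ _ _ _ _ _ _ _ _ _ _ _ _ _ (by fun_prop)
      fun n => (hi n).uniform₁ v x y z p p' q h1 h2 h3 h4
  · intro v x y z p q q' h1 h2 h3 h4
    exact key _ _ _ _ _ _ _ _ _ _ _ _ _ _ _ (by fun_prop)
      fun n => (hi n).uniform₂ v x y z p q q' h1 h2 h3 h4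
  · intro v x z y p p' q h1 h2 h3
    exact key _ _ _ _ _ _ _ _ _ _ _ _ _ _ _ (by fun_prop)
      fun n => (hi n).mixed₁le v x z y p p' q h1 h2 h3
  · intro v x z y p p' q h1 h2 h3 h4
    exact key _ _ _ _ _ _ _ _ _ _ _ _ _ _ _ (by fun_prop)
      fun n => (hi n).mixed₁ge v x z y p p' q h1 h2 h3 h4
  · intro v x z y p q q' h1 h2 h3 h4
    exact key _ _ _ _ _ _ _ _ _ _ _ _ _ _ _ (by fun_prop)
      fun n => (hi n).mixed₂le v x z y p q q' h1 h2 h3 h4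
  · intro v x z y p q q' h1 h2 h3
    exact key _ _ _ _ _ _ _ _ _ _ _ _ _ _ _ (by fun_prop)
      fun n => (hi n).mixed₂ge v x z y p q q' h1 h2 h3

theorem Coeffs.picard_zero (K : Coeffs) (f₀ : Amp) (k : Kind) (v : Bool) (x y z : ℝ) :
    K.picard f₀ k v (x, y, z, 0, 0) = f₀ k v (x, y, z, 0, 0) := by
  rw [Coeffs.picard, tsum_eq_single 0]
  · rfl
  · intro n hn
    obtain ⟨n, rfl⟩ := Nat.exists_eq_succ_of_ne_zero hn
    rw [Function.iterate_succ_apply']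
    cases k <;> simp [Coeffs.step]

/-- The Lipschitz bounds in the separate arguments give a joint one for bounded times. -/
theorem Amp.Lip.sub_le {f : Amp} {l C T : ℝ} (h : f.Lip l C) (hl : 0 ≤ l) (hC : 0 ≤ C) (k : Kind)
    (v : Bool) {x y z p q x' y' z' p' q' D : ℝ} (hx : |x - x'| ≤ D) (hy : |y - y'| ≤ D)
    (hz : |z - z'| ≤ D) (hp : |p - p'| ≤ D) (hq : |q - q'| ≤ D) (hpT : |p| ≤ T) (hpT' : |p'| ≤ T)
    (hqT : |q| ≤ T) (hqT' : |q'| ≤ T) :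
    ‖f k v (x, y, z, p, q) - f k v (x', y', z', p', q')‖ ≤
      3 * C * Real.exp (l * (2 * T)) * D := by
  have hD : 0 ≤ D := (abs_nonneg _).trans hx
  have e : ∀ a b : ℝ, a ≤ T → b ≤ T → Real.exp (l * (a + b)) ≤ Real.exp (l * (2 * T)) := by
    intro a b ha hb
    gcongr
    linarith
  have h1 := h.label k v x y z x' y' z' p q D hx hy hz
  have h2 := h.left k v x' y' z' p p' T q hpT hpT'
  have h3 := h.right k v x' y' z' p' q q' T hqT hqT'
  have e1 := e _ _ hpT hqT
  have e2 := e _ _ le_rfl hqT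
  have e3 := e _ _ hpT' le_rfl
  calc _ = ‖(f k v (x, y, z, p, q) - f k v (x', y', z', p, q)) +
        (f k v (x', y', z', p, q) - f k v (x', y', z', p', q)) +
        (f k v (x', y', z', p', q) - f k v (x', y', z', p', q'))‖ := by congr 1; ring
    _ ≤ _ := (norm_add_le _ _).trans (add_le_add_left (norm_add_le _ _) _)
    _ ≤ C * D * Real.exp (l * (2 * T)) + C * D * Real.exp (l * (2 * T)) +
        C * D * Real.exp (l * (2 * T)) := by
      refine add_le_add (add_le_add (h1.trans ?_) (h2.trans ?_)) (h3.trans ?_) <;> gcongr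
    _ = _ := by ring

theorem Amp.Lip.cont {f : Amp} {l C : ℝ} (h : f.Lip l C) (hl : 0 ≤ l) (hC : 0 ≤ C) : f.Cont := by
  intro k v
  rw [continuous_iff_continuousAt]
  rintro ⟨x, y, z, p, q⟩
  set T := max |p| |q| + 1 with hT
  have hmem : {X : ℝ × ℝ × ℝ × ℝ × ℝ | |X.2.2.2.1| < T ∧ |X.2.2.2.2| < T} ∈
      nhds (x, y, z, p, q) := by
    refine IsOpen.mem_nhds ?_ ⟨?_, ?_⟩
    · have c₁ : Continuous fun X : ℝ × ℝ × ℝ × ℝ × ℝ => |X.2.2.2.1| := by fun_prop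
      have c₂ : Continuous fun X : ℝ × ℝ × ℝ × ℝ × ℝ => |X.2.2.2.2| := by fun_prop
      exact (isOpen_lt c₁ continuous_const).inter (isOpen_lt c₂ continuous_const)
    · exact (le_max_left _ _).trans_lt (lt_add_one _)
    · exact (le_max_right _ _).trans_lt (lt_add_one _)
  have hpq := mem_of_mem_nhds hmem
  refine tendsto_iff_norm_sub_tendsto_zero.2 (squeeze_zero' (.of_forall fun _ => norm_nonneg _)
    (g := fun X : ℝ × ℝ × ℝ × ℝ × ℝ => 3 * C * Real.exp (l * (2 * T)) *
      (|X.1 - x| + |X.2.1 - y| + |X.2.2.1 - z| + |X.2.2.2.1 - p| + |X.2.2.2.2 - q|)) ?_ ?_)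
  · filter_upwards [hmem] with X hX
    have a1 := abs_nonneg (X.1 - x)
    have a2 := abs_nonneg (X.2.1 - y)
    have a3 := abs_nonneg (X.2.2.1 - z)
    have a4 := abs_nonneg (X.2.2.2.1 - p)
    have a5 := abs_nonneg (X.2.2.2.2 - q)
    exact h.sub_le hl hC k v (by linarith) (by linarith) (by linarith) (by linarith) (by linarith)
      hX.1.le hpq.1.le hX.2.le hpq.2.le
  · have : ContinuousAt (fun X : ℝ × ℝ × ℝ × ℝ × ℝ => 3 * C * Real.exp (l * (2 * T)) *
      (|X.1 - x| + |X.2.1 - y| + |X.2.2.1 - z| + |X.2.2.2.1 - p| + |X.2.2.2.2 - q|))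
      (x, y, z, p, q) := by fun_prop
    simpa [ContinuousAt] using this

end

/-! ### Null coordinates -/

/-- The sign of a velocity. -/
def sgn (v : Bool) : ℝ := if v then 1 else -1

theorem sgn_not (v : Bool) : sgn (!v) = -sgn v := by cases v <;> simp [sgn]

theorem sgn_mul_self (v : Bool) : sgn v * sgn v = 1 := by cases v <;> simp [sgn]

/-- The null coordinate `s_j - sgn v * t_j` of particle `j`, the label of its light ray of velocity
`sgn v`. -/
def null (v : Bool) (P : Config) (j : Fin 3) : ℝ := P j 1 - sgn v * P j 0

theorem continuous_null (v : Bool) (j : Fin 3) : Continuous fun P => null v P j := by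
  unfold null; fun_prop

theorem null_add (v : Bool) (P Q : Config) (j : Fin 3) :
    null v (P + Q) j = null v P j + null v Q j := by
  simp [null]; ring

theorem null_sub (v : Bool) (P Q : Config) (j : Fin 3) :
    null v (P - Q) j = null v P j - null v Q j := by
  simp [null]; ring

theorem null_smul (v : Bool) (r : ℝ) (P : Config) (j : Fin 3) :
    null v (r • P) j = r * null v P j := by
  simp [null]; ring

theorem abs_null_le (v : Bool) (P : Config) (j : Fin 3) : |null v P j| ≤ 2 * ‖P‖ := by
  have h : ∀ i, |P j i| ≤ ‖P‖ := fun i => (norm_le_pi_norm (P j) i).trans (norm_le_pi_norm P j)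
  have hs : |sgn v| = 1 := by cases v <;> simp [sgn]
  calc |null v P j| ≤ |P j 1| + |sgn v * P j 0| := abs_sub _ _
    _ ≤ _ := by rw [abs_mul, hs]; linarith [h 0, h 1]

theorem null_sub_null (v : Bool) (P : Config) (j : Fin 3) :
    null (!v) P j - null v P j = 2 * sgn v * P j 0 := by
  simp [null, sgn_not]; ring

theorem mem_S1_iff {P : Config} :
    P ∈ S1 ↔ ∀ v, null v P 1 < null v P 0 ∧ null v P 0 < null v P 2 := by
  have key : ∀ a b : ℝ, (a ^ 2 - b ^ 2 < 0 ∧ 0 < b) ↔ (-b < a ∧ a < b) := by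
    intro a b
    constructor
    · rintro ⟨h, hb⟩
      exact abs_lt.1 (abs_lt_of_sq_lt_sq (by linarith) hb.le)
    · rintro ⟨h1, h2⟩
      exact ⟨by nlinarith, by linarith⟩
  have h1 := key (P 0 0 - P 1 0) (P 0 1 - P 1 1)
  have h2 := key (P 0 0 - P 2 0) (P 2 1 - P 0 1)
  have e : (P 0 1 - P 2 1) ^ 2 = (P 2 1 - P 0 1) ^ 2 := by ring
  simp only [S1, spaceLike, mem_ofPred_eq, eta, Pi.sub_apply, Bool.forall_bool, null, sgn, e]
  simp only [Bool.false_eq_true, if_false, if_true]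
  constructor
  · rintro ⟨⟨a, b⟩, c, d⟩
    have := h1.1 ⟨a, by linarith⟩
    have := h2.1 ⟨b, by linarith⟩
    grind
  · intro h
    have a := h1.2 (by grind)
    have b := h2.2 (by grind)
    exact ⟨⟨a.1, b.1⟩, by linarith [a.2], by linarith [b.2]⟩

theorem isOpen_S1 : IsOpen S1 := by
  have : S1 = ⋂ v : Bool, {P | null v P 1 < null v P 0} ∩ {P | null v P 0 < null v P 2} := by
    ext P; simp [mem_S1_iff]
  rw [this]
  exact isOpen_iInter_of_finite fun v =>
    (isOpen_lt (continuous_null v 1) (continuous_null v 0)).inter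
      (isOpen_lt (continuous_null v 0) (continuous_null v 2))

/-- A configuration in `𝓢₁`; adding positive multiples of it moves `closure 𝓢₁` into `𝓢₁`. -/
def inward : Config := ![![0, 0], ![0, -1], ![0, 1] ]

theorem null_inward (v : Bool) : null v inward 0 = 0 ∧ null v inward 1 = -1 ∧
    null v inward 2 = 1 := by
  simp [null, inward]

theorem mem_closure_S1_iff {P : Config} :
    P ∈ closure S1 ↔ ∀ v, null v P 1 ≤ null v P 0 ∧ null v P 0 ≤ null v P 2 := by
  constructor
  · intro h
    have hc : IsClosed {P : Config | ∀ v, null v P 1 ≤ null v P 0 ∧ null v P 0 ≤ null v P 2} := by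
      have : {P : Config | ∀ v, null v P 1 ≤ null v P 0 ∧ null v P 0 ≤ null v P 2} =
          ⋂ v : Bool, {P | null v P 1 ≤ null v P 0} ∩ {P | null v P 0 ≤ null v P 2} := by
        ext P; simp
      rw [this]
      exact isClosed_iInter fun v =>
        (isClosed_le (continuous_null v 1) (continuous_null v 0)).inter
          (isClosed_le (continuous_null v 0) (continuous_null v 2))
    exact closure_minimal (fun Q hQ v => ⟨(mem_S1_iff.1 hQ v).1.le, (mem_S1_iff.1 hQ v).2.le⟩) hc h
  · intro h
    have hlim : Filter.Tendsto (fun r : ℝ => P + r • inward) (nhdsWithin 0 (Ioi 0)) (nhds P) := by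
      have : Continuous fun r : ℝ => P + r • inward := by fun_prop
      have := this.tendsto 0
      simp only [zero_smul, add_zero] at this
      exact this.mono_left nhdsWithin_le_nhds
    refine mem_closure_of_tendsto hlim ?_
    filter_upwards [self_mem_nhdsWithin] with r hr
    rw [mem_Ioi] at hr
    rw [mem_S1_iff]
    intro v
    obtain ⟨h0, h1, h2⟩ := null_inward v
    simp only [null_add, null_smul, h0, h1, h2]
    constructor <;> linarith [h v]

theorem add_inward_mem_S1 {P : Config} (hP : P ∈ closure S1) {r : ℝ} (hr : 0 < r) :
    P + r • inward ∈ S1 := by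
  rw [mem_S1_iff]
  intro v
  obtain ⟨h0, h1, h2⟩ := null_inward v
  have := mem_closure_S1_iff.1 hP v
  simp only [null_add, null_smul, h0, h1, h2]
  constructor <;> linarith

theorem isOpen_spaceLike : IsOpen spaceLike := by
  have h : ∀ j, IsOpen {p : Config | eta (p 0 - p j) < 0} := fun j =>
    isOpen_lt (by unfold eta; fun_prop) continuous_const
  exact (h 1).inter (h 2)

theorem S1_subset_spaceLike : S1 ⊆ spaceLike := fun _ h => h.1

theorem mem_C1_iff {P : Config} (hP : P ∈ closure S1) :
    P ∈ C1 ↔ ∀ v, null v P 1 = null v P 0 := by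
  have hn : (∀ v, null v P 1 = null v P 0) ↔ (P 1 1 = P 0 1 ∧ P 1 0 = P 0 0) := by
    simp only [null, Bool.forall_bool, sgn]
    simp only [Bool.false_eq_true, if_false, if_true]
    constructor
    · rintro ⟨h1, h2⟩; constructor <;> linarith
    · rintro ⟨h1, h2⟩; simp [h1, h2]
  rw [hn]
  refine ⟨fun h => h.2, fun h => ⟨?_, h⟩⟩
  rw [isOpen_spaceLike.frontier_eq]
  refine ⟨closure_mono S1_subset_spaceLike hP, fun hs => ?_⟩
  have := hs.1
  simp [eta, h.1, h.2] at this

theorem mem_C2_iff {P : Config} (hP : P ∈ closure S1) :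
    P ∈ C2 ↔ ∀ v, null v P 2 = null v P 0 := by
  have hn : (∀ v, null v P 2 = null v P 0) ↔ (P 2 1 = P 0 1 ∧ P 2 0 = P 0 0) := by
    simp only [null, Bool.forall_bool, sgn]
    simp only [Bool.false_eq_true, if_false, if_true]
    constructor
    · rintro ⟨h1, h2⟩; constructor <;> linarith
    · rintro ⟨h1, h2⟩; simp [h1, h2]
  rw [hn]
  refine ⟨fun h => h.2, fun h => ⟨?_, h⟩⟩
  rw [isOpen_spaceLike.frontier_eq]
  refine ⟨closure_mono S1_subset_spaceLike hP, fun hs => ?_⟩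
  have := hs.2
  simp [eta, h.1, h.2] at this

theorem null_atTimeZero (v : Bool) (s : Positions) (j : Fin 3) :
    null v (atTimeZero s) j = s j := by
  simp [null, atTimeZero]

theorem mem_closure_S1_atTimeZero {s : Positions} :
    atTimeZero s ∈ closure S1 ↔ s 1 ≤ s 0 ∧ s 0 ≤ s 2 := by
  simp [mem_closure_S1_iff, null_atTimeZero]

theorem mem_halfSpace {s : Positions} : s ∈ halfSpace ↔ s 1 ≤ s 0 ∧ s 0 ≤ s 2 := by
  rw [← mem_closure_S1_atTimeZero]
  exact ⟨fun h => h.2, fun h => ⟨closure_mono S1_subset_spaceLike h, h⟩⟩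

theorem halfSpace_subset_initialSurface : halfSpace ⊆ initialSurface := fun _ h => h.1

/-- The null vector of particle `j` along its ray of velocity `sgn v`, such that the other null
coordinate grows by one. -/
noncomputable def nullVec (j : Fin 3) (v : Bool) : Config := Pi.single j ![sgn v / 2, 1 / 2]

theorem null_nullVec_same (j : Fin 3) (v : Bool) (i : Fin 3) : null v (nullVec j v) i = 0 := by
  by_cases h : i = j
  · subst h
    have := sgn_mul_self v
    simp [null, nullVec]; linarith
  · simp [null, nullVec, Pi.single_eq_of_ne h]

theorem null_nullVec_other (j : Fin 3) (v : Bool) : null (!v) (nullVec j v) j = 1 := by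
  have := sgn_mul_self v
  simp [null, nullVec, sgn_not]; linarith

theorem null_nullVec_of_ne {i j : Fin 3} (h : i ≠ j) (v w : Bool) : null w (nullVec j v) i = 0 := by
  simp [null, nullVec, Pi.single_eq_of_ne h]

/-- The configuration with given null coordinates: `c j` for velocity `sgn v`, `o j` for the
opposite velocity. -/
noncomputable def ofNull (v : Bool) (c₀ o₀ c₁ o₁ c₂ o₂ : ℝ) : Config :=
  ![![sgn v * (o₀ - c₀) / 2, (o₀ + c₀) / 2], ![sgn v * (o₁ - c₁) / 2, (o₁ + c₁) / 2],
    ![sgn v * (o₂ - c₂) / 2, (o₂ + c₂) / 2] ]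

theorem config_ext (v : Bool) {P Q : Config} (h : ∀ j, null v P j = null v Q j)
    (h' : ∀ j, null (!v) P j = null (!v) Q j) : P = Q := by
  ext j i
  have h1 := h j
  have h2 := h' j
  simp only [null, sgn_not] at h1 h2
  have hs : P j 1 = Q j 1 := by linarith
  have ht : sgn v * P j 0 = sgn v * Q j 0 := by linarith
  have hv : sgn v ≠ 0 := fun h => by simpa [h] using sgn_mul_self v
  fin_cases i
  · exact mul_left_cancel₀ hv ht
  · exact hs

section

variable (v : Bool) (c₀ o₀ c₁ o₁ c₂ o₂ : ℝ)

theorem null_ofNull (j : Fin 3) : null v (ofNull v c₀ o₀ c₁ o₁ c₂ o₂) j = ![c₀, c₁, c₂] j := by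
  have := sgn_mul_self v
  fin_cases j <;> simp [null, ofNull] <;> grind

theorem null_not_ofNull (j : Fin 3) :
    null (!v) (ofNull v c₀ o₀ c₁ o₁ c₂ o₂) j = ![o₀, o₁, o₂] j := by
  have := sgn_mul_self v
  fin_cases j <;> simp [null, ofNull, sgn_not] <;> grind

theorem ofNull_null (P : Config) : ofNull v (null v P 0) (null (!v) P 0) (null v P 1)
    (null (!v) P 1) (null v P 2) (null (!v) P 2) = P := by
  refine config_ext v (fun j => ?_) fun j => ?_
  · rw [null_ofNull]; fin_cases j <;> rfl
  · rw [null_not_ofNull]; fin_cases j <;> rfl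

theorem ofNull_not : ofNull (!v) o₀ c₀ o₁ c₁ o₂ c₂ = ofNull v c₀ o₀ c₁ o₁ c₂ o₂ := by
  refine config_ext (!v) (fun j => ?_) fun j => ?_
  · rw [null_ofNull, null_not_ofNull]
  · rw [null_not_ofNull, Bool.not_not, null_ofNull]

variable {v c₀ o₀ c₁ o₁ c₂ o₂}

theorem ofNull_mem_closure_S1 : ofNull v c₀ o₀ c₁ o₁ c₂ o₂ ∈ closure S1 ↔
    (c₁ ≤ c₀ ∧ c₀ ≤ c₂) ∧ o₁ ≤ o₀ ∧ o₀ ≤ o₂ := by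
  have h1 := null_ofNull v c₀ o₀ c₁ o₁ c₂ o₂
  have h2 := null_not_ofNull v c₀ o₀ c₁ o₁ c₂ o₂
  have hall : ∀ p : Bool → Prop, (∀ w, p w) ↔ p v ∧ p (!v) := by
    intro p; cases v <;> simp [and_comm]
  rw [mem_closure_S1_iff, hall]
  simp [h1, h2]

end

/-! ### Spins and null derivatives -/

/-- The spin of a component that is transported along rays of velocity `sgn v`. -/
def raySpin (v : Bool) : Fin 2 := if v then 0 else 1

/-- The spin index all of whose entries belong to the velocity `v`, apart from the one at `o`. -/
def spin (v : Bool) : Option (Fin 3) → SpinIndex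
  | none => fun _ => raySpin v
  | some j => Function.update (fun _ => raySpin v) j (raySpin !v)

/-- The velocity of the majority of the entries of a spin index. -/
def majority (ς : SpinIndex) : Bool := if ς 0 = ς 1 then ς 0 = 0 else ς 2 = 0

/-- The entry of a spin index that differs from the two others. -/
def minority (ς : SpinIndex) : Option (Fin 3) :=
  if ς 0 = ς 1 then (if ς 1 = ς 2 then none else some 2) else if ς 0 = ς 2 then some 1 else some 0

theorem spin_majority_minority : ∀ ς : SpinIndex, spin (majority ς) (minority ς) = ς := by
  decide

theorem majority_spin : ∀ v o, majority (spin v o) = v := by decide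

theorem minority_spin : ∀ v o, minority (spin v o) = o := by decide

theorem raySpin_surjective : ∀ a : Fin 2, ∃ v, a = raySpin v := by decide

theorem gammaDir_self (j : Fin 3) (a : Fin 2) : gammaDir j a a = 0 := by
  fin_cases a <;> ext i μ <;> by_cases hi : i = j <;> fin_cases μ <;>
    simp [gammaDir, gamma, hi]

theorem gammaDir_raySpin (j : Fin 3) (v : Bool) :
    gammaDir j (raySpin !v) (raySpin v) = (2 * sgn v) • nullVec j v := by
  cases v <;> ext i μ <;> by_cases hi : i = j <;> fin_cases μ <;>
    simp [gammaDir, gamma, nullVec, raySpin, sgn, hi] <;> norm_num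

theorem sum_raySpin {M : Type*} [AddCommMonoid M] (v : Bool) (F : Fin 2 → M) :
    ∑ b, F b = F (raySpin v) + F (raySpin !v) := by
  cases v <;> simp [raySpin, Fin.sum_univ_two, add_comm]

/-- The coefficient of the flipped component in the null derivative of particle `j`. -/
noncomputable def massCoeff (ħ m : ℝ) (j : Fin 3) (v : Bool) : ℂ :=
  (sgn v / 2 : ℝ) * (-Complex.I * ((mass m j / ħ : ℝ) : ℂ))

/-- The Dirac equations, as equations for the null derivatives of all components. -/
def NullEquations (ħ m : ℝ) (Ψ : Config → Spinor) : Prop :=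
  ∀ P ∈ S1, ∀ j v ς, ς j = raySpin v → HasLineDerivAt ℝ (comp Ψ ς)
    (massCoeff ħ m j v * Ψ P (Function.update ς j (raySpin !v))) P (nullVec j v)

theorem two_sgn_mul_massCoeff (ħ m : ℝ) (j : Fin 3) (v : Bool) :
    ((2 * sgn v : ℝ) : ℂ) * massCoeff ħ m j v = -Complex.I * ((mass m j / ħ : ℝ) : ℂ) := by
  have : ((sgn v : ℝ) : ℂ) * (sgn v : ℝ) = 1 := by
    rw [← Complex.ofReal_mul, sgn_mul_self, Complex.ofReal_one]
  unfold massCoeff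
  push_cast
  linear_combination (-Complex.I * ((mass m j : ℂ) / (ħ : ℂ))) * this

theorem nullEquations_iff {ħ m : ℝ} (hħ : 0 < ħ) {Ψ : Config → Spinor} :
    NullEquations ħ m Ψ ↔ ((∀ p ∈ S1, ∀ j, DiracDifferentiableAt j Ψ p) ∧
      ∀ p ∈ S1, ∀ j, (-Complex.I * (ħ : ℂ)) • dirac j Ψ p + (mass m j : ℂ) • Ψ p = 0) := by
  have hħ' : (ħ : ℂ) ≠ 0 := by exact_mod_cast hħ.ne'
  have hI := Complex.I_mul_I
  have hval : ∀ p j v (ς : SpinIndex), ς j = raySpin v →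
      dirac j Ψ p (Function.update ς j (raySpin !v)) =
        lineDeriv ℝ (comp Ψ ς) p ((2 * sgn v) • nullVec j v) := by
    intro p j v ς hς
    have hu : Function.update ς j (raySpin v) = ς := by rw [← hς, Function.update_eq_self]
    simp only [dirac]
    rw [sum_raySpin v]
    simp only [Function.update_self, Function.update_idem, gammaDir_self, lineDeriv_zero, add_zero,
      gammaDir_raySpin, hu]
  constructor
  · intro h
    refine ⟨fun p hp j ς b => ?_, fun p hp j => ?_⟩
    · obtain ⟨v, rfl⟩ := raySpin_surjective b
      by_cases hb : ς j = raySpin v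
      · rw [hb, gammaDir_self]
        exact lineDifferentiableAt_zero
      · have hb' : ς j = raySpin !v := by
          revert hb; generalize ς j = a; revert a v; decide
        rw [hb', gammaDir_raySpin]
        exact ((h p hp j v _ (Function.update_self _ _ _)).smul _).lineDifferentiableAt
    · ext ς
      obtain ⟨v, hv⟩ := raySpin_surjective (ς j)
      have h1 := hval p j (!v) (Function.update ς j (raySpin !v)) (Function.update_self _ _ _)
      have h2 := (h p hp j (!v) (Function.update ς j (raySpin !v))
        (Function.update_self _ _ _)).smul (2 * sgn !v)
      simp only [Function.update_idem, Bool.not_not, ← hv, Function.update_eq_self] at h1 h2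
      simp only [Pi.add_apply, Pi.smul_apply, smul_eq_mul, Pi.zero_apply]
      have h3 := two_sgn_mul_massCoeff ħ m j (!v)
      have h4 : (ħ : ℂ) * ((mass m j / ħ : ℝ) : ℂ) = mass m j := by
        push_cast; field_simp
      rw [h1, h2.lineDeriv, Complex.real_smul]
      linear_combination (-Complex.I * ħ * Ψ p ς) * h3 + Complex.I ^ 2 * Ψ p ς * h4 +
        (mass m j : ℂ) * Ψ p ς * hI
  · rintro ⟨hd, he⟩ P hP j v ς hς
    have hu : Function.update ς j (raySpin v) = ς := by rw [← hς, Function.update_eq_self]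
    have h1 := hd P hP j (Function.update ς j (raySpin !v)) (raySpin v)
    simp only [Function.update_self, Function.update_idem, gammaDir_raySpin, hu] at h1
    have h2 := congrFun (he P hP j) (Function.update ς j (raySpin !v))
    simp only [Pi.add_apply, Pi.smul_apply, smul_eq_mul, Pi.zero_apply, hval P j v ς hς] at h2
    have hv : 2 * sgn v ≠ 0 := by cases v <;> simp [sgn]
    have h3 := h1.hasLineDerivAt.smul (2 * sgn v)⁻¹
    rw [smul_smul, inv_mul_cancel₀ hv, one_smul] at h3
    convert h3 using 1
    have hv' : ((2 * sgn v : ℝ) : ℂ) ≠ 0 := by exact_mod_cast hv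
    rw [Complex.real_smul, Complex.ofReal_inv, eq_inv_mul_iff_mul_eq₀ hv', ← mul_assoc,
      two_sgn_mul_massCoeff]
    push_cast
    field_simp
    linear_combination (-Complex.I) * h2 -
      (ħ : ℂ) * lineDeriv ℝ (comp Ψ ς) P ((2 * sgn v) • nullVec j v) * hI

/-! ### Wave functions from amplitudes -/

/-- Phases of the components with a minority entry at `j`, relative to the mixed amplitude. The
boundary conditions say that with these phases the three components with the same majority fit
together. -/
noncomputable def phase (θ₁ θ₂ : ℝ) (v : Bool) : Fin 3 → ℂ :=
  if v then ![Complex.exp (Complex.I * θ₂), Complex.exp (Complex.I * θ₁) * Complex.exp (Complex.I * θ₂), 1]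
  else ![Complex.exp (Complex.I * θ₁), 1, Complex.exp (Complex.I * θ₁) * Complex.exp (Complex.I * θ₂)]

section

variable {ħ m θ₁ θ₂ : ℝ}

theorem norm_phase (v : Bool) (j : Fin 3) : ‖phase θ₁ θ₂ v j‖ = 1 := by
  have h : ∀ θ : ℝ, ‖Complex.exp (Complex.I * θ)‖ = 1 := fun θ => by
    rw [mul_comm, Complex.norm_exp_ofReal_mul_I]
  cases v <;> fin_cases j <;> simp [phase, h]

theorem phase_ne_zero (v : Bool) (j : Fin 3) : phase θ₁ θ₂ v j ≠ 0 := by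
  rw [← norm_ne_zero_iff, norm_phase]; exact one_ne_zero

theorem phase_mul_phase_not (v : Bool) (i j : Fin 3) :
    phase θ₁ θ₂ v i * phase θ₁ θ₂ (!v) i = phase θ₁ θ₂ v j * phase θ₁ θ₂ (!v) j := by
  cases v <;> fin_cases i <;> fin_cases j <;> simp [phase] <;> ring

theorem massCoeff_zero (v : Bool) : massCoeff ħ m 0 v = 0 := by
  simp [massCoeff, mass]

theorem massCoeff_two (v : Bool) : massCoeff ħ m 2 v = massCoeff ħ m 1 v := by
  simp [massCoeff, mass]

theorem massCoeff_not (j : Fin 3) (v : Bool) : massCoeff ħ m j (!v) = -massCoeff ħ m j v := by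
  simp [massCoeff, sgn_not]; ring

theorem norm_massCoeff_one (hħ : 0 < ħ) (hm : 0 < m) (v : Bool) :
    ‖massCoeff ħ m 1 v‖ = m / ħ / 2 := by
  have hs : |sgn v| = 1 := by cases v <;> simp [sgn]
  simp [massCoeff, mass, hs, abs_of_pos hħ, abs_of_pos hm]
  ring

variable (ħ m θ₁ θ₂)

/-- The coefficients of the system for the amplitudes of a solution of the Dirac equations. -/
noncomputable def waveCoeffs : Coeffs where
  a v := massCoeff ħ m 1 v * phase θ₁ θ₂ v 1
  a' v := massCoeff ħ m 1 v * phase θ₁ θ₂ v 2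
  b v := massCoeff ħ m 1 v * phase θ₁ θ₂ (!v) 2 / phase θ₁ θ₂ v 0
  b' v := massCoeff ħ m 1 v * phase θ₁ θ₂ (!v) 1 / phase θ₁ θ₂ v 0
  d v := massCoeff ħ m 1 v / phase θ₁ θ₂ v 1
  d' v := massCoeff ħ m 1 v / phase θ₁ θ₂ v 2
  comm_uniform v := by
    linear_combination (massCoeff ħ m 1 v ^ 2 / phase θ₁ θ₂ v 0) *
      phase_mul_phase_not (θ₁ := θ₁) (θ₂ := θ₂) v 1 2
  comm_le_ge v := by
    have h := phase_ne_zero (θ₁ := θ₁) (θ₂ := θ₂)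
    field_simp [h]
  comm_ge_ge v := by
    have h := phase_ne_zero (θ₁ := θ₁) (θ₂ := θ₂)
    have h0 := phase_mul_phase_not (θ₁ := θ₁) (θ₂ := θ₂) v 1 0
    have e : phase θ₁ θ₂ v 2 / phase θ₁ θ₂ v 1 = phase θ₁ θ₂ (!v) 1 / phase θ₁ θ₂ v 0 *
        (phase θ₁ θ₂ v 2 / phase θ₁ θ₂ (!v) 0) := by
      rw [div_mul_div_comm, div_eq_div_iff (h _ _) (mul_ne_zero (h _ _) (h _ _)), ← h0]; ring
    rw [massCoeff_not, Bool.not_not]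
    linear_combination massCoeff ħ m 1 v ^ 2 * e
  comm_le_le v := by
    have h := phase_ne_zero (θ₁ := θ₁) (θ₂ := θ₂)
    have h0 := phase_mul_phase_not (θ₁ := θ₁) (θ₂ := θ₂) v 2 0
    have e : phase θ₁ θ₂ v 1 / phase θ₁ θ₂ v 2 = phase θ₁ θ₂ (!v) 2 / phase θ₁ θ₂ v 0 *
        (phase θ₁ θ₂ v 1 / phase θ₁ θ₂ (!v) 0) := by
      rw [div_mul_div_comm, div_eq_div_iff (h _ _) (mul_ne_zero (h _ _) (h _ _)), ← h0]; ring
    rw [massCoeff_not, Bool.not_not]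
    linear_combination massCoeff ħ m 1 v ^ 2 * e

variable {ħ m θ₁ θ₂}

theorem bound_waveCoeffs (hħ : 0 < ħ) (hm : 0 < m) : (waveCoeffs ħ m θ₁ θ₂).Bound (m / ħ / 2) := by
  constructor <;> intro v <;>
    simp [waveCoeffs, norm_massCoeff_one hħ hm, norm_phase]

/-- The time of particle `j`, up to the factor `±2`, as the difference of its null coordinates. -/
def gap (v : Bool) (P : Config) (j : Fin 3) : ℝ := null (!v) P j - null v P j

theorem gap_not (v : Bool) (P : Config) (j : Fin 3) : gap (!v) P j = -gap v P j := by
  simp [gap]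

theorem abs_gap (v : Bool) (P : Config) (j : Fin 3) : |gap v P j| = 2 * |P j 0| := by
  have hs : |sgn v| = 1 := by cases v <;> simp [sgn]
  rw [gap, null_sub_null, abs_mul, abs_mul, hs]; simp

theorem gap_sub (v : Bool) (P Q : Config) (j : Fin 3) :
    gap v (P - Q) j = gap v P j - gap v Q j := by
  simp only [gap, null_sub]; ring

variable (θ₁ θ₂) in
/-- The component with majority velocity `sgn v` and minority entry `o` of the wave function with
amplitudes `F`. It does not depend on the null coordinate of the photon that changes along the rays of
this component. -/
noncomputable def component (F : Amp) (v : Bool) : Option (Fin 3) → Config → ℂ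
  | none, P => F .uniform v (null v P 1, null v P 0, null v P 2, gap v P 1, gap v P 2)
  | some 0, P => phase θ₁ θ₂ v 0 *
      F .mixed v (null v P 1, null v P 2, null (!v) P 0, gap v P 1, gap v P 2)
  | some 1, P => phase θ₁ θ₂ v 1 *
      F .mixed v (null v P 0, null v P 2, null (!v) P 1, gap v P 1, gap v P 2)
  | some 2, P => phase θ₁ θ₂ v 2 *
      F .mixed v (null v P 1, null v P 0, null (!v) P 2, gap v P 1, gap v P 2)

variable (θ₁ θ₂) in
open Classical in
/-- The wave function with given amplitudes, cut off outside `closure 𝓢₁`. -/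
noncomputable def wave (F : Amp) (P : Config) : Spinor := fun ς =>
  if P ∈ closure S1 then component θ₁ θ₂ F (majority ς) (minority ς) P else 0

theorem wave_spin {F : Amp} {P : Config} (hP : P ∈ closure S1) (v : Bool) (o : Option (Fin 3)) :
    wave θ₁ θ₂ F P (spin v o) = component θ₁ θ₂ F v o P := by
  simp [wave, hP, majority_spin, minority_spin]

theorem wave_of_notMem {F : Amp} {P : Config} (hP : P ∉ closure S1) : wave θ₁ θ₂ F P = 0 := by
  ext ς; simp [wave, hP]

theorem continuous_gap (v : Bool) (j : Fin 3) : Continuous fun P => gap v P j :=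
  (continuous_null _ _).sub (continuous_null _ _)

theorem continuous_component {F : Amp} (hF : F.Cont) (v : Bool) (o : Option (Fin 3)) :
    Continuous (component θ₁ θ₂ F v o) := by
  have hn := continuous_null
  have hg := continuous_gap
  rcases o with _ | j
  · exact hF.comp .uniform v (by fun_prop)
  · fin_cases j <;> exact continuous_const.mul (hF.comp .mixed v (by fun_prop))

theorem continuousOn_wave {F : Amp} (hF : F.Cont) : ContinuousOn (wave θ₁ θ₂ F) (closure S1) := by
  refine continuousOn_pi.2 fun ς => ?_
  refine (continuous_component (θ₁ := θ₁) (θ₂ := θ₂) hF (majority ς) (minority ς)).continuousOn.congr fun P hP => ?_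
  simp [wave, hP]

theorem norm_wave_le {F : Amp} {l C T : ℝ} (hF : F.Bound l C) (hl : 0 ≤ l) (hC : 0 ≤ C)
    {P : Config} (hP : P ∈ timeSlab T) : ‖wave θ₁ θ₂ F P‖ ≤ C * Real.exp (l * (4 * T)) := by
  refine (pi_norm_le_iff_of_nonneg (by positivity)).2 fun ς => ?_
  have hg : ∀ v j, |gap v P j| ≤ 2 * T := fun v j => by rw [abs_gap]; linarith [hP j]
  have key : ∀ k v x y z, ‖F k v (x, y, z, gap v P 1, gap v P 2)‖ ≤
      C * Real.exp (l * (4 * T)) := by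
    intro k v x y z
    refine (hF k v x y z _ _).trans ?_
    have : |gap v P 1| + |gap v P 2| ≤ 4 * T := by linarith [hg v 1, hg v 2]
    gcongr
  by_cases hS : P ∈ closure S1
  · simp only [wave, hS, if_true]
    generalize majority ς = v
    generalize minority ς = o
    rcases o with _ | j
    · exact key _ _ _ _ _
    · fin_cases j <;> simp only [component, norm_mul, norm_phase, one_mul] <;> exact key _ _ _ _ _
  · rw [wave_of_notMem hS]
    simp; positivity

theorem norm_wave_sub_le {F : Amp} {l C T : ℝ} (hF : F.Lip l C) (hl : 0 ≤ l) (hC : 0 ≤ C)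
    {P Q : Config} (hP : P ∈ closure S1 ∩ timeSlab T) (hQ : Q ∈ closure S1 ∩ timeSlab T) :
    ‖wave θ₁ θ₂ F P - wave θ₁ θ₂ F Q‖ ≤ 6 * C * Real.exp (l * (4 * T)) * ‖P - Q‖ := by
  refine (pi_norm_le_iff_of_nonneg (by positivity)).2 fun ς => ?_
  have hg : ∀ R ∈ timeSlab T, ∀ v j, |gap v R j| ≤ 2 * T := fun R hR v j => by
    rw [abs_gap]; linarith [hR j]
  have hn : ∀ v j, |null v P j - null v Q j| ≤ 2 * ‖P - Q‖ := fun v j => by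
    rw [← null_sub]; exact abs_null_le _ _ _
  have hd : ∀ v j, |gap v P j - gap v Q j| ≤ 2 * ‖P - Q‖ := fun v j => by
    rw [← gap_sub, abs_gap]
    have := (norm_le_pi_norm ((P - Q) j) 0).trans (norm_le_pi_norm (P - Q) j)
    rw [Real.norm_eq_abs] at this
    linarith
  have key : ∀ k v x y z x' y' z', |x - x'| ≤ 2 * ‖P - Q‖ → |y - y'| ≤ 2 * ‖P - Q‖ →
      |z - z'| ≤ 2 * ‖P - Q‖ →
      ‖F k v (x, y, z, gap v P 1, gap v P 2) - F k v (x', y', z', gap v Q 1, gap v Q 2)‖ ≤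
        6 * C * Real.exp (l * (4 * T)) * ‖P - Q‖ := by
    intro k v x y z x' y' z' hx hy hz
    refine (hF.sub_le hl hC k v hx hy hz (hd v 1) (hd v 2) (hg P hP.2 v 1) (hg Q hQ.2 v 1)
      (hg P hP.2 v 2) (hg Q hQ.2 v 2)).trans (le_of_eq ?_)
    rw [show 2 * (2 * T) = 4 * T by ring]; ring
  simp only [wave, hP.1, hQ.1, if_true, Pi.sub_apply]
  generalize majority ς = v
  generalize minority ς = o
  rcases o with _ | j
  · exact key _ _ _ _ _ _ _ _ (hn _ _) (hn _ _) (hn _ _)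
  · fin_cases j <;> simp only [component, ← mul_sub, norm_mul, norm_phase, one_mul] <;>
      exact key _ _ _ _ _ _ _ _ (hn _ _) (hn _ _) (hn _ _)

/-- The boundary conditions in terms of spins and phases. -/
theorem boundaryCondition_iff {P : Config} {ψ : Spinor} (hP : P ∈ closure S1) :
    BoundaryCondition θ₁ θ₂ P ψ ↔
      ((∀ v, null v P 1 = null v P 0) → ∀ v,
        phase θ₁ θ₂ v 0 * ψ (spin v (some 1)) = phase θ₁ θ₂ v 1 * ψ (spin v (some 0))) ∧
      ((∀ v, null v P 2 = null v P 0) → ∀ v,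
        phase θ₁ θ₂ v 0 * ψ (spin v (some 2)) = phase θ₁ θ₂ v 2 * ψ (spin v (some 0))) := by
  have e : spin true (some 0) = ![1, 0, 0] ∧ spin true (some 1) = ![0, 1, 0] ∧
      spin true (some 2) = ![0, 0, 1] ∧ spin false (some 0) = ![0, 1, 1] ∧
      spin false (some 1) = ![1, 0, 1] ∧ spin false (some 2) = ![1, 1, 0] := by decide
  obtain ⟨e1, e2, e3, e4, e5, e6⟩ := e
  have h1 := Complex.exp_ne_zero (Complex.I * θ₁)
  have h2 := Complex.exp_ne_zero (Complex.I * θ₂)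
  rw [BoundaryCondition, mem_C1_iff hP, mem_C2_iff hP]
  refine and_congr (imp_congr_right fun _ => ?_) (imp_congr_right fun _ => ?_)
  · simp only [Fin.forall_fin_two, Bool.forall_bool, e1, e2, e4, e5, phase, if_true,
      Bool.false_eq_true, if_false, Matrix.cons_val_zero, Matrix.cons_val_one, one_mul]
    rw [and_comm]
    refine and_congr eq_comm ?_
    rw [mul_comm (Complex.exp (Complex.I * θ₁)) (Complex.exp (Complex.I * θ₂)), mul_assoc,
      mul_right_inj' h2]
  · simp only [Fin.forall_fin_two, Bool.forall_bool, e1, e3, e4, e6, phase, if_true,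
      Bool.false_eq_true, if_false, Matrix.cons_val_zero, Matrix.cons_val_two, one_mul,
      Matrix.tail_cons, Matrix.head_cons]
    rw [and_comm]
    refine and_congr ?_ eq_comm
    rw [mul_assoc, mul_right_inj' h1]

theorem boundaryCondition_wave (F : Amp) (P : Config) :
    BoundaryCondition θ₁ θ₂ P (wave θ₁ θ₂ F P) := by
  by_cases hP : P ∈ closure S1
  · refine (boundaryCondition_iff hP).2 ⟨fun h v => ?_, fun h v => ?_⟩ <;>
      simp only [wave_spin hP, component, h] <;> ring
  · rw [wave_of_notMem hP]
    constructor <;> intros <;> simp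

end

/-! ### The null derivatives of the wave function -/

theorem hasDerivAt_of_sub_eq_integral {φ G : ℝ → ℂ} {p : ℝ} (hG : Continuous G)
    (h : ∀ᶠ p' in nhds p, φ p' - φ p = ∫ σ in p..p', G σ) : HasDerivAt φ (G p) p := by
  have h1 : HasDerivAt (fun p' => φ p + ∫ σ in p..p', G σ) (G p) p :=
    (intervalIntegral.integral_hasDerivAt_right (hG.intervalIntegrable _ _)
      (hG.stronglyMeasurableAtFilter _ _) hG.continuousAt).const_add _
  refine h1.congr_of_eventuallyEq ?_
  filter_upwards [h] with p' hp'
  rw [← hp']; ring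

namespace Coeffs.Solves

variable {K : Coeffs} {F : Amp}

theorem hasDerivAt_uniform₁ (h : K.Solves F F) (hF : F.Cont) (v : Bool) {x y z p q : ℝ}
    (hxy : x ≤ y) (hyz : y ≤ z) (hp : x + p < z + q) :
    HasDerivAt (fun p => F .uniform v (x, y, z, p, q)) (K.u₁ F v x y z p q) p := by
  refine hasDerivAt_of_sub_eq_integral (hF.u₁ (K := K) v x y z q) ?_
  filter_upwards [Iio_mem_nhds (show p < z + q - x by linarith)] with p' hp'
  rw [mem_Iio] at hp'
  exact h.uniform₁ v x y z p p' q hxy hyz hp.le (by linarith)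

theorem hasDerivAt_uniform₂ (h : K.Solves F F) (hF : F.Cont) (v : Bool) {x y z p q : ℝ}
    (hxy : x ≤ y) (hyz : y ≤ z) (hp : x + p < z + q) :
    HasDerivAt (fun q => F .uniform v (x, y, z, p, q)) (K.u₂ F v x y z p q) q := by
  refine hasDerivAt_of_sub_eq_integral (hF.u₂ (K := K) v x y z p) ?_
  filter_upwards [Ioi_mem_nhds (show x + p - z < q by linarith)] with q' hq'
  rw [mem_Ioi] at hq'
  exact h.uniform₂ v x y z p q q' hxy hyz hp.le (by linarith)

theorem hasDerivAt_mixed₁le (h : K.Solves F F) (hF : F.Cont) (v : Bool) {x z y p q : ℝ}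
    (hxz : x ≤ z) (hp : p < y - x) :
    HasDerivAt (fun p => F .mixed v (x, z, y, p, q)) (K.m₁le F v x z y p q) p := by
  refine hasDerivAt_of_sub_eq_integral (hF.m₁le (K := K) v x z y q) ?_
  filter_upwards [Iio_mem_nhds hp] with p' hp'
  exact h.mixed₁le v x z y p p' q hxz hp.le (le_of_lt hp')

theorem hasDerivAt_mixed₁ge (h : K.Solves F F) (hF : F.Cont) (v : Bool) {x z y p q : ℝ}
    (hxz : x ≤ z) (hp : y - x < p) (hq : y - z ≤ q) :
    HasDerivAt (fun p => F .mixed v (x, z, y, p, q)) (K.m₁ge F v x z y p q) p := by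
  refine hasDerivAt_of_sub_eq_integral (hF.m₁ge (K := K) v x z y q) ?_
  filter_upwards [Ioi_mem_nhds hp] with p' hp'
  exact h.mixed₁ge v x z y p p' q hxz hp.le (le_of_lt hp') hq

theorem hasDerivAt_mixed₂le (h : K.Solves F F) (hF : F.Cont) (v : Bool) {x z y p q : ℝ}
    (hxz : x ≤ z) (hq : q < y - z) (hp : p ≤ y - x) :
    HasDerivAt (fun q => F .mixed v (x, z, y, p, q)) (K.m₂le F v x z y p q) q := by
  refine hasDerivAt_of_sub_eq_integral (hF.m₂le (K := K) v x z y p) ?_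
  filter_upwards [Iio_mem_nhds hq] with q' hq'
  exact h.mixed₂le v x z y p q q' hxz hq.le (le_of_lt hq') hp

theorem hasDerivAt_mixed₂ge (h : K.Solves F F) (hF : F.Cont) (v : Bool) {x z y p q : ℝ}
    (hxz : x ≤ z) (hq : y - z < q) :
    HasDerivAt (fun q => F .mixed v (x, z, y, p, q)) (K.m₂ge F v x z y p q) q := by
  refine hasDerivAt_of_sub_eq_integral (hF.m₂ge (K := K) v x z y p) ?_
  filter_upwards [Ioi_mem_nhds hq] with q' hq'
  exact h.mixed₂ge v x z y p q q' hxz hq.le (le_of_lt hq')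

end Coeffs.Solves

/-- Entries of a spin index along rays of velocity `sgn v` belong to the majority, or they are the
minority entry of an index with the opposite majority. -/
theorem eq_spin_of_apply_eq : ∀ (ς : SpinIndex) j v, ς j = raySpin v →
    (∃ o, o ≠ some j ∧ ς = spin v o) ∨ ς = spin (!v) (some j) := by
  decide

theorem update_spin_none : ∀ j v, Function.update (spin v none) j (raySpin !v) = spin v (some j) := by
  decide

theorem update_spin_self : ∀ j v,
    Function.update (spin (!v) (some j)) j (raySpin !v) = spin (!v) none := by
  decide

theorem update_spin_ne : ∀ v,
    (Function.update (spin v (some 0)) 1 (raySpin !v) = spin (!v) (some 2) ∧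
      Function.update (spin v (some 2)) 1 (raySpin !v) = spin (!v) (some 0)) ∧
    Function.update (spin v (some 0)) 2 (raySpin !v) = spin (!v) (some 1) ∧
      Function.update (spin v (some 1)) 2 (raySpin !v) = spin (!v) (some 0) := by
  decide

section

variable {ħ m θ₁ θ₂ : ℝ} {F : Amp}

theorem null_add_nullVec (v : Bool) (P : Config) (j i : Fin 3) (t : ℝ) :
    null v (P + t • nullVec j v) i = null v P i := by
  rw [null_add, null_smul, null_nullVec_same, mul_zero, add_zero]

theorem null_not_add_nullVec (v : Bool) (P : Config) (j : Fin 3) (t : ℝ) :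
    null (!v) (P + t • nullVec j v) j = null (!v) P j + t := by
  rw [null_add, null_smul, null_nullVec_other, mul_one]

theorem null_not_add_nullVec_of_ne (v : Bool) (P : Config) {j i : Fin 3} (h : i ≠ j) (t : ℝ) :
    null (!v) (P + t • nullVec j v) i = null (!v) P i := by
  rw [null_add, null_smul, null_nullVec_of_ne h, mul_zero, add_zero]

theorem gap_add_nullVec (v : Bool) (P : Config) (j : Fin 3) (t : ℝ) :
    gap v (P + t • nullVec j v) j = gap v P j + t := by
  rw [gap, null_not_add_nullVec, null_add_nullVec, gap]; ring

theorem gap_add_nullVec_of_ne (v : Bool) (P : Config) {j i : Fin 3} (h : i ≠ j) (t : ℝ) :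
    gap v (P + t • nullVec j v) i = gap v P i := by
  rw [gap, null_not_add_nullVec_of_ne _ _ h, null_add_nullVec, gap]

/-- The components of the wave function of a solution of the system satisfy the equations of the
first electron. -/
theorem hasLineDerivAt_component_one (h : (waveCoeffs ħ m θ₁ θ₂).Solves F F) (hF : F.Cont)
    {P : Config} (hP : P ∈ S1) (v : Bool) :
    (HasLineDerivAt ℝ (component θ₁ θ₂ F v none)
        (massCoeff ħ m 1 v * component θ₁ θ₂ F v (some 1) P) P (nullVec 1 v) ∧
      HasLineDerivAt ℝ (component θ₁ θ₂ F v (some 0))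
        (massCoeff ħ m 1 v * component θ₁ θ₂ F (!v) (some 2) P) P (nullVec 1 v)) ∧
    HasLineDerivAt ℝ (component θ₁ θ₂ F v (some 2))
        (massCoeff ħ m 1 v * component θ₁ θ₂ F (!v) (some 0) P) P (nullVec 1 v) ∧
      HasLineDerivAt ℝ (component θ₁ θ₂ F (!v) (some 1))
        (massCoeff ħ m 1 v * component θ₁ θ₂ F (!v) none P) P (nullVec 1 v) := by
  have hk := phase_ne_zero (θ₁ := θ₁) (θ₂ := θ₂)
  have h20 : (2 : Fin 3) ≠ 1 := by decide
  have h01 : (0 : Fin 3) ≠ 1 := by decide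
  have hS := mem_S1_iff.1 hP
  obtain ⟨hv1, hv2⟩ := hS v
  obtain ⟨hw1, hw2⟩ := hS (!v)
  simp only [HasLineDerivAt]
  simp only [component, Bool.not_not, gap_not, null_add_nullVec, gap_add_nullVec,
    null_not_add_nullVec_of_ne _ _ h20, null_not_add_nullVec_of_ne _ _ h01,
    gap_add_nullVec_of_ne _ _ h20]
  have e1 : null (!v) P 1 = null v P 1 + gap v P 1 := by rw [gap]; ring
  have e2 : null (!v) P 2 = null v P 2 + gap v P 2 := by rw [gap]; ring
  refine ⟨⟨?_, ?_⟩, ?_, ?_⟩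
  · have := h.hasDerivAt_uniform₁ hF v (x := null v P 1) (y := null v P 0) (z := null v P 2)
      (p := gap v P 1 + 0) (q := gap v P 2) hv1.le hv2.le (by linarith)
    refine (this.comp_const_add _ _).congr_deriv ?_
    simp only [Coeffs.u₁, waveCoeffs, add_zero, e1]
    ring
  · have := h.hasDerivAt_mixed₁le hF v (x := null v P 1) (z := null v P 2) (y := null (!v) P 0)
      (p := gap v P 1 + 0) (q := gap v P 2) (by linarith) (by linarith)
    refine ((this.comp_const_add _ _).const_mul _).congr_deriv ?_
    simp only [Coeffs.m₁le, waveCoeffs, add_zero, e1]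
    field_simp [hk]
  · have := h.hasDerivAt_mixed₁le hF v (x := null v P 1) (z := null v P 0) (y := null (!v) P 2)
      (p := gap v P 1 + 0) (q := gap v P 2) (by linarith) (by linarith)
    refine ((this.comp_const_add _ _).const_mul _).congr_deriv ?_
    have hk2 := phase_mul_phase_not (θ₁ := θ₁) (θ₂ := θ₂) v 2 0
    simp only [Coeffs.m₁le, waveCoeffs, add_zero, e1]
    field_simp [hk]
    linear_combination (massCoeff ħ m 1 v * F .mixed (!v)
      (null v P 1 + gap v P 1, null (!v) P 2, null v P 0, -gap v P 1, -gap v P 2)) * hk2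
  · have := h.hasDerivAt_mixed₁ge hF (!v) (x := null (!v) P 0) (z := null (!v) P 2) (y := null v P 1)
      (p := -gap v P 1 - 0) (q := -gap v P 2) (by linarith) (by linarith) (by linarith)
    simp only [neg_add']
    refine ((this.comp_const_sub _ _).const_mul _).congr_deriv ?_
    simp only [Coeffs.m₁ge, waveCoeffs, sub_zero, massCoeff_not, sub_neg_eq_add, e1]
    field_simp [hk]

/-- The components of the wave function of a solution of the system satisfy the equations of the
second electron. -/
theorem hasLineDerivAt_component_two (h : (waveCoeffs ħ m θ₁ θ₂).Solves F F) (hF : F.Cont)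
    {P : Config} (hP : P ∈ S1) (v : Bool) :
    (HasLineDerivAt ℝ (component θ₁ θ₂ F v none)
        (massCoeff ħ m 1 v * component θ₁ θ₂ F v (some 2) P) P (nullVec 2 v) ∧
      HasLineDerivAt ℝ (component θ₁ θ₂ F v (some 0))
        (massCoeff ħ m 1 v * component θ₁ θ₂ F (!v) (some 1) P) P (nullVec 2 v)) ∧
    HasLineDerivAt ℝ (component θ₁ θ₂ F v (some 1))
        (massCoeff ħ m 1 v * component θ₁ θ₂ F (!v) (some 0) P) P (nullVec 2 v) ∧
      HasLineDerivAt ℝ (component θ₁ θ₂ F (!v) (some 2))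
        (massCoeff ħ m 1 v * component θ₁ θ₂ F (!v) none P) P (nullVec 2 v) := by
  have hk := phase_ne_zero (θ₁ := θ₁) (θ₂ := θ₂)
  have h20 : (1 : Fin 3) ≠ 2 := by decide
  have h01 : (0 : Fin 3) ≠ 2 := by decide
  have hS := mem_S1_iff.1 hP
  obtain ⟨hv1, hv2⟩ := hS v
  obtain ⟨hw1, hw2⟩ := hS (!v)
  simp only [HasLineDerivAt]
  simp only [component, Bool.not_not, gap_not, null_add_nullVec, gap_add_nullVec,
    null_not_add_nullVec_of_ne _ _ h20, null_not_add_nullVec_of_ne _ _ h01,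
    gap_add_nullVec_of_ne _ _ h20]
  have e1 : null (!v) P 1 = null v P 1 + gap v P 1 := by rw [gap]; ring
  have e2 : null (!v) P 2 = null v P 2 + gap v P 2 := by rw [gap]; ring
  refine ⟨⟨?_, ?_⟩, ?_, ?_⟩
  · have := h.hasDerivAt_uniform₂ hF v (x := null v P 1) (y := null v P 0) (z := null v P 2)
      (p := gap v P 1) (q := gap v P 2 + 0) hv1.le hv2.le (by linarith)
    refine (this.comp_const_add _ _).congr_deriv ?_
    simp only [Coeffs.u₂, waveCoeffs, add_zero, e2]
    ring
  · have := h.hasDerivAt_mixed₂ge hF v (x := null v P 1) (z := null v P 2) (y := null (!v) P 0)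
      (p := gap v P 1) (q := gap v P 2 + 0) (by linarith) (by linarith)
    refine ((this.comp_const_add _ _).const_mul _).congr_deriv ?_
    simp only [Coeffs.m₂ge, waveCoeffs, add_zero, e2]
    field_simp [hk]
  · have := h.hasDerivAt_mixed₂ge hF v (x := null v P 0) (z := null v P 2) (y := null (!v) P 1)
      (p := gap v P 1) (q := gap v P 2 + 0) (by linarith) (by linarith)
    refine ((this.comp_const_add _ _).const_mul _).congr_deriv ?_
    have hk2 := phase_mul_phase_not (θ₁ := θ₁) (θ₂ := θ₂) v 1 0
    simp only [Coeffs.m₂ge, waveCoeffs, add_zero, e2]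
    field_simp [hk]
    linear_combination (massCoeff ħ m 1 v * F .mixed (!v)
      (null (!v) P 1, null v P 2 + gap v P 2, null v P 0, -gap v P 1, -gap v P 2)) * hk2
  · have := h.hasDerivAt_mixed₂le hF (!v) (x := null (!v) P 1) (z := null (!v) P 0) (y := null v P 2)
      (p := -gap v P 1) (q := -gap v P 2 - 0) (by linarith) (by linarith) (by linarith)
    simp only [neg_add']
    refine ((this.comp_const_sub _ _).const_mul _).congr_deriv ?_
    simp only [Coeffs.m₂le, waveCoeffs, sub_zero, massCoeff_not, sub_neg_eq_add, e2]
    field_simp [hk]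

/-- The wave function of a solution of the system for the amplitudes satisfies the Dirac
equations. -/
theorem nullEquations_wave (h : (waveCoeffs ħ m θ₁ θ₂).Solves F F) (hF : F.Cont) :
    NullEquations ħ m (wave θ₁ θ₂ F) := by
  intro P hP j v ς hς
  have hc : ∀ w o w' o' j, ς = spin w o →
      HasLineDerivAt ℝ (component θ₁ θ₂ F w o) (massCoeff ħ m j v * component θ₁ θ₂ F w' o' P) P
        (nullVec j v) →
      Function.update ς j (raySpin !v) = spin w' o' →
      HasLineDerivAt ℝ (comp (wave θ₁ θ₂ F) ς)
        (massCoeff ħ m j v * wave θ₁ θ₂ F P (Function.update ς j (raySpin !v))) P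
        (nullVec j v) := by
    rintro w o w' o' j rfl hd hu
    rw [hu, wave_spin (subset_closure hP)]
    refine hd.congr_of_eventuallyEq ?_
    filter_upwards [isOpen_S1.mem_nhds hP] with Q hQ
    exact wave_spin (subset_closure hQ) w o
  have hconst : ∀ w o, ς = spin w o → j = 0 →
      (∀ t : ℝ, component θ₁ θ₂ F w o (P + t • nullVec 0 v) = component θ₁ θ₂ F w o P) →
      HasLineDerivAt ℝ (comp (wave θ₁ θ₂ F) ς)
        (massCoeff ħ m j v * wave θ₁ θ₂ F P (Function.update ς j (raySpin !v))) P
        (nullVec j v) := by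
    rintro w o hs rfl ht
    refine hc w o _ _ 0 hs ?_ (spin_majority_minority _).symm
    simp only [HasLineDerivAt, ht, massCoeff_zero, zero_mul]
    exact hasDerivAt_const _ _
  have h10 : (1 : Fin 3) ≠ 0 := by decide
  have h20 : (2 : Fin 3) ≠ 0 := by decide
  obtain ⟨⟨one1, one2⟩, one3, one4⟩ := hasLineDerivAt_component_one h hF hP v
  obtain ⟨⟨two1, two2⟩, two3, two4⟩ := hasLineDerivAt_component_two h hF hP v
  simp only [← massCoeff_two] at two1 two2 two3 two4
  obtain ⟨⟨u1, u2⟩, u3, u4⟩ := update_spin_ne v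
  rcases eq_spin_of_apply_eq ς j v hς with ⟨o, ho, rfl⟩ | rfl
  · fin_cases j <;> rcases o with _ | i
    · refine hconst v none rfl rfl fun t => ?_
      simp only [component, null_add_nullVec, gap_add_nullVec_of_ne _ _ h10,
        gap_add_nullVec_of_ne _ _ h20]
    · fin_cases i
      · exact absurd rfl ho
      · refine hconst v (some 1) rfl rfl fun t => ?_
        simp only [component, null_add_nullVec, gap_add_nullVec_of_ne _ _ h10,
          gap_add_nullVec_of_ne _ _ h20, null_not_add_nullVec_of_ne _ _ h10]
      · refine hconst v (some 2) rfl rfl fun t => ?_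
        simp only [component, null_add_nullVec, gap_add_nullVec_of_ne _ _ h10,
          gap_add_nullVec_of_ne _ _ h20, null_not_add_nullVec_of_ne _ _ h20]
    · exact hc _ _ _ _ _ rfl one1 (update_spin_none _ _)
    · fin_cases i
      · exact hc _ _ _ _ _ rfl one2 u1
      · exact absurd rfl ho
      · exact hc _ _ _ _ _ rfl one3 u2
    · exact hc _ _ _ _ _ rfl two1 (update_spin_none _ _)
    · fin_cases i
      · exact hc _ _ _ _ _ rfl two2 u3
      · exact hc _ _ _ _ _ rfl two3 u4
      · exact absurd rfl ho
  · fin_cases j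
    · refine hconst (!v) (some 0) rfl rfl fun t => ?_
      simp only [component, Bool.not_not, null_add_nullVec, gap_not, gap_add_nullVec_of_ne _ _ h10,
        gap_add_nullVec_of_ne _ _ h20, null_not_add_nullVec_of_ne _ _ h10,
        null_not_add_nullVec_of_ne _ _ h20]
    · exact hc _ _ _ _ _ rfl one4 (update_spin_self _ _)
    · exact hc _ _ _ _ _ rfl two4 (update_spin_self _ _)

end

/-! ### Initial amplitudes -/

section

variable {θ₁ θ₂ M L : ℝ} {Ψ₀ : Positions → Spinor}

theorem vec_mem_halfSpace (x y z : ℝ) : ![y, min x y, max y z] ∈ halfSpace := by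
  rw [mem_halfSpace]
  exact ⟨min_le_right _ _, le_max_left _ _⟩

/-- A component of the data as a function of the positions of the first electron, the photon and the
second electron, extended to all triples of positions by moving the electrons to the photon if they are
on the wrong side. -/
noncomputable def dataComponent (Ψ₀ : Positions → Spinor) (v : Bool) (o : Option (Fin 3))
    (x y z : ℝ) : ℂ := Ψ₀ ![y, min x y, max y z] (spin v o)

variable (θ₁ θ₂) in
/-- The amplitudes at time zero, independent of the times. The mixed amplitude is assembled from its
three pieces `y ≤ x`, `x ≤ y ≤ z`, `z ≤ y` as a telescoping sum; at `y = x` and `y = z` the pieces agree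
by the boundary conditions. -/
noncomputable def dataAmp (Ψ₀ : Positions → Spinor) : Amp
  | .uniform, v, (x, y, z, _, _) => dataComponent Ψ₀ v none x y z
  | .mixed, v, (x, z, y, _, _) =>
      (phase θ₁ θ₂ v 1)⁻¹ * dataComponent Ψ₀ v (some 1) (min y x) x z +
      (phase θ₁ θ₂ v 0)⁻¹ * (dataComponent Ψ₀ v (some 0) x (max x (min y z)) z -
        dataComponent Ψ₀ v (some 0) x x z) +
      (phase θ₁ θ₂ v 2)⁻¹ * (dataComponent Ψ₀ v (some 2) x z (max y z) -
        dataComponent Ψ₀ v (some 2) x z z)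

theorem static_dataAmp : (dataAmp θ₁ θ₂ Ψ₀).Static := by
  rintro (_ | _) v x y z p q <;> rfl

theorem norm_dataComponent_le (hM : ∀ s ∈ halfSpace, ‖Ψ₀ s‖ ≤ M) (v : Bool) (o : Option (Fin 3))
    (x y z : ℝ) : ‖dataComponent Ψ₀ v o x y z‖ ≤ M :=
  (norm_le_pi_norm (Ψ₀ _) (spin v o)).trans (hM _ (vec_mem_halfSpace x y z))

theorem abs_min_sub_min_le {a b a' b' D : ℝ} (ha : |a - a'| ≤ D) (hb : |b - b'| ≤ D) :
    |min a b - min a' b'| ≤ D :=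
  (abs_min_sub_min_le_max a b a' b').trans (max_le ha hb)

theorem abs_max_sub_max_le {a b a' b' D : ℝ} (ha : |a - a'| ≤ D) (hb : |b - b'| ≤ D) :
    |max a b - max a' b'| ≤ D :=
  (abs_max_sub_max_le_max a b a' b').trans (max_le ha hb)

theorem norm_dataComponent_sub_le (hL0 : 0 ≤ L)
    (hL : ∀ s ∈ halfSpace, ∀ s' ∈ halfSpace, ‖Ψ₀ s - Ψ₀ s'‖ ≤ L * ‖s - s'‖) (v : Bool)
    (o : Option (Fin 3)) {x y z x' y' z' D : ℝ} (hx : |x - x'| ≤ D) (hy : |y - y'| ≤ D)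
    (hz : |z - z'| ≤ D) :
    ‖dataComponent Ψ₀ v o x y z - dataComponent Ψ₀ v o x' y' z'‖ ≤ L * D := by
  have hD : 0 ≤ D := (abs_nonneg _).trans hx
  have h1 := hL _ (vec_mem_halfSpace x y z) _ (vec_mem_halfSpace x' y' z')
  have h2 := norm_le_pi_norm (Ψ₀ ![y, min x y, max y z] - Ψ₀ ![y', min x' y', max y' z']) (spin v o)
  refine (h2.trans h1).trans (mul_le_mul_of_nonneg_left ?_ hL0)
  refine (pi_norm_le_iff_of_nonneg hD).2 fun i => ?_
  fin_cases i
  · exact hy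
  · exact abs_min_sub_min_le hx hy
  · exact abs_max_sub_max_le hy hz

theorem bound_dataAmp (hM : ∀ s ∈ halfSpace, ‖Ψ₀ s‖ ≤ M) {l : ℝ} (hl : 0 ≤ l) :
    (dataAmp θ₁ θ₂ Ψ₀).Bound l (5 * M) := by
  have h := norm_dataComponent_le hM
  have hM0 : 0 ≤ M := (norm_nonneg _).trans (h true none 0 0 0)
  intro k v x y z p q
  have h1 : 1 ≤ Real.exp (l * (|p| + |q|)) := Real.one_le_exp (by positivity)
  refine le_trans ?_ (le_mul_of_one_le_right (by positivity) h1)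
  rcases k with _ | _
  · exact (h _ _ _ _ _).trans (by linarith)
  · simp only [dataAmp]
    refine (norm_add₃_le).trans ?_
    simp only [norm_mul, norm_inv, norm_phase, inv_one, one_mul]
    have h2 := fun o a b c a' b' c' => (norm_sub_le (dataComponent Ψ₀ v o a b c)
      (dataComponent Ψ₀ v o a' b' c')).trans (add_le_add (h _ _ _ _ _) (h _ _ _ _ _))
    refine (add_le_add (add_le_add (h _ _ _ _ _) (h2 _ _ _ _ _ _ _)) (h2 _ _ _ _ _ _ _)).trans ?_
    linarith

theorem lip_dataAmp (hL0 : 0 ≤ L)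
    (hL : ∀ s ∈ halfSpace, ∀ s' ∈ halfSpace, ‖Ψ₀ s - Ψ₀ s'‖ ≤ L * ‖s - s'‖) {l : ℝ} (hl : 0 ≤ l) :
    (dataAmp θ₁ θ₂ Ψ₀).Lip l (5 * L) where
  label k v x y z x' y' z' p q D hx hy hz := by
    have hD : 0 ≤ D := (abs_nonneg _).trans hx
    have h := fun o {a b c a' b' c'} => norm_dataComponent_sub_le hL0 hL v o (x := a) (y := b)
      (z := c) (x' := a') (y' := b') (z' := c') (D := D)
    have h1 : 1 ≤ Real.exp (l * (|p| + |q|)) := Real.one_le_exp (by positivity)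
    refine le_trans ?_ (le_mul_of_one_le_right (by positivity) h1)
    rcases k with _ | _
    · exact (h _ hx hy hz).trans (by nlinarith)
    · simp only [dataAmp]
      have e : ∀ a b c d e a' b' c' d' e' k₁ k₂ k₃ : ℂ,
          k₁ * a + k₂ * (b - c) + k₃ * (d - e) - (k₁ * a' + k₂ * (b' - c') + k₃ * (d' - e')) =
          k₁ * (a - a') + k₂ * ((b - b') - (c - c')) + k₃ * ((d - d') - (e - e')) := by
        intros; ring
      rw [e]
      refine (norm_add₃_le).trans ?_
      simp only [norm_mul, norm_inv, norm_phase, inv_one, one_mul]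
      refine (add_le_add (add_le_add
        (h _ (abs_min_sub_min_le hz hx) hx hy) ((norm_sub_le _ _).trans (add_le_add
          (h _ hx (abs_max_sub_max_le hx (abs_min_sub_min_le hz hy)) hy) (h _ hx hx hy))))
        ((norm_sub_le _ _).trans (add_le_add
          (h _ hx hy (abs_max_sub_max_le hz hy)) (h _ hx hy hy)))).trans ?_
      linarith
  left k v x y z p p' P q _ _ := by
    have : dataAmp θ₁ θ₂ Ψ₀ k v (x, y, z, p, q) = dataAmp θ₁ θ₂ Ψ₀ k v (x, y, z, p', q) := by
      cases k <;> rfl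
    rw [this, sub_self, norm_zero]; positivity
  right k v x y z p q q' Q _ _ := by
    have : dataAmp θ₁ θ₂ Ψ₀ k v (x, y, z, p, q) = dataAmp θ₁ θ₂ Ψ₀ k v (x, y, z, p, q') := by
      cases k <;> rfl
    rw [this, sub_self, norm_zero]; positivity

theorem gap_atTimeZero (v : Bool) (s : Positions) (j : Fin 3) : gap v (atTimeZero s) j = 0 := by
  simp [gap, null_atTimeZero]

/-- The components of the wave function of the initial amplitudes are the data. -/
theorem component_dataAmp (hb : ∀ s, BoundaryCondition θ₁ θ₂ (atTimeZero s) (Ψ₀ s)) {s : Positions}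
    (hs : s ∈ halfSpace) (v : Bool) (o : Option (Fin 3)) :
    component θ₁ θ₂ (dataAmp θ₁ θ₂ Ψ₀) v o (atTimeZero s) = Ψ₀ s (spin v o) := by
  have hk := phase_ne_zero (θ₁ := θ₁) (θ₂ := θ₂)
  obtain ⟨h1, h2⟩ := mem_halfSpace.1 hs
  have hval : ∀ o x y z, x ≤ y → y ≤ z →
      dataComponent Ψ₀ v o x y z = Ψ₀ ![y, x, z] (spin v o) := by
    intro o x y z hx hz
    rw [dataComponent, min_eq_left hx, max_eq_right hz]
  have hself : Ψ₀ ![s 0, s 1, s 2] = Ψ₀ s := by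
    congr 1; ext i; fin_cases i <;> rfl
  have hC1 : ∀ x z, x ≤ z → (phase θ₁ θ₂ v 1)⁻¹ * dataComponent Ψ₀ v (some 1) x x z =
      (phase θ₁ θ₂ v 0)⁻¹ * dataComponent Ψ₀ v (some 0) x x z := by
    intro x z hxz
    rw [hval _ _ _ _ le_rfl hxz, hval _ _ _ _ le_rfl hxz]
    have h := ((boundaryCondition_iff (mem_closure_S1_atTimeZero.2 ⟨le_rfl, hxz⟩)).1
      (hb ![x, x, z])).1 (fun w => by simp [null_atTimeZero]) v
    rw [inv_mul_eq_div, inv_mul_eq_div, div_eq_div_iff (hk _ _) (hk _ _)]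
    linear_combination h
  have hC2 : ∀ x z, x ≤ z → (phase θ₁ θ₂ v 2)⁻¹ * dataComponent Ψ₀ v (some 2) x z z =
      (phase θ₁ θ₂ v 0)⁻¹ * dataComponent Ψ₀ v (some 0) x z z := by
    intro x z hxz
    rw [hval _ _ _ _ hxz le_rfl, hval _ _ _ _ hxz le_rfl]
    have h := ((boundaryCondition_iff (mem_closure_S1_atTimeZero.2 ⟨hxz, le_rfl⟩)).1
      (hb ![z, x, z])).2 (fun w => by simp [null_atTimeZero]) v
    rw [inv_mul_eq_div, inv_mul_eq_div, div_eq_div_iff (hk _ _) (hk _ _)]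
    linear_combination h
  rw [← hself]
  rcases o with _ | j
  · simp only [component, dataAmp, null_atTimeZero, hval _ _ _ _ h1 h2]
  · fin_cases j
    · simp only [component, dataAmp, null_atTimeZero]
      rw [min_eq_right h1, min_eq_left h2, max_eq_right h1, max_eq_right h2]
      rw [mul_sub, hC1 _ _ (h1.trans h2), sub_self, mul_zero]
      simp only [Fin.zero_eta, hval _ _ _ _ h1 h2]
      field_simp [hk]
      ring
    · simp only [component, dataAmp, null_atTimeZero]
      rw [min_eq_left h1, min_eq_left (h1.trans h2), max_eq_left h1, max_eq_right (h1.trans h2)]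
      rw [sub_self, sub_self, mul_zero, mul_zero]
      simp only [Fin.mk_one, hval _ _ _ _ h1 h2]
      field_simp [hk]
      ring
    · simp only [component, dataAmp, null_atTimeZero]
      rw [min_eq_right (h1.trans h2), min_eq_right h2, max_eq_right h1, max_eq_left h2]
      rw [mul_sub, mul_sub, hC1 _ _ h1, hC2 _ _ h1]
      simp only [Fin.reduceFinMk, hval _ _ _ _ h1 h2]
      field_simp [hk]
      ring

end

/-! ### Existence -/

theorem component_congr {F G : Amp} {θ₁ θ₂ : ℝ} {s : Positions}
    (h : ∀ k v x y z, F k v (x, y, z, 0, 0) = G k v (x, y, z, 0, 0)) (v : Bool) (o : Option (Fin 3)) :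
    component θ₁ θ₂ F v o (atTimeZero s) = component θ₁ θ₂ G v o (atTimeZero s) := by
  rcases o with _ | j
  · simp only [component, gap_atTimeZero, h]
  · fin_cases j <;> simp only [component, gap_atTimeZero, h]

/-- Existence of a solution, with bounds that are linear in the bounds of the data. -/
theorem exists_isSolution {ħ m θ₁ θ₂ : ℝ} (hħ : 0 < ħ) (hm : 0 < m) {Ψ₀ : Positions → Spinor}
    (h0 : IsInitialData θ₁ θ₂ Ψ₀) {M L : ℝ} (hL0 : 0 ≤ L) (hM : ∀ s ∈ halfSpace, ‖Ψ₀ s‖ ≤ M)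
    (hL : ∀ s ∈ halfSpace, ∀ s' ∈ halfSpace, ‖Ψ₀ s - Ψ₀ s'‖ ≤ L * ‖s - s'‖) :
    ∃ Ψ, IsSolution ħ m θ₁ θ₂ Ψ₀ Ψ ∧ ∀ T,
      (∀ P ∈ timeSlab T, ‖Ψ P‖ ≤ 10 * M * Real.exp (24 * (m / ħ) * (4 * T))) ∧
      ∀ P ∈ closure S1 ∩ timeSlab T, ∀ Q ∈ closure S1 ∩ timeSlab T, ‖Ψ P - Ψ Q‖ ≤
        60 * (L + 24 * (m / ħ) * M) * Real.exp (24 * (m / ħ) * (4 * T)) * ‖P - Q‖ := by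
  set c := m / ħ / 2 with hc
  have hc0 : 0 < c := by positivity
  have el : 24 * (m / ħ) = 48 * c := by rw [hc]; ring
  have hM0 : 0 ≤ M := (norm_nonneg _).trans (hM _ (vec_mem_halfSpace 0 0 0))
  have hB : (dataAmp θ₁ θ₂ Ψ₀).Bound (48 * c) (5 * M) := bound_dataAmp hM (by positivity)
  have hLip : (dataAmp θ₁ θ₂ Ψ₀).Lip (48 * c) (5 * L) := lip_dataAmp hL0 hL (by positivity)
  have hcont := hLip.cont (by positivity) (by positivity)
  have hK : (waveCoeffs ħ m θ₁ θ₂).Bound c := bound_waveCoeffs hħ hm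
  set F := (waveCoeffs ħ m θ₁ θ₂).picard (dataAmp θ₁ θ₂ Ψ₀) with hF
  have hFB : F.Bound (48 * c) (2 * (5 * M)) := hB.picard hK hc0 (by positivity)
  have hFL : F.Lip (48 * c) (2 * (5 * L + 48 * c * (5 * M))) :=
    hLip.picard hB hcont hK hc0 (by positivity) (by positivity)
  have hFc : F.Cont := hFL.cont (by positivity) (by positivity)
  have hFs : (waveCoeffs ħ m θ₁ θ₂).Solves F F :=
    Coeffs.solves_picard static_dataAmp hB hcont hK hc0 (by positivity)
  have hnull := nullEquations_wave hFs hFc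
  obtain ⟨hd, he⟩ := (nullEquations_iff hħ).1 hnull
  refine ⟨wave θ₁ θ₂ F, ⟨?_, continuousOn_wave hFc, hd, he, ?_, boundaryCondition_wave F⟩, ?_⟩
  · intro P hP
    by_contra hn
    exact hP (wave_of_notMem hn)
  · intro s hs
    by_cases hS : s ∈ halfSpace
    · ext ς
      rw [← spin_majority_minority ς, wave_spin hS.2,
        component_congr fun k v x y z => Coeffs.picard_zero _ _ k v x y z,
        component_dataAmp h0.boundary hS]
    · rw [wave_of_notMem fun h => hS ⟨hs, h⟩]
      by_contra hn
      exact hS (h0.support_subset (Ne.symm hn))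
  · intro T
    rw [el]
    refine ⟨fun P hP => ?_, fun P hP Q hQ => ?_⟩
    · refine (norm_wave_le hFB (by positivity) (by positivity) hP).trans (le_of_eq ?_)
      ring
    · refine (norm_wave_sub_le hFL (by positivity) (by positivity) hP hQ).trans (le_of_eq ?_)
      ring

/-! ### Regularity of the data -/

theorem convex_halfSpace : Convex ℝ halfSpace := by
  intro s hs t ht a b ha hb hab
  rw [mem_halfSpace] at *
  simp only [Pi.add_apply, Pi.smul_apply, smul_eq_mul]
  constructor <;> nlinarith

theorem uniqueDiffOn_halfSpace : UniqueDiffOn ℝ halfSpace := by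
  refine uniqueDiffOn_convex convex_halfSpace ⟨![0, -1, 1], ?_⟩
  have ho : IsOpen {s : Positions | s 1 < s 0 ∧ s 0 < s 2} :=
    (isOpen_lt (continuous_apply 1) (continuous_apply 0)).inter
      (isOpen_lt (continuous_apply 0) (continuous_apply 2))
  refine interior_maximal (fun s hs => mem_halfSpace.2 ⟨hs.1.le, hs.2.le⟩) ho ?_
  simp

theorem isClosed_halfSpace : IsClosed halfSpace := by
  have : halfSpace = {s : Positions | s 1 ≤ s 0} ∩ {s | s 0 ≤ s 2} := by
    ext s; exact mem_halfSpace
  rw [this]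
  exact (isClosed_le (continuous_apply 1) (continuous_apply 0)).inter
      (isClosed_le (continuous_apply 0) (continuous_apply 2))

namespace IsInitialData

variable {θ₁ θ₂ : ℝ} {Ψ₀ Φ₀ : Positions → Spinor}

theorem norm_sub_le_of_fderivWithin (h : IsInitialData θ₁ θ₂ Ψ₀) {L : ℝ}
    (hL : ∀ s ∈ halfSpace, ‖fderivWithin ℝ Ψ₀ halfSpace s‖ ≤ L) :
    ∀ s ∈ halfSpace, ∀ s' ∈ halfSpace, ‖Ψ₀ s - Ψ₀ s'‖ ≤ L * ‖s - s'‖ := fun s hs s' hs' =>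
  convex_halfSpace.norm_image_sub_le_of_norm_fderivWithin_le
    (h.contDiffOn.differentiableOn (by norm_num)) hL hs' hs

theorem exists_norm_le (h : IsInitialData θ₁ θ₂ Ψ₀) : ∃ M, ∀ s ∈ halfSpace, ‖Ψ₀ s‖ ≤ M := by
  obtain ⟨M, hM⟩ := (h.hasCompactSupport.inter_right isClosed_halfSpace).exists_bound_of_continuousOn
    (h.contDiffOn.continuousOn.mono inter_subset_right)
  refine ⟨max M 0, fun s hs => ?_⟩
  by_cases ht : s ∈ tsupport Ψ₀
  · exact (hM s ⟨ht, hs⟩).trans (le_max_left _ _)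
  · rw [image_eq_zero_of_notMem_tsupport ht, norm_zero]
    exact le_max_right _ _

theorem exists_norm_fderivWithin_le (h : IsInitialData θ₁ θ₂ Ψ₀) :
    ∃ L, 0 ≤ L ∧ ∀ s ∈ halfSpace, ‖fderivWithin ℝ Ψ₀ halfSpace s‖ ≤ L := by
  obtain ⟨M, hM⟩ := (h.hasCompactSupport.inter_right isClosed_halfSpace).exists_bound_of_continuousOn
    ((h.contDiffOn.continuousOn_fderivWithin uniqueDiffOn_halfSpace le_rfl).mono inter_subset_right)
  refine ⟨max M 0, le_max_right _ _, fun s hs => ?_⟩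
  by_cases ht : s ∈ tsupport Ψ₀
  · exact (hM s ⟨ht, hs⟩).trans (le_max_left _ _)
  · have hz : Ψ₀ =ᶠ[nhds s] fun _ => 0 := notMem_tsupport_iff_eventuallyEq.1 ht
    rw [(hz.filter_mono nhdsWithin_le_nhds).fderivWithin_eq hz.self_of_nhds,
      fderivWithin_const_apply, norm_zero]
    exact le_max_right _ _

theorem sub (hΨ : IsInitialData θ₁ θ₂ Ψ₀) (hΦ : IsInitialData θ₁ θ₂ Φ₀) :
    IsInitialData θ₁ θ₂ (Ψ₀ - Φ₀) where
  contDiffOn := hΨ.contDiffOn.sub hΦ.contDiffOn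
  hasCompactSupport := by
    rw [sub_eq_add_neg]
    exact hΨ.hasCompactSupport.add hΦ.hasCompactSupport.neg
  support_subset := (Function.support_sub _ _).trans
    (union_subset hΨ.support_subset hΦ.support_subset)
  boundary s := by
    obtain ⟨h1, h2⟩ := hΨ.boundary s
    obtain ⟨h3, h4⟩ := hΦ.boundary s
    refine ⟨fun h ς => ?_, fun h ς => ?_⟩
    · simp only [Pi.sub_apply, h1 h, h3 h, mul_sub]
    · simp only [Pi.sub_apply, h2 h, h4 h, mul_sub]

end IsInitialData

/-! ### Uniqueness for the system of amplitudes -/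

/-- The arguments of amplitudes that are determined by the data at time zero between `-R` and `R`: the
rays are in order, the electrons are space-like, and all null coordinates are at least `-R` for the
first electron and at most `R` for the second one, also after moving the electrons to time zero. -/
def domain (R : ℝ) : Kind → Set (ℝ × ℝ × ℝ × ℝ × ℝ)
  | .uniform => {X | match X with
    | (x, y, z, p, q) => x ≤ y ∧ y ≤ z ∧ x + p ≤ z + q ∧ -R ≤ x ∧ -R ≤ x + p ∧ z ≤ R ∧ z + q ≤ R}
  | .mixed => {X | match X with
    | (x, z, y, p, q) => x ≤ z ∧ (p ≤ y - x ∨ y - z ≤ q) ∧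
        (-R ≤ x ∧ -R ≤ x + p ∧ -R ≤ y ∧ -R ≤ y - p) ∧ z ≤ R ∧ z + q ≤ R ∧ y ≤ R ∧ y - q ≤ R}

theorem mem_domain_uniform {R x y z p q : ℝ} : (x, y, z, p, q) ∈ domain R .uniform ↔
    x ≤ y ∧ y ≤ z ∧ x + p ≤ z + q ∧ -R ≤ x ∧ -R ≤ x + p ∧ z ≤ R ∧ z + q ≤ R := Iff.rfl

theorem mem_domain_mixed {R x z y p q : ℝ} : (x, z, y, p, q) ∈ domain R .mixed ↔
    x ≤ z ∧ (p ≤ y - x ∨ y - z ≤ q) ∧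
      (-R ≤ x ∧ -R ≤ x + p ∧ -R ≤ y ∧ -R ≤ y - p) ∧ z ≤ R ∧ z + q ≤ R ∧ y ≤ R ∧ y - q ≤ R := Iff.rfl

/-- Bound for the increment of a function with different derivatives on the two sides of `s`. -/
theorem norm_sub_le_of_split {φ g h : ℝ → ℂ} {s p l C : ℝ} (hl : 0 < l) (hC : 0 ≤ C)
    (hg : ∀ a ∈ uIcc 0 p, ∀ b ∈ uIcc 0 p, a ≤ s → b ≤ s → φ b - φ a = ∫ σ in a..b, g σ)
    (hh : ∀ a ∈ uIcc 0 p, ∀ b ∈ uIcc 0 p, s ≤ a → s ≤ b → φ b - φ a = ∫ σ in a..b, h σ)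
    (hgC : ∀ σ ∈ uIcc 0 p, σ ≤ s → ‖g σ‖ ≤ C * Real.exp (l * |σ|))
    (hhC : ∀ σ ∈ uIcc 0 p, s ≤ σ → ‖h σ‖ ≤ C * Real.exp (l * |σ|)) :
    ‖φ p - φ 0‖ ≤ 4 * C / l * Real.exp (l * |p|) := by
  have habs : ∀ σ ∈ uIcc 0 p, |σ| ≤ |p| := fun σ hσ => by
    simpa using abs_sub_left_of_mem_uIcc hσ
  have key : ∀ a ∈ uIcc 0 p, ∀ b ∈ uIcc 0 p, (a ≤ s ∧ b ≤ s ∨ s ≤ a ∧ s ≤ b) →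
      ‖φ b - φ a‖ ≤ 2 * C / l * Real.exp (l * |p|) := by
    intro a ha b hb hs
    have hsub : Ι a b ⊆ uIcc 0 p := uIoc_subset_uIcc.trans (uIcc_subset_uIcc ha hb)
    rcases hs with ⟨h1, h2⟩ | ⟨h1, h2⟩
    · rw [hg a ha b hb h1 h2]
      refine norm_integral_le_exp hl hC (habs a ha) (habs b hb) fun σ hσ => hgC σ (hsub hσ) ?_
      exact (hσ.2).trans (max_le h1 h2)
    · rw [hh a ha b hb h1 h2]
      refine norm_integral_le_exp hl hC (habs a ha) (habs b hb) fun σ hσ => hhC σ (hsub hσ) ?_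
      exact (le_min h1 h2).trans hσ.1.le
  have hm0 : (0 : ℝ) ∈ uIcc 0 p := left_mem_uIcc
  have hmp : p ∈ uIcc 0 p := right_mem_uIcc
  have e : 2 * C / l * Real.exp (l * |p|) + 2 * C / l * Real.exp (l * |p|) =
      4 * C / l * Real.exp (l * |p|) := by ring
  have hle : 2 * C / l * Real.exp (l * |p|) ≤ 4 * C / l * Real.exp (l * |p|) := by
    rw [← e]; exact le_add_of_nonneg_left (by positivity)
  by_cases hside : (0 ≤ s ∧ p ≤ s ∨ s ≤ 0 ∧ s ≤ p)
  · exact (key 0 hm0 p hmp hside).trans hle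
  · have hs : s ∈ uIcc 0 p := by
      rw [mem_uIcc]; grind
    have h1 : 0 ≤ s ∧ s ≤ s ∨ s ≤ 0 ∧ s ≤ s := by simpa using le_total 0 s
    have h2 : s ≤ s ∧ p ≤ s ∨ s ≤ s ∧ s ≤ p := by simpa using le_total p s
    calc ‖φ p - φ 0‖ = ‖(φ p - φ s) + (φ s - φ 0)‖ := by rw [sub_add_sub_cancel]
      _ ≤ _ := (norm_add_le _ _).trans (add_le_add (key s hs p hmp h2) (key 0 hm0 s hs h1))
      _ = _ := e

theorem norm_sub_le_of_eq_integral {φ g : ℝ → ℂ} {p l C : ℝ} (hl : 0 < l) (hC : 0 ≤ C)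
    (hg : ∀ a ∈ uIcc 0 p, ∀ b ∈ uIcc 0 p, φ b - φ a = ∫ σ in a..b, g σ)
    (hgC : ∀ σ ∈ uIcc 0 p, ‖g σ‖ ≤ C * Real.exp (l * |σ|)) :
    ‖φ p - φ 0‖ ≤ 4 * C / l * Real.exp (l * |p|) :=
  norm_sub_le_of_split (s := 0) hl hC (fun a ha b hb _ _ => hg a ha b hb)
    (fun a ha b hb _ _ => hg a ha b hb) (fun σ hσ _ => hgC σ hσ) fun σ hσ _ => hgC σ hσ

namespace Coeffs.Solves

variable {K : Coeffs} {f : Amp} {c R : ℝ}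

/-- Increments in the time of the first electron, under a weighted bound for the solution. -/
theorem norm_left_sub_le (h : K.Solves f f) (hK : K.Bound c) (hc : 0 < c) {C l : ℝ} (hC : 0 ≤ C)
    (hl : 0 < l) (hf : ∀ k v x y z p q, (x, y, z, p, q) ∈ domain R k →
      ‖f k v (x, y, z, p, q)‖ ≤ C * Real.exp (l * (|p| + |q|))) (k : Kind) (v : Bool)
    {x y z p q : ℝ} (hX : (x, y, z, p, q) ∈ domain R k) (hX0 : (x, y, z, 0, q) ∈ domain R k) :
    ‖f k v (x, y, z, p, q) - f k v (x, y, z, 0, q)‖ ≤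
      4 * (c * C * Real.exp (l * |q|)) / l * Real.exp (l * |p|) := by
  have bnd : ∀ {k : ℂ}, ‖k‖ ≤ c → ∀ kk v x y z p q, (x, y, z, p, q) ∈ domain R kk →
      ‖k * f kk v (x, y, z, p, q)‖ ≤ c * C * Real.exp (l * |q|) * Real.exp (l * |p|) := by
    intro k hk kk v x y z p q hX
    have := norm_mul_le_mul_mul hk (hf kk v x y z p q hX)
    rwa [mul_add, add_comm, Real.exp_add, ← mul_assoc] at this
  have hC' : ∀ E : ℝ, 0 ≤ c * C * Real.exp E := fun E => by positivity
  rcases k with _ | _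
  · rw [mem_domain_uniform] at hX hX0
    have hle : ∀ σ ∈ uIcc 0 p, x + σ ≤ z + q ∧ -R ≤ x + σ := fun σ hσ => by
      rw [mem_uIcc] at hσ; grind
    refine norm_sub_le_of_eq_integral (φ := fun p => f .uniform v (x, y, z, p, q))
      (g := fun σ => K.u₁ f v x y z σ q) hl (hC' _) ?_ ?_
    · intro a ha b hb
      exact h.uniform₁ v x y z a b q hX.1 hX.2.1 (hle a ha).1 (hle b hb).1
    · intro σ hσ
      obtain ⟨h1, h2⟩ := hle σ hσ
      exact bnd (hK.a v) _ _ _ _ _ _ _ (by rw [mem_domain_mixed]; grind)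
  -- for the kind `mixed`, the rays of equal velocity are `x` and `y`
  · rw [mem_domain_mixed] at hX hX0
    have hle : ∀ σ ∈ uIcc 0 p, -R ≤ x + σ ∧ -R ≤ z - σ ∧ (z - y ≤ q ∨ σ ≤ z - x) := fun σ hσ => by
      rw [mem_uIcc] at hσ; grind
    have hle' : ∀ σ ∈ uIcc 0 p, σ ≤ z - x →
        ‖K.m₁le f v x y z σ q‖ ≤ c * C * Real.exp (l * |q|) * Real.exp (l * |σ|) := fun σ hσ hs => by
      obtain ⟨h1, h2, -⟩ := hle σ hσ
      have := bnd (hK.b v) .mixed (!v) (x + σ) z y (-σ) (-q) (by rw [mem_domain_mixed]; grind)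
      rwa [abs_neg, abs_neg] at this
    by_cases hq : z - y ≤ q
    · refine norm_sub_le_of_split (φ := fun p => f .mixed v (x, y, z, p, q)) (s := z - x)
        (g := fun σ => K.m₁le f v x y z σ q) (h := fun σ => K.m₁ge f v x y z σ q) hl (hC' _)
        (fun a _ b _ ha hb => h.mixed₁le v x y z a b q hX.1 ha hb)
        (fun a _ b _ ha hb => h.mixed₁ge v x y z a b q hX.1 ha hb hq) hle' ?_
      intro σ hσ hs
      obtain ⟨h1, h2, -⟩ := hle σ hσ
      exact bnd (hK.d v) _ _ _ _ _ _ _ (by rw [mem_domain_uniform]; grind)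
    · have hs : ∀ σ ∈ uIcc 0 p, σ ≤ z - x := fun σ hσ => (hle σ hσ).2.2.resolve_left hq
      exact norm_sub_le_of_eq_integral (φ := fun p => f .mixed v (x, y, z, p, q))
        (g := fun σ => K.m₁le f v x y z σ q) hl (hC' _)
        (fun a ha b hb => h.mixed₁le v x y z a b q hX.1 (hs a ha) (hs b hb))
        fun σ hσ => hle' σ hσ (hs σ hσ)

/-- Increments in the time of the second electron, under a weighted bound for the solution. -/
theorem norm_right_sub_le (h : K.Solves f f) (hK : K.Bound c) (hc : 0 < c) {C l : ℝ} (hC : 0 ≤ C)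
    (hl : 0 < l) (hf : ∀ k v x y z p q, (x, y, z, p, q) ∈ domain R k →
      ‖f k v (x, y, z, p, q)‖ ≤ C * Real.exp (l * (|p| + |q|))) (k : Kind) (v : Bool)
    {x y z p q : ℝ} (hX : (x, y, z, p, q) ∈ domain R k) (hX0 : (x, y, z, p, 0) ∈ domain R k) :
    ‖f k v (x, y, z, p, q) - f k v (x, y, z, p, 0)‖ ≤
      4 * (c * C * Real.exp (l * |p|)) / l * Real.exp (l * |q|) := by
  have bnd : ∀ {k : ℂ}, ‖k‖ ≤ c → ∀ kk v x y z p q, (x, y, z, p, q) ∈ domain R kk →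
      ‖k * f kk v (x, y, z, p, q)‖ ≤ c * C * Real.exp (l * |p|) * Real.exp (l * |q|) := by
    intro k hk kk v x y z p q hX
    have := norm_mul_le_mul_mul hk (hf kk v x y z p q hX)
    rwa [mul_add, Real.exp_add, ← mul_assoc] at this
  have hC' : ∀ E : ℝ, 0 ≤ c * C * Real.exp E := fun E => by positivity
  rcases k with _ | _
  · rw [mem_domain_uniform] at hX hX0
    have hle : ∀ σ ∈ uIcc 0 q, x + p ≤ z + σ ∧ z + σ ≤ R := fun σ hσ => by
      rw [mem_uIcc] at hσ; grind
    refine norm_sub_le_of_eq_integral (φ := fun q => f .uniform v (x, y, z, p, q))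
      (g := K.u₂ f v x y z p) hl (hC' _) ?_ ?_
    · intro a ha b hb
      exact h.uniform₂ v x y z p a b hX.1 hX.2.1 (hle a ha).1 (hle b hb).1
    · intro σ hσ
      obtain ⟨h1, h2⟩ := hle σ hσ
      exact bnd (hK.a' v) _ _ _ _ _ _ _ (by rw [mem_domain_mixed]; grind)
  -- for the kind `mixed`, the rays of equal velocity are `x` and `y`
  · rw [mem_domain_mixed] at hX hX0
    have hle : ∀ σ ∈ uIcc 0 q, y + σ ≤ R ∧ z - σ ≤ R ∧ (p ≤ z - x ∨ z - y ≤ σ) := fun σ hσ => by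
      rw [mem_uIcc] at hσ; grind
    have hge' : ∀ σ ∈ uIcc 0 q, z - y ≤ σ →
        ‖K.m₂ge f v x y z p σ‖ ≤ c * C * Real.exp (l * |p|) * Real.exp (l * |σ|) := fun σ hσ hs => by
      obtain ⟨h1, h2, -⟩ := hle σ hσ
      have := bnd (hK.b' v) .mixed (!v) z (y + σ) x (-p) (-σ) (by rw [mem_domain_mixed]; grind)
      rwa [abs_neg, abs_neg] at this
    by_cases hp : p ≤ z - x
    · refine norm_sub_le_of_split (φ := fun q => f .mixed v (x, y, z, p, q)) (s := z - y)
        (g := K.m₂le f v x y z p) (h := K.m₂ge f v x y z p) hl (hC' _)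
        (fun a _ b _ ha hb => h.mixed₂le v x y z p a b hX.1 ha hb hp)
        (fun a _ b _ ha hb => h.mixed₂ge v x y z p a b hX.1 ha hb) ?_ hge'
      intro σ hσ hs
      obtain ⟨h1, h2, -⟩ := hle σ hσ
      exact bnd (hK.d' v) _ _ _ _ _ _ _ (by rw [mem_domain_uniform]; grind)
    · have hs : ∀ σ ∈ uIcc 0 q, z - y ≤ σ := fun σ hσ => (hle σ hσ).2.2.resolve_left hp
      exact norm_sub_le_of_eq_integral (φ := fun q => f .mixed v (x, y, z, p, q))
        (g := K.m₂ge f v x y z p) hl (hC' _)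
        (fun a ha b hb => h.mixed₂ge v x y z p a b hX.1 (hs a ha) (hs b hb))
        fun σ hσ => hge' σ hσ (hs σ hσ)

/-- Improvement of an exponentially weighted bound for a solution that vanishes at time zero, by
integration along the path of `pathInt`. -/
theorem norm_le_half (h : K.Solves f f) (hK : K.Bound c) (hc : 0 < c)
    (h0 : ∀ k v x y z, (x, y, z, (0 : ℝ), (0 : ℝ)) ∈ domain R k → f k v (x, y, z, 0, 0) = 0) {C : ℝ}
    (hC : 0 ≤ C) (hf : ∀ k v x y z p q, (x, y, z, p, q) ∈ domain R k →
      ‖f k v (x, y, z, p, q)‖ ≤ C * Real.exp (16 * c * (|p| + |q|))) :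
    ∀ k v x y z p q, (x, y, z, p, q) ∈ domain R k →
      ‖f k v (x, y, z, p, q)‖ ≤ C / 2 * Real.exp (16 * c * (|p| + |q|)) := by
  intro k v x y z p q hX
  have hl : 0 < 16 * c := by positivity
  have e1 : ∀ E : ℝ, 4 * (c * C * E) / (16 * c) = C / 4 * E := fun E => by field_simp; ring
  have e2 : Real.exp (16 * c * (|p| + |q|)) = Real.exp (16 * c * |p|) * Real.exp (16 * c * |q|) := by
    rw [← Real.exp_add]; ring_nf
  have hp1 : 1 ≤ Real.exp (16 * c * |p|) := Real.one_le_exp (by positivity)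
  have hq1 : 1 ≤ Real.exp (16 * c * |q|) := Real.one_le_exp (by positivity)
  have hX00 : (x, y, z, 0, 0) ∈ domain R k := by
    cases k <;> simp only [mem_domain_uniform, mem_domain_mixed] at hX ⊢ <;> grind
  have hleft := fun {p q : ℝ} => h.norm_left_sub_le hK hc hC hl hf k v (x := x) (y := y) (z := z)
    (p := p) (q := q)
  have hright := fun {p q : ℝ} => h.norm_right_sub_le hK hc hC hl hf k v (x := x) (y := y) (z := z)
    (p := p) (q := q)
  simp only [e1] at hleft hright
  rw [e2]
  rcases le_total 0 q with hq | hq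
  · have hX0 : (x, y, z, 0, q) ∈ domain R k := by
      cases k <;> simp only [mem_domain_uniform, mem_domain_mixed] at hX ⊢ <;> grind
    have h1 := hright hX0 hX00
    have h2 := hleft hX hX0
    rw [h0 k v x y z hX00, sub_zero, abs_zero, mul_zero, Real.exp_zero, mul_one] at h1
    have h3 := norm_add_le (f k v (x, y, z, p, q) - f k v (x, y, z, 0, q)) (f k v (x, y, z, 0, q))
    rw [sub_add_cancel] at h3
    have h4 : C / 4 * Real.exp (16 * c * |q|) ≤
        C / 4 * (Real.exp (16 * c * |p|) * Real.exp (16 * c * |q|)) := by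
      gcongr; exact le_mul_of_one_le_left (by positivity) hp1
    linarith
  · have hX0 : (x, y, z, p, 0) ∈ domain R k := by
      cases k <;> simp only [mem_domain_uniform, mem_domain_mixed] at hX ⊢ <;> grind
    have h1 := hleft hX0 hX00
    have h2 := hright hX hX0
    rw [h0 k v x y z hX00, sub_zero, abs_zero, mul_zero, Real.exp_zero, mul_one] at h1
    have h3 := norm_add_le (f k v (x, y, z, p, q) - f k v (x, y, z, p, 0)) (f k v (x, y, z, p, 0))
    rw [sub_add_cancel] at h3
    have h4 : C / 4 * Real.exp (16 * c * |p|) ≤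
        C / 4 * (Real.exp (16 * c * |p|) * Real.exp (16 * c * |q|)) := by
      gcongr; exact le_mul_of_one_le_right (by positivity) hq1
    linarith

/-- A bounded solution of the system that vanishes at time zero vanishes on the domain of
dependence. -/
theorem eq_zero (h : K.Solves f f) (hK : K.Bound c) (hc : 0 < c)
    (h0 : ∀ k v x y z, (x, y, z, (0 : ℝ), (0 : ℝ)) ∈ domain R k → f k v (x, y, z, 0, 0) = 0) {B : ℝ}
    (hB : ∀ k v, ∀ X ∈ domain R k, ‖f k v X‖ ≤ B) {k : Kind} (v : Bool) {X : ℝ × ℝ × ℝ × ℝ × ℝ}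
    (hX : X ∈ domain R k) : f k v X = 0 := by
  have hB0 : 0 ≤ B := (norm_nonneg _).trans (hB k v X hX)
  have key : ∀ n : ℕ, ∀ k v x y z p q, (x, y, z, p, q) ∈ domain R k →
      ‖f k v (x, y, z, p, q)‖ ≤ B / 2 ^ n * Real.exp (16 * c * (|p| + |q|)) := by
    intro n
    induction n with
    | zero =>
      intro k v x y z p q hX
      rw [pow_zero, div_one]
      exact (hB k v _ hX).trans
        (le_mul_of_one_le_right hB0 (Real.one_le_exp (by positivity)))
    | succ n ih =>
      rw [pow_succ, ← div_div]
      exact h.norm_le_half hK hc h0 (by positivity) ih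
  obtain ⟨x, y, z, p, q⟩ := X
  have hlim : Filter.Tendsto (fun n : ℕ => B / 2 ^ n * Real.exp (16 * c * (|p| + |q|))) Filter.atTop
      (nhds 0) := by
    have := (tendsto_pow_atTop_nhds_zero_of_lt_one (r := (1 / 2 : ℝ)) (by norm_num)
      (by norm_num)).const_mul (B * Real.exp (16 * c * (|p| + |q|)))
    rw [mul_zero] at this
    refine this.congr fun n => ?_
    rw [one_div, inv_pow]; ring
  exact norm_le_zero_iff.1 (ge_of_tendsto' hlim fun n => key n k v x y z p q hX)

end Coeffs.Solves

/-! ### Increments along null vectors -/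

section

variable {ħ m : ℝ} {Ψ : Config → Spinor}

/-- The null derivatives integrate to increments between points of `closure 𝓢₁`, which may be boundary
points. -/
theorem NullEquations.sub_eq_integral (hΨ : NullEquations ħ m Ψ) (hc : ContinuousOn Ψ (closure S1))
    {P : Config} {j : Fin 3} {v : Bool} {ς : SpinIndex} (hς : ς j = raySpin v) {a b : ℝ}
    (ha : P + a • nullVec j v ∈ closure S1) (hb : P + b • nullVec j v ∈ closure S1) :
    Ψ (P + b • nullVec j v) ς - Ψ (P + a • nullVec j v) ς =
      ∫ t in a..b, massCoeff ħ m j v *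
        Ψ (P + t • nullVec j v) (Function.update ς j (raySpin !v)) := by
  -- a globally continuous `Φ` replaces `Ψ` in the passage to the limit from the interior
  obtain ⟨Φ, hΦ⟩ := ContinuousMap.exists_restrict_eq isClosed_closure
    (⟨(closure S1).domRestrict Ψ, hc.domRestrict⟩ : C(closure S1, Spinor))
  have hΦΨ : ∀ Q ∈ closure S1, Ψ Q = Φ Q := fun Q hQ =>
    (DFunLike.congr_fun hΦ ⟨Q, hQ⟩).symm
  have hseg : ∀ t ∈ uIcc a b, P + t • nullVec j v ∈ closure S1 := by
    intro t ht
    rw [mem_closure_S1_iff] at *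
    intro w
    have h1 := ha w
    have h2 := hb w
    simp only [null_add, null_smul] at h1 h2 ⊢
    have h3 : ∀ i, ∃ r, ∀ t : ℝ, t * null w (nullVec j v) i = t * r := fun i => ⟨_, fun _ => rfl⟩
    have key : ∀ A B r s : ℝ, A + a * r ≤ B + a * s → A + b * r ≤ B + b * s →
        A + t * r ≤ B + t * s := by
      intro A B r s ha hb
      rcases le_total r s with h | h <;> rw [mem_uIcc] at ht <;> rcases ht with ht | ht <;>
        nlinarith
    exact ⟨key _ _ _ _ h1.1 h2.1, key _ _ _ _ h1.2 h2.2⟩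
  have hcΦ : ∀ τ : SpinIndex, Continuous fun Q => Φ Q τ := fun τ =>
    (continuous_apply τ).comp Φ.continuous
  have hint : ∀ r : ℝ, 0 < r →
      Φ (P + b • nullVec j v + r • inward) ς - Φ (P + a • nullVec j v + r • inward) ς =
        ∫ t in a..b, massCoeff ħ m j v *
          Φ (P + t • nullVec j v + r • inward) (Function.update ς j (raySpin !v)) := by
    intro r hr
    have hmem := fun t ht => add_inward_mem_S1 (hseg t ht) hr
    have hd : ∀ t ∈ uIcc a b, HasDerivAt (fun t => Ψ (P + t • nullVec j v + r • inward) ς)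
        (massCoeff ħ m j v *
          Φ (P + t • nullVec j v + r • inward) (Function.update ς j (raySpin !v))) t := by
      intro t ht
      have h1 := hΨ _ (hmem t ht) j v ς hς
      rw [HasLineDerivAt, ← sub_self t] at h1
      have h2 := h1.comp_sub_const t t
      rw [← hΦΨ _ (subset_closure (hmem t ht))]
      refine h2.congr_of_eventuallyEq (.of_eq (funext fun s => ?_))
      change Ψ _ ς = Ψ _ ς
      congr 1
      rw [sub_smul]; abel
    have hci : Continuous fun t : ℝ => massCoeff ħ m j v *
        Φ (P + t • nullVec j v + r • inward) (Function.update ς j (raySpin !v)) :=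
      continuous_const.mul ((hcΦ _).comp (by fun_prop))
    rw [intervalIntegral.integral_eq_sub_of_hasDerivAt hd (hci.intervalIntegrable _ _),
      ← hΦΨ _ (subset_closure (hmem b right_mem_uIcc)),
      ← hΦΨ _ (subset_closure (hmem a left_mem_uIcc))]
  have hclosed : IsClosed {r : ℝ |
      Φ (P + b • nullVec j v + r • inward) ς - Φ (P + a • nullVec j v + r • inward) ς =
        ∫ t in a..b, massCoeff ħ m j v *
          Φ (P + t • nullVec j v + r • inward) (Function.update ς j (raySpin !v))} := by
    refine isClosed_eq ?_ ?_
    · exact ((hcΦ ς).comp (by fun_prop)).sub ((hcΦ ς).comp (by fun_prop))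
    · refine intervalIntegral.continuous_parametric_intervalIntegral_of_continuous' ?_ a b
      exact continuous_const.mul ((hcΦ _).comp (by fun_prop))
  have h0 : (0 : ℝ) ∈ closure (Ioi 0) := by rw [closure_Ioi]; exact self_mem_Ici
  have h1 := hclosed.closure_subset_iff.2 (fun r hr => hint r hr) h0
  simp only [mem_ofPred_eq, zero_smul, add_zero] at h1
  rw [hΦΨ _ ha, hΦΨ _ hb, h1]
  refine intervalIntegral.integral_congr fun t ht => ?_
  rw [← hΦΨ _ (hseg t ht)]

theorem ofNull_eq_add_photon (v : Bool) (c₀ o₀ c₁ o₁ c₂ o₂ : ℝ) :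
    ofNull v c₀ o₀ c₁ o₁ c₂ o₂ = ofNull v c₀ 0 c₁ o₁ c₂ o₂ + o₀ • nullVec 0 v := by
  ext i μ
  fin_cases i <;> fin_cases μ <;> simp [ofNull, nullVec] <;> ring

theorem ofNull_eq_add_one (v : Bool) (c₀ o₀ c₁ o₁ c₂ o₂ : ℝ) :
    ofNull v c₀ o₀ c₁ o₁ c₂ o₂ = ofNull v c₀ o₀ c₁ 0 c₂ o₂ + o₁ • nullVec 1 v := by
  ext i μ
  fin_cases i <;> fin_cases μ <;> simp [ofNull, nullVec] <;> ring

theorem ofNull_eq_add_two (v : Bool) (c₀ o₀ c₁ o₁ c₂ o₂ : ℝ) :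
    ofNull v c₀ o₀ c₁ o₁ c₂ o₂ = ofNull v c₀ o₀ c₁ o₁ c₂ 0 + o₂ • nullVec 2 v := by
  ext i μ
  fin_cases i <;> fin_cases μ <;> simp [ofNull, nullVec] <;> ring

variable {v : Bool} {c₀ o₀ o₀' c₁ o₁ c₂ o₂ : ℝ} {o : Option (Fin 3)}

/-- A component does not depend on the null coordinate of the photon that varies along the photon's
ray. -/
theorem NullEquations.apply_photon (hΨ : NullEquations ħ m Ψ) (hc : ContinuousOn Ψ (closure S1))
    {ς : SpinIndex} (hς : ς 0 = raySpin v) (h : ofNull v c₀ o₀ c₁ o₁ c₂ o₂ ∈ closure S1)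
    (h' : ofNull v c₀ o₀' c₁ o₁ c₂ o₂ ∈ closure S1) :
    Ψ (ofNull v c₀ o₀ c₁ o₁ c₂ o₂) ς = Ψ (ofNull v c₀ o₀' c₁ o₁ c₂ o₂) ς := by
  rw [ofNull_eq_add_photon] at h h' ⊢
  rw [ofNull_eq_add_photon v c₀ o₀' c₁ o₁ c₂ o₂, ← sub_eq_zero,
    hΨ.sub_eq_integral hc hς h' h]
  simp [massCoeff_zero]

theorem NullEquations.sub_one (hΨ : NullEquations ħ m Ψ) (hc : ContinuousOn Ψ (closure S1))
    {ς : SpinIndex} (hς : ς 1 = raySpin v) {a b : ℝ} (ha : ofNull v c₀ o₀ c₁ a c₂ o₂ ∈ closure S1)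
    (hb : ofNull v c₀ o₀ c₁ b c₂ o₂ ∈ closure S1) :
    Ψ (ofNull v c₀ o₀ c₁ b c₂ o₂) ς - Ψ (ofNull v c₀ o₀ c₁ a c₂ o₂) ς =
      ∫ t in a..b, massCoeff ħ m 1 v *
        Ψ (ofNull v c₀ o₀ c₁ t c₂ o₂) (Function.update ς 1 (raySpin !v)) := by
  have e := fun t => ofNull_eq_add_one v c₀ o₀ c₁ t c₂ o₂
  have h := hΨ.sub_eq_integral hc hς (e a ▸ ha) (e b ▸ hb)
  simpa only [← e] using h

theorem NullEquations.sub_two (hΨ : NullEquations ħ m Ψ) (hc : ContinuousOn Ψ (closure S1))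
    {ς : SpinIndex} (hς : ς 2 = raySpin v) {a b : ℝ} (ha : ofNull v c₀ o₀ c₁ o₁ c₂ a ∈ closure S1)
    (hb : ofNull v c₀ o₀ c₁ o₁ c₂ b ∈ closure S1) :
    Ψ (ofNull v c₀ o₀ c₁ o₁ c₂ b) ς - Ψ (ofNull v c₀ o₀ c₁ o₁ c₂ a) ς =
      ∫ t in a..b, massCoeff ħ m 1 v *
        Ψ (ofNull v c₀ o₀ c₁ o₁ c₂ t) (Function.update ς 2 (raySpin !v)) := by
  have e := fun t => ofNull_eq_add_two v c₀ o₀ c₁ o₁ c₂ t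
  have h := hΨ.sub_eq_integral hc hς (e a ▸ ha) (e b ▸ hb)
  simpa only [← e, massCoeff_two] using h

end

/-! ### The amplitudes of a wave function -/

/-- Wave functions that satisfy the equations and the boundary conditions. -/
structure IsWave (ħ m θ₁ θ₂ : ℝ) (Ψ : Config → Spinor) : Prop where
  nullEquations : NullEquations ħ m Ψ
  continuousOn : ContinuousOn Ψ (closure S1)
  boundary : ∀ P, BoundaryCondition θ₁ θ₂ P (Ψ P)

variable {ħ m θ₁ θ₂ : ℝ} {Ψ : Config → Spinor}

variable (θ₁ θ₂) in
open Classical in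
/-- The amplitudes of a wave function. The null coordinate of the photon on which a component does not
depend is chosen such that the photon stays between the electrons. -/
noncomputable def amplitude (Ψ : Config → Spinor) : Amp
  | .uniform, v, (x, y, z, p, q) => Ψ (ofNull v y (z + q) x (x + p) z (z + q)) (spin v none)
  | .mixed, v, (x, z, y, p, q) =>
      if p ≤ y - x then
        if y - z ≤ q then
          (phase θ₁ θ₂ v 0)⁻¹ * Ψ (ofNull v x y x (x + p) z (z + q)) (spin v (some 0))
        else (phase θ₁ θ₂ v 2)⁻¹ * Ψ (ofNull v z y x (x + p) (y - q) y) (spin v (some 2))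
      else (phase θ₁ θ₂ v 1)⁻¹ * Ψ (ofNull v x y (y - p) y z (z + q)) (spin v (some 1))

theorem spin_some_zero_zero (v : Bool) : spin v (some 0) 0 = raySpin !v := by
  cases v <;> rfl

theorem spin_zero_of_ne {o : Option (Fin 3)} (ho : o ≠ some 0) (v : Bool) :
    spin v o 0 = raySpin v := by
  revert o v; decide

namespace IsWave

variable {v : Bool} {c₀ c₀' o₀ o₀' c₁ o₁ c₂ o₂ x y z p q : ℝ} {o : Option (Fin 3)}

theorem apply_photon (h : IsWave ħ m θ₁ θ₂ Ψ) (ho : o ≠ some 0)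
    (hP : ofNull v c₀ o₀ c₁ o₁ c₂ o₂ ∈ closure S1) (hP' : ofNull v c₀ o₀' c₁ o₁ c₂ o₂ ∈ closure S1) :
    Ψ (ofNull v c₀ o₀ c₁ o₁ c₂ o₂) (spin v o) = Ψ (ofNull v c₀ o₀' c₁ o₁ c₂ o₂) (spin v o) :=
  h.nullEquations.apply_photon h.continuousOn (spin_zero_of_ne ho v) hP hP'

theorem apply_photon_minority (h : IsWave ħ m θ₁ θ₂ Ψ)
    (hP : ofNull v c₀ o₀ c₁ o₁ c₂ o₂ ∈ closure S1) (hP' : ofNull v c₀' o₀ c₁ o₁ c₂ o₂ ∈ closure S1) :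
    Ψ (ofNull v c₀ o₀ c₁ o₁ c₂ o₂) (spin v (some 0)) =
      Ψ (ofNull v c₀' o₀ c₁ o₁ c₂ o₂) (spin v (some 0)) := by
  rw [← ofNull_not] at hP hP' ⊢
  rw [← ofNull_not v c₀']
  exact h.nullEquations.apply_photon h.continuousOn (spin_some_zero_zero v) hP hP'

theorem sub_one (h : IsWave ħ m θ₁ θ₂ Ψ) {w : Bool} {o' : Option (Fin 3)}
    (ho : spin v o 1 = raySpin v) (hw : Function.update (spin v o) 1 (raySpin !v) = spin w o') {a b : ℝ}
    (ha : ofNull v c₀ o₀ c₁ a c₂ o₂ ∈ closure S1) (hb : ofNull v c₀ o₀ c₁ b c₂ o₂ ∈ closure S1) :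
    Ψ (ofNull v c₀ o₀ c₁ b c₂ o₂) (spin v o) - Ψ (ofNull v c₀ o₀ c₁ a c₂ o₂) (spin v o) =
      ∫ t in a..b, massCoeff ħ m 1 v * Ψ (ofNull v c₀ o₀ c₁ t c₂ o₂) (spin w o') := by
  rw [h.nullEquations.sub_one h.continuousOn ho ha hb, hw]

theorem sub_one_minority (h : IsWave ħ m θ₁ θ₂ Ψ) {a b : ℝ}
    (ha : ofNull v c₀ o₀ a o₁ c₂ o₂ ∈ closure S1) (hb : ofNull v c₀ o₀ b o₁ c₂ o₂ ∈ closure S1) :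
    Ψ (ofNull v c₀ o₀ b o₁ c₂ o₂) (spin v (some 1)) -
        Ψ (ofNull v c₀ o₀ a o₁ c₂ o₂) (spin v (some 1)) =
      ∫ t in a..b, -massCoeff ħ m 1 v * Ψ (ofNull v c₀ o₀ t o₁ c₂ o₂) (spin v none) := by
  simp only [← ofNull_not v] at ha hb ⊢
  rw [h.nullEquations.sub_one h.continuousOn (by cases v <;> rfl) ha hb, massCoeff_not, Bool.not_not]
  have := update_spin_self 1 (!v)
  rw [Bool.not_not] at this
  rw [this]

theorem sub_two (h : IsWave ħ m θ₁ θ₂ Ψ) {w : Bool} {o' : Option (Fin 3)}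
    (ho : spin v o 2 = raySpin v) (hw : Function.update (spin v o) 2 (raySpin !v) = spin w o') {a b : ℝ}
    (ha : ofNull v c₀ o₀ c₁ o₁ c₂ a ∈ closure S1) (hb : ofNull v c₀ o₀ c₁ o₁ c₂ b ∈ closure S1) :
    Ψ (ofNull v c₀ o₀ c₁ o₁ c₂ b) (spin v o) - Ψ (ofNull v c₀ o₀ c₁ o₁ c₂ a) (spin v o) =
      ∫ t in a..b, massCoeff ħ m 1 v * Ψ (ofNull v c₀ o₀ c₁ o₁ c₂ t) (spin w o') := by
  rw [h.nullEquations.sub_two h.continuousOn ho ha hb, hw]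

theorem sub_two_minority (h : IsWave ħ m θ₁ θ₂ Ψ) {a b : ℝ}
    (ha : ofNull v c₀ o₀ c₁ o₁ a o₂ ∈ closure S1) (hb : ofNull v c₀ o₀ c₁ o₁ b o₂ ∈ closure S1) :
    Ψ (ofNull v c₀ o₀ c₁ o₁ b o₂) (spin v (some 2)) -
        Ψ (ofNull v c₀ o₀ c₁ o₁ a o₂) (spin v (some 2)) =
      ∫ t in a..b, -massCoeff ħ m 1 v * Ψ (ofNull v c₀ o₀ c₁ o₁ t o₂) (spin v none) := by
  simp only [← ofNull_not v] at ha hb ⊢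
  rw [h.nullEquations.sub_two h.continuousOn (by cases v <;> rfl) ha hb, massCoeff_not, Bool.not_not]
  have := update_spin_self 2 (!v)
  rw [Bool.not_not] at this
  rw [this]

theorem boundary_one (h : IsWave ħ m θ₁ θ₂ Ψ) (hP : ofNull v c₀ o₀ c₀ o₀ c₂ o₂ ∈ closure S1) :
    (phase θ₁ θ₂ v 1)⁻¹ * Ψ (ofNull v c₀ o₀ c₀ o₀ c₂ o₂) (spin v (some 1)) =
      (phase θ₁ θ₂ v 0)⁻¹ * Ψ (ofNull v c₀ o₀ c₀ o₀ c₂ o₂) (spin v (some 0)) := by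
  have hk := phase_ne_zero (θ₁ := θ₁) (θ₂ := θ₂)
  have hall : ∀ w, null w (ofNull v c₀ o₀ c₀ o₀ c₂ o₂) 1 = null w (ofNull v c₀ o₀ c₀ o₀ c₂ o₂) 0 := by
    intro w
    rcases Bool.eq_or_eq_not w v with rfl | rfl <;> simp [null_ofNull, null_not_ofNull]
  have := ((boundaryCondition_iff hP).1 (h.boundary _)).1 hall v
  rw [inv_mul_eq_div, inv_mul_eq_div, div_eq_div_iff (hk _ _) (hk _ _)]
  linear_combination this

theorem boundary_two (h : IsWave ħ m θ₁ θ₂ Ψ) (hP : ofNull v c₀ o₀ c₁ o₁ c₀ o₀ ∈ closure S1) :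
    (phase θ₁ θ₂ v 2)⁻¹ * Ψ (ofNull v c₀ o₀ c₁ o₁ c₀ o₀) (spin v (some 2)) =
      (phase θ₁ θ₂ v 0)⁻¹ * Ψ (ofNull v c₀ o₀ c₁ o₁ c₀ o₀) (spin v (some 0)) := by
  have hk := phase_ne_zero (θ₁ := θ₁) (θ₂ := θ₂)
  have hall : ∀ w, null w (ofNull v c₀ o₀ c₁ o₁ c₀ o₀) 2 = null w (ofNull v c₀ o₀ c₁ o₁ c₀ o₀) 0 := by
    intro w
    rcases Bool.eq_or_eq_not w v with rfl | rfl <;> simp [null_ofNull, null_not_ofNull]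
  have := ((boundaryCondition_iff hP).1 (h.boundary _)).2 hall v
  rw [inv_mul_eq_div, inv_mul_eq_div, div_eq_div_iff (hk _ _) (hk _ _)]
  linear_combination this

end IsWave

theorem amplitude_uniform (v : Bool) (x y z p q : ℝ) : amplitude θ₁ θ₂ Ψ .uniform v (x, y, z, p, q) =
    Ψ (ofNull v y (z + q) x (x + p) z (z + q)) (spin v none) := rfl

section

variable {v : Bool} {x y z p q : ℝ}

theorem amplitude_mixed_le_ge (hp : p ≤ y - x) (hq : y - z ≤ q) :
    amplitude θ₁ θ₂ Ψ .mixed v (x, z, y, p, q) =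
      (phase θ₁ θ₂ v 0)⁻¹ * Ψ (ofNull v x y x (x + p) z (z + q)) (spin v (some 0)) := by
  simp [amplitude, hp, sub_le_iff_le_add.1 hq, -one_div]

theorem IsWave.amplitude_mixed_le_le (h : IsWave ħ m θ₁ θ₂ Ψ) (hxz : x ≤ z) (hp : p ≤ y - x)
    (hq : q ≤ y - z) : amplitude θ₁ θ₂ Ψ .mixed v (x, z, y, p, q) =
      (phase θ₁ θ₂ v 2)⁻¹ * Ψ (ofNull v z y x (x + p) (y - q) y) (spin v (some 2)) := by
  rcases hq.eq_or_lt with rfl | hq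
  · rw [amplitude_mixed_le_ge hp le_rfl, sub_sub_cancel, add_sub_cancel, h.boundary_two,
      h.apply_photon_minority]
    all_goals rw [ofNull_mem_closure_S1]; grind
  · simp only [amplitude, hp, hq.not_ge, if_true, if_false]

theorem IsWave.amplitude_mixed_ge_ge (h : IsWave ħ m θ₁ θ₂ Ψ) (hxz : x ≤ z) (hp : y - x ≤ p)
    (hq : y - z ≤ q) : amplitude θ₁ θ₂ Ψ .mixed v (x, z, y, p, q) =
      (phase θ₁ θ₂ v 1)⁻¹ * Ψ (ofNull v x y (y - p) y z (z + q)) (spin v (some 1)) := by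
  rcases hp.eq_or_lt with rfl | hp
  · rw [amplitude_mixed_le_ge le_rfl hq, sub_sub_cancel, add_sub_cancel, h.boundary_one]
    rw [ofNull_mem_closure_S1]; grind
  · simp only [amplitude, hp.not_ge, if_false]

/-- The components of a wave function in terms of its amplitudes. -/
theorem IsWave.component_amplitude (h : IsWave ħ m θ₁ θ₂ Ψ) {P : Config} (hP : P ∈ closure S1)
    (v : Bool) (o : Option (Fin 3)) :
    component θ₁ θ₂ (amplitude θ₁ θ₂ Ψ) v o P = Ψ P (spin v o) := by
  have hk := phase_ne_zero (θ₁ := θ₁) (θ₂ := θ₂) v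
  have hS := mem_closure_S1_iff.1 hP
  obtain ⟨hv1, hv2⟩ := hS v
  obtain ⟨hw1, hw2⟩ := hS (!v)
  have hPn := ofNull_null v P
  have e1 : null v P 1 + gap v P 1 = null (!v) P 1 := by rw [gap]; ring
  have e2 : null v P 2 + gap v P 2 = null (!v) P 2 := by rw [gap]; ring
  have e3 : null (!v) P 1 - gap v P 1 = null v P 1 := by rw [gap]; ring
  have e4 : null (!v) P 2 - gap v P 2 = null v P 2 := by rw [gap]; ring
  rcases o with _ | j
  · rw [component, amplitude_uniform, e1, e2]
    refine (h.apply_photon (o := none) (by simp) ?_ ?_).trans (congrFun (congrArg Ψ hPn) _) <;>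
        rw [ofNull_mem_closure_S1] <;> grind
  · fin_cases j
    · change phase θ₁ θ₂ v 0 * amplitude θ₁ θ₂ Ψ .mixed v _ = Ψ P (spin v (some 0))
      rw [amplitude_mixed_le_ge (by linarith) (by linarith), mul_inv_cancel_left₀ (hk _), e1, e2]
      refine (h.apply_photon_minority ?_ ?_).trans (congrFun (congrArg Ψ hPn) _) <;>
        rw [ofNull_mem_closure_S1] <;> grind
    · change phase θ₁ θ₂ v 1 * amplitude θ₁ θ₂ Ψ .mixed v _ = Ψ P (spin v (some 1))
      rw [h.amplitude_mixed_ge_ge (by linarith) (by linarith) (by linarith),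
        mul_inv_cancel_left₀ (hk _), e3, e2]
      refine (h.apply_photon (o := some 1) (by simp) ?_ ?_).trans (congrFun (congrArg Ψ hPn) _) <;>
        rw [ofNull_mem_closure_S1] <;> grind
    · change phase θ₁ θ₂ v 2 * amplitude θ₁ θ₂ Ψ .mixed v _ = Ψ P (spin v (some 2))
      rw [h.amplitude_mixed_le_le (by linarith) (by linarith) (by linarith),
        mul_inv_cancel_left₀ (hk _), e1, e4]
      refine (h.apply_photon (o := some 2) (by simp) ?_ ?_).trans (congrFun (congrArg Ψ hPn) _) <;>
        rw [ofNull_mem_closure_S1] <;> grind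

end

theorem integral_neg_mul_eq (g : ℂ) (F : ℝ → ℂ) (y p p' : ℝ) :
    ∫ t in (y - p)..(y - p'), -g * F t = ∫ σ in p..p', g * F (y - σ) := by
  rw [← intervalIntegral.integral_comp_sub_left (fun t => -g * F t) y,
    intervalIntegral.integral_symm, ← intervalIntegral.integral_neg]
  simp

namespace IsWave

theorem uniform₁_amplitude (h : IsWave ħ m θ₁ θ₂ Ψ) (v : Bool) (x y z p p' q : ℝ) (hxy : x ≤ y)
    (hyz : y ≤ z) (hp : x + p ≤ z + q) (hp' : x + p' ≤ z + q) :
    amplitude θ₁ θ₂ Ψ .uniform v (x, y, z, p', q) - amplitude θ₁ θ₂ Ψ .uniform v (x, y, z, p, q) =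
      ∫ σ in p..p', (waveCoeffs ħ m θ₁ θ₂).u₁ (amplitude θ₁ θ₂ Ψ) v x y z σ q := by
  have hk := phase_ne_zero (θ₁ := θ₁) (θ₂ := θ₂) v
  rw [amplitude_uniform, amplitude_uniform, h.sub_one rfl (update_spin_none 1 v)
    (by rw [ofNull_mem_closure_S1]; grind) (by rw [ofNull_mem_closure_S1]; grind),
    ← intervalIntegral.integral_comp_add_left]
  refine intervalIntegral.integral_congr fun σ hσ => ?_
  have hσ' : x + σ ≤ z + q := by rw [mem_uIcc] at hσ; grind
  simp only [Coeffs.u₁]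
  rw [h.amplitude_mixed_ge_ge hyz (by linarith) (by linarith), add_sub_cancel_right,
    h.apply_photon (o := some 1) (o₀ := z + q) (o₀' := x + σ) (by simp)
    (by rw [ofNull_mem_closure_S1]; grind) (by rw [ofNull_mem_closure_S1]; grind)]
  simp only [waveCoeffs]
  field_simp [hk]

theorem uniform₂_amplitude (h : IsWave ħ m θ₁ θ₂ Ψ) (v : Bool) (x y z p q q' : ℝ) (hxy : x ≤ y)
    (hyz : y ≤ z) (hq : x + p ≤ z + q) (hq' : x + p ≤ z + q') :
    amplitude θ₁ θ₂ Ψ .uniform v (x, y, z, p, q') - amplitude θ₁ θ₂ Ψ .uniform v (x, y, z, p, q) =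
      ∫ σ in q..q', (waveCoeffs ħ m θ₁ θ₂).u₂ (amplitude θ₁ θ₂ Ψ) v x y z p σ := by
  have hk := phase_ne_zero (θ₁ := θ₁) (θ₂ := θ₂) v
  have hp : ∀ q, x + p ≤ z + q → Ψ (ofNull v y (z + q) x (x + p) z (z + q)) (spin v none) =
      Ψ (ofNull v y (x + p) x (x + p) z (z + q)) (spin v none) := fun q hq =>
    h.apply_photon (by simp) (by rw [ofNull_mem_closure_S1]; grind)
      (by rw [ofNull_mem_closure_S1]; grind)
  rw [amplitude_uniform, amplitude_uniform, hp q hq, hp q' hq', h.sub_two rfl (update_spin_none 2 v)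
    (by rw [ofNull_mem_closure_S1]; grind) (by rw [ofNull_mem_closure_S1]; grind),
    ← intervalIntegral.integral_comp_add_left]
  refine intervalIntegral.integral_congr fun σ hσ => ?_
  have hσ' : x + p ≤ z + σ := by rw [mem_uIcc] at hσ; grind
  simp only [Coeffs.u₂]
  rw [h.amplitude_mixed_le_le hxy (by linarith) (by linarith), add_sub_cancel_right,
    h.apply_photon (o := some 2) (o₀ := x + p) (o₀' := z + σ) (by simp)
    (by rw [ofNull_mem_closure_S1]; grind) (by rw [ofNull_mem_closure_S1]; grind)]
  simp only [waveCoeffs]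
  field_simp [hk]

theorem mixed₁le_amplitude (h : IsWave ħ m θ₁ θ₂ Ψ) (v : Bool) (x z y p p' q : ℝ) (hxz : x ≤ z)
    (hp : p ≤ y - x) (hp' : p' ≤ y - x) :
    amplitude θ₁ θ₂ Ψ .mixed v (x, z, y, p', q) - amplitude θ₁ θ₂ Ψ .mixed v (x, z, y, p, q) =
      ∫ σ in p..p', (waveCoeffs ħ m θ₁ θ₂).m₁le (amplitude θ₁ θ₂ Ψ) v x z y σ q := by
  have hk := phase_ne_zero (θ₁ := θ₁) (θ₂ := θ₂)
  have hσ : ∀ σ ∈ uIcc p p', x + σ ≤ y := fun σ hσ => by rw [mem_uIcc] at hσ; grind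
  obtain ⟨⟨u1, u2⟩, -⟩ := update_spin_ne v
  rcases le_total (y - z) q with hq | hq
  · rw [amplitude_mixed_le_ge hp hq, amplitude_mixed_le_ge hp' hq, ← mul_sub,
      h.sub_one (by cases v <;> rfl) u1 (by rw [ofNull_mem_closure_S1]; grind)
      (by rw [ofNull_mem_closure_S1]; grind), ← intervalIntegral.integral_comp_add_left,
      ← intervalIntegral.integral_const_mul]
    refine intervalIntegral.integral_congr fun σ hσ' => ?_
    have h1 := hσ σ hσ'
    simp only [Coeffs.m₁le]
    rw [h.amplitude_mixed_le_le h1 (by linarith) (by linarith), add_neg_cancel_right, sub_neg_eq_add,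
      h.apply_photon (v := !v) (o := some 2) (o₀ := z) (o₀' := x) (by simp)
      (by rw [ofNull_mem_closure_S1]; grind) (by rw [ofNull_mem_closure_S1]; grind), ofNull_not]
    simp only [waveCoeffs]
    field_simp [hk]
  · rw [h.amplitude_mixed_le_le hxz hp hq, h.amplitude_mixed_le_le hxz hp' hq, ← mul_sub,
      h.sub_one (by cases v <;> rfl) u2 (by rw [ofNull_mem_closure_S1]; grind)
      (by rw [ofNull_mem_closure_S1]; grind), ← intervalIntegral.integral_comp_add_left,
      ← intervalIntegral.integral_const_mul]
    refine intervalIntegral.integral_congr fun σ hσ' => ?_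
    have h1 := hσ σ hσ'
    simp only [Coeffs.m₁le]
    rw [amplitude_mixed_le_ge (by linarith) (by linarith), add_neg_cancel_right, ← sub_eq_add_neg,
      h.apply_photon_minority (v := !v) (c₀ := x + σ) (c₀' := y)
      (by rw [ofNull_mem_closure_S1]; grind) (by rw [ofNull_mem_closure_S1]; grind), ofNull_not]
    simp only [waveCoeffs]
    have hk2 := phase_mul_phase_not (θ₁ := θ₁) (θ₂ := θ₂) v 2 0
    field_simp [hk]
    linear_combination (-(massCoeff ħ m 1 v * Ψ (ofNull v z y x (x + σ) (y - q) y)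
      (spin (!v) (some 0)))) * hk2

theorem mixed₁ge_amplitude (h : IsWave ħ m θ₁ θ₂ Ψ) (v : Bool) (x z y p p' q : ℝ) (hxz : x ≤ z)
    (hp : y - x ≤ p) (hp' : y - x ≤ p') (hq : y - z ≤ q) :
    amplitude θ₁ θ₂ Ψ .mixed v (x, z, y, p', q) - amplitude θ₁ θ₂ Ψ .mixed v (x, z, y, p, q) =
      ∫ σ in p..p', (waveCoeffs ħ m θ₁ θ₂).m₁ge (amplitude θ₁ θ₂ Ψ) v x z y σ q := by
  have hk := phase_ne_zero (θ₁ := θ₁) (θ₂ := θ₂)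
  rw [h.amplitude_mixed_ge_ge hxz hp hq, h.amplitude_mixed_ge_ge hxz hp' hq, ← mul_sub,
    h.sub_one_minority (by rw [ofNull_mem_closure_S1]; grind) (by rw [ofNull_mem_closure_S1]; grind),
    integral_neg_mul_eq, ← intervalIntegral.integral_const_mul]
  refine intervalIntegral.integral_congr fun σ hσ => ?_
  have hσ' : y - σ ≤ x := by rw [mem_uIcc] at hσ; grind
  simp only [Coeffs.m₁ge]
  rw [amplitude_uniform, sub_add_cancel,
    h.apply_photon (o := none) (o₀ := z + q) (o₀' := y) (by simp)
    (by rw [ofNull_mem_closure_S1]; grind) (by rw [ofNull_mem_closure_S1]; grind)]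
  simp only [waveCoeffs]
  field_simp [hk]

theorem mixed₂le_amplitude (h : IsWave ħ m θ₁ θ₂ Ψ) (v : Bool) (x z y p q q' : ℝ) (hxz : x ≤ z)
    (hq : q ≤ y - z) (hq' : q' ≤ y - z) (hp : p ≤ y - x) :
    amplitude θ₁ θ₂ Ψ .mixed v (x, z, y, p, q') - amplitude θ₁ θ₂ Ψ .mixed v (x, z, y, p, q) =
      ∫ σ in q..q', (waveCoeffs ħ m θ₁ θ₂).m₂le (amplitude θ₁ θ₂ Ψ) v x z y p σ := by
  have hk := phase_ne_zero (θ₁ := θ₁) (θ₂ := θ₂)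
  rw [h.amplitude_mixed_le_le hxz hp hq, h.amplitude_mixed_le_le hxz hp hq', ← mul_sub,
    h.sub_two_minority (by rw [ofNull_mem_closure_S1]; grind) (by rw [ofNull_mem_closure_S1]; grind),
    integral_neg_mul_eq, ← intervalIntegral.integral_const_mul]
  refine intervalIntegral.integral_congr fun σ hσ => ?_
  simp only [Coeffs.m₂le]
  rw [amplitude_uniform, sub_add_cancel]
  simp only [waveCoeffs]
  field_simp [hk]

theorem mixed₂ge_amplitude (h : IsWave ħ m θ₁ θ₂ Ψ) (v : Bool) (x z y p q q' : ℝ) (hxz : x ≤ z)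
    (hq : y - z ≤ q) (hq' : y - z ≤ q') :
    amplitude θ₁ θ₂ Ψ .mixed v (x, z, y, p, q') - amplitude θ₁ θ₂ Ψ .mixed v (x, z, y, p, q) =
      ∫ σ in q..q', (waveCoeffs ħ m θ₁ θ₂).m₂ge (amplitude θ₁ θ₂ Ψ) v x z y p σ := by
  have hk := phase_ne_zero (θ₁ := θ₁) (θ₂ := θ₂)
  have hσ : ∀ σ ∈ uIcc q q', y ≤ z + σ := fun σ hσ => by rw [mem_uIcc] at hσ; grind
  obtain ⟨-, u1, u2⟩ := update_spin_ne v
  rcases le_total p (y - x) with hp | hp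
  · rw [amplitude_mixed_le_ge hp hq, amplitude_mixed_le_ge hp hq', ← mul_sub,
      h.sub_two (by cases v <;> rfl) u1 (by rw [ofNull_mem_closure_S1]; grind)
      (by rw [ofNull_mem_closure_S1]; grind), ← intervalIntegral.integral_comp_add_left,
      ← intervalIntegral.integral_const_mul]
    refine intervalIntegral.integral_congr fun σ hσ' => ?_
    have h1 := hσ σ hσ'
    simp only [Coeffs.m₂ge]
    rw [h.amplitude_mixed_ge_ge h1 (by linarith) (by linarith), add_neg_cancel_right, sub_neg_eq_add,
      ofNull_not]
    simp only [waveCoeffs]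
    field_simp [hk]
  · rw [h.amplitude_mixed_ge_ge hxz hp hq, h.amplitude_mixed_ge_ge hxz hp hq', ← mul_sub,
      h.sub_two (by cases v <;> rfl) u2 (by rw [ofNull_mem_closure_S1]; grind)
      (by rw [ofNull_mem_closure_S1]; grind), ← intervalIntegral.integral_comp_add_left,
      ← intervalIntegral.integral_const_mul]
    refine intervalIntegral.integral_congr fun σ hσ' => ?_
    have h1 := hσ σ hσ'
    simp only [Coeffs.m₂ge]
    rw [amplitude_mixed_le_ge (by linarith) (by linarith), add_neg_cancel_right, ← sub_eq_add_neg,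
      ofNull_not]
    simp only [waveCoeffs]
    have hk2 := phase_mul_phase_not (θ₁ := θ₁) (θ₂ := θ₂) v 1 0
    field_simp [hk]
    linear_combination (-(massCoeff ħ m 1 v * Ψ (ofNull v x y (y - p) y z (z + σ))
      (spin (!v) (some 0)))) * hk2

theorem solves_amplitude (h : IsWave ħ m θ₁ θ₂ Ψ) :
    (waveCoeffs ħ m θ₁ θ₂).Solves (amplitude θ₁ θ₂ Ψ) (amplitude θ₁ θ₂ Ψ) where
  uniform₁ := h.uniform₁_amplitude
  uniform₂ := h.uniform₂_amplitude
  mixed₁le := h.mixed₁le_amplitude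
  mixed₁ge := h.mixed₁ge_amplitude
  mixed₂le := h.mixed₂le_amplitude
  mixed₂ge := h.mixed₂ge_amplitude

end IsWave

/-! ### Uniqueness -/

variable {Φ : Config → Spinor} {Ψ₀ Φ₀ : Positions → Spinor}

theorem ofNull_self (v : Bool) (c₀ c₁ c₂ : ℝ) :
    ofNull v c₀ c₀ c₁ c₁ c₂ c₂ = atTimeZero ![c₀, c₁, c₂] := by
  ext j μ
  fin_cases j <;> fin_cases μ <;> simp [ofNull, atTimeZero]

theorem norm_le_of_abs_null_le {P : Config} {v : Bool} {R : ℝ} (h : ∀ j, |null v P j| ≤ R)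
    (h' : ∀ j, |null (!v) P j| ≤ R) : ‖P‖ ≤ R := by
  have hR : 0 ≤ R := (abs_nonneg _).trans (h 0)
  refine (pi_norm_le_iff_of_nonneg hR).2 fun j => (pi_norm_le_iff_of_nonneg hR).2 fun μ => ?_
  have h1 := abs_le.1 (h j)
  have h2 := abs_le.1 (h' j)
  rw [Real.norm_eq_abs, abs_le]
  cases v <;> fin_cases μ <;> simp [null, sgn] at h1 h2 ⊢ <;> constructor <;> linarith

theorem IsWave.sub (hΨ : IsWave ħ m θ₁ θ₂ Ψ) (hΦ : IsWave ħ m θ₁ θ₂ Φ) :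
    IsWave ħ m θ₁ θ₂ (Ψ - Φ) where
  nullEquations P hP j v ς hς := by
    have := HasDerivAt.sub (hΨ.nullEquations P hP j v ς hς) (hΦ.nullEquations P hP j v ς hς)
    rw [← mul_sub] at this
    exact this
  continuousOn := hΨ.continuousOn.sub hΦ.continuousOn
  boundary P := by
    obtain ⟨h1, h2⟩ := hΨ.boundary P
    obtain ⟨h3, h4⟩ := hΦ.boundary P
    refine ⟨fun h ς => ?_, fun h ς => ?_⟩
    · simp only [Pi.sub_apply, h1 h, h3 h, mul_sub]
    · simp only [Pi.sub_apply, h2 h, h4 h, mul_sub]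

theorem IsSolution.isWave (hħ : 0 < ħ) (h : IsSolution ħ m θ₁ θ₂ Ψ₀ Ψ) : IsWave ħ m θ₁ θ₂ Ψ :=
  ⟨(nullEquations_iff hħ).2 ⟨h.differentiable, h.equation⟩, h.continuousOn, h.boundary⟩

namespace IsWave

theorem amplitude_eq_zero_of_initial (h : IsWave ħ m θ₁ θ₂ Ψ)
    (h0 : ∀ s ∈ halfSpace, Ψ (atTimeZero s) = 0) (R : ℝ) (k : Kind) (v : Bool) (x y z : ℝ)
    (hX : (x, y, z, (0 : ℝ), (0 : ℝ)) ∈ domain R k) :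
    amplitude θ₁ θ₂ Ψ k v (x, y, z, 0, 0) = 0 := by
  have hz : ∀ c₀ c₁ c₂, c₁ ≤ c₀ → c₀ ≤ c₂ → Ψ (ofNull v c₀ c₀ c₁ c₁ c₂ c₂) = 0 := by
    intro c₀ c₁ c₂ h1 h2
    rw [ofNull_self]
    exact h0 _ (mem_halfSpace.2 ⟨h1, h2⟩)
  rcases k with _ | _
  · rw [mem_domain_uniform] at hX
    rw [amplitude_uniform, add_zero, add_zero,
      h.apply_photon (o := none) (o₀ := z) (o₀' := y) (by simp)
        (by rw [ofNull_mem_closure_S1]; grind) (by rw [ofNull_mem_closure_S1]; grind),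
      hz y x z hX.1 hX.2.1, Pi.zero_apply]
  -- for the kind `mixed`, the rays of equal velocity are `x` and `y`
  · rw [mem_domain_mixed] at hX
    obtain ⟨hxy, -⟩ := hX
    rcases le_total z x with h1 | h1
    · rw [h.amplitude_mixed_ge_ge hxy (by linarith) (by linarith), sub_zero, add_zero,
        h.apply_photon (o := some 1) (o₀ := z) (o₀' := x) (by simp)
          (by rw [ofNull_mem_closure_S1]; grind) (by rw [ofNull_mem_closure_S1]; grind),
        hz x z y h1 hxy, Pi.zero_apply, mul_zero]
    · rcases le_total z y with h2 | h2
      · rw [amplitude_mixed_le_ge (by linarith) (by linarith), add_zero, add_zero,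
          h.apply_photon_minority (c₀ := x) (c₀' := z)
            (by rw [ofNull_mem_closure_S1]; grind) (by rw [ofNull_mem_closure_S1]; grind),
          hz z x y h1 h2, Pi.zero_apply, mul_zero]
      · rw [h.amplitude_mixed_le_le hxy (by linarith) (by linarith), sub_zero, add_zero,
          h.apply_photon (o := some 2) (o₀ := z) (o₀' := y) (by simp)
            (by rw [ofNull_mem_closure_S1]; grind) (by rw [ofNull_mem_closure_S1]; grind),
          hz y x z hxy h2, Pi.zero_apply, mul_zero]

theorem exists_norm_amplitude_le (h : IsWave ħ m θ₁ θ₂ Ψ) (R : ℝ) :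
    ∃ B, ∀ k v, ∀ X ∈ domain R k, ‖amplitude θ₁ θ₂ Ψ k v X‖ ≤ B := by
  obtain ⟨B, hB⟩ := ((isCompact_closedBall (0 : Config) R).inter_right
    isClosed_closure).exists_bound_of_continuousOn (h.continuousOn.mono inter_subset_right)
  have key : ∀ (v : Bool) (o : Option (Fin 3)) (c₀ o₀ c₁ o₁ c₂ o₂ : ℝ),
      ofNull v c₀ o₀ c₁ o₁ c₂ o₂ ∈ closure S1 → -R ≤ c₁ → -R ≤ o₁ → c₂ ≤ R → o₂ ≤ R →
      ‖Ψ (ofNull v c₀ o₀ c₁ o₁ c₂ o₂) (spin v o)‖ ≤ B := by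
    intro v o c₀ o₀ c₁ o₁ c₂ o₂ hP h1 h2 h3 h4
    refine (norm_le_pi_norm (Ψ (ofNull v c₀ o₀ c₁ o₁ c₂ o₂)) (spin v o)).trans (hB _ ⟨?_, hP⟩)
    rw [mem_closedBall_zero_iff]
    rw [ofNull_mem_closure_S1] at hP
    refine norm_le_of_abs_null_le (v := v) (fun j => ?_) fun j => ?_
    · rw [null_ofNull, abs_le]; fin_cases j <;> simp <;> grind
    · rw [null_not_ofNull, abs_le]; fin_cases j <;> simp <;> grind
  refine ⟨B, ?_⟩
  rintro (_ | _) v ⟨x, y, z, p, q⟩ hX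
  · rw [mem_domain_uniform] at hX
    rw [amplitude_uniform]
    refine key _ _ _ _ _ _ _ _ (by rw [ofNull_mem_closure_S1]; grind) ?_ ?_ ?_ ?_ <;> grind
  · rw [mem_domain_mixed] at hX
    rcases le_or_gt p (z - x) with hp | hp
    · rcases le_total (z - y) q with hq | hq
      · rw [amplitude_mixed_le_ge hp hq, norm_mul, norm_inv, norm_phase, inv_one, one_mul]
        refine key _ _ _ _ _ _ _ _ (by rw [ofNull_mem_closure_S1]; grind) ?_ ?_ ?_ ?_ <;> grind
      · rw [h.amplitude_mixed_le_le hX.1 hp hq, norm_mul, norm_inv, norm_phase, inv_one, one_mul]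
        refine key _ _ _ _ _ _ _ _ (by rw [ofNull_mem_closure_S1]; grind) ?_ ?_ ?_ ?_ <;> grind
    · have hq : z - y ≤ q := hX.2.1.resolve_left hp.not_ge
      rw [h.amplitude_mixed_ge_ge hX.1 hp.le hq, norm_mul, norm_inv, norm_phase, inv_one, one_mul]
      refine key _ _ _ _ _ _ _ _ (by rw [ofNull_mem_closure_S1]; grind) ?_ ?_ ?_ ?_ <;> grind

/-- A wave function that vanishes at time zero vanishes. -/
theorem eq_zero (h : IsWave ħ m θ₁ θ₂ Ψ) (hħ : 0 < ħ) (hm : 0 < m)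
    (h0 : ∀ s ∈ halfSpace, Ψ (atTimeZero s) = 0) {P : Config} (hP : P ∈ closure S1) : Ψ P = 0 := by
  set R := 2 * ‖P‖ with hR
  obtain ⟨B, hB⟩ := h.exists_norm_amplitude_le R
  have hz := fun {k : Kind} (v : Bool) {X} => h.solves_amplitude.eq_zero (k := k) (X := X)
    (bound_waveCoeffs hħ hm) (by positivity) (h.amplitude_eq_zero_of_initial h0 R) hB v
  have hn := fun v j => abs_le.1 (abs_null_le v P j)
  have hS := mem_closure_S1_iff.1 hP
  ext ς
  rw [← spin_majority_minority ς, ← h.component_amplitude hP, Pi.zero_apply]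
  generalize majority ς = v
  generalize minority ς = o
  have e1 : null v P 1 + gap v P 1 = null (!v) P 1 := by rw [gap]; ring
  have e2 : null v P 2 + gap v P 2 = null (!v) P 2 := by rw [gap]; ring
  obtain ⟨s1, s2⟩ := hS v
  obtain ⟨s3, s4⟩ := hS (!v)
  have a1 := hn v 1
  have a2 := hn v 2
  have a0 := hn v 0
  have b1 := hn (!v) 1
  have b2 := hn (!v) 2
  have b0 := hn (!v) 0
  rcases o with _ | j
  · rw [component]
    refine hz v ?_
    rw [mem_domain_uniform]; grind
  · fin_cases j
    all_goals
      refine mul_eq_zero_of_right _ (hz v ?_)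
      rw [mem_domain_mixed]; grind

theorem eqOn (hΨ : IsWave ħ m θ₁ θ₂ Ψ) (hΦ : IsWave ħ m θ₁ θ₂ Φ) (hħ : 0 < ħ) (hm : 0 < m)
    (h : ∀ s ∈ halfSpace, Ψ (atTimeZero s) = Φ (atTimeZero s)) : EqOn Ψ Φ (closure S1) :=
  fun _ hP => sub_eq_zero.1 <| (hΨ.sub hΦ).eq_zero hħ hm (fun s hs => sub_eq_zero.2 (h s hs)) hP

end IsWave

theorem IsSolution.eq_zero_of_notMem (h : IsSolution ħ m θ₁ θ₂ Ψ₀ Ψ) {P : Config}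
    (hP : P ∉ closure S1) : Ψ P = 0 := by
  by_contra hn
  exact hP (h.support_subset hn)

/-- The difference of two solutions is the solution for the difference of the data. -/
theorem IsSolution.sub_eq (hħ : 0 < ħ) (hm : 0 < m) (hΨ : IsSolution ħ m θ₁ θ₂ Ψ₀ Ψ)
    (hΦ : IsSolution ħ m θ₁ θ₂ Φ₀ Φ) {X : Config → Spinor}
    (hX : IsSolution ħ m θ₁ θ₂ (Ψ₀ - Φ₀) X) : Ψ - Φ = X := by
  ext1 P
  by_cases hP : P ∈ closure S1
  · refine ((hΨ.isWave hħ).sub (hΦ.isWave hħ)).eqOn (hX.isWave hħ) hħ hm (fun s hs => ?_) hP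
    have hs' := halfSpace_subset_initialSurface hs
    rw [Pi.sub_apply, hΨ.initial s hs', hΦ.initial s hs', hX.initial s hs', Pi.sub_apply]
  · rw [Pi.sub_apply, hΨ.eq_zero_of_notMem hP, hΦ.eq_zero_of_notMem hP, hX.eq_zero_of_notMem hP,
      sub_zero]

theorem IsSolution.unique (hħ : 0 < ħ) (hm : 0 < m) (hΨ : IsSolution ħ m θ₁ θ₂ Ψ₀ Ψ)
    (hΦ : IsSolution ħ m θ₁ θ₂ Ψ₀ Φ) : Φ = Ψ := by
  ext1 P
  by_cases hP : P ∈ closure S1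
  · refine (hΦ.isWave hħ).eqOn (hΨ.isWave hħ) hħ hm (fun s hs => ?_) hP
    have hs' := halfSpace_subset_initialSurface hs
    rw [hΨ.initial s hs', hΦ.initial s hs']
  · rw [hΨ.eq_zero_of_notMem hP, hΦ.eq_zero_of_notMem hP]

/-! ### Differentiability almost everywhere -/

theorem ae_differentiableAt_of_lipschitzOnWith
    (h : ∀ T : ℝ, ∃ K : ℝ≥0, LipschitzOnWith K Ψ (closure S1 ∩ timeSlab T)) :
    ∀ᵐ P : Config, P ∈ S1 → DifferentiableAt ℝ Ψ P := by
  have h1 : ∀ n : ℕ, ∀ᵐ P : Config, P ∈ closure S1 ∩ timeSlab n →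
      DifferentiableWithinAt ℝ Ψ (closure S1 ∩ timeSlab n) P := fun n => by
    obtain ⟨K, hK⟩ := h n
    exact hK.ae_differentiableWithinAt_of_mem
  filter_upwards [ae_all_iff.2 h1] with P hP hS
  obtain ⟨n, hn⟩ := exists_nat_gt ‖P‖
  have ho : closure S1 ∩ timeSlab n ∈ nhds P := by
    filter_upwards [isOpen_S1.mem_nhds hS, (isOpen_lt continuous_norm continuous_const).mem_nhds hn]
      with Q hQ hQn
    exact ⟨subset_closure hQ, fun j =>
      ((norm_le_pi_norm (Q j) 0).trans (norm_le_pi_norm Q j)).trans (le_of_lt hQn)⟩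
  exact (hP n (mem_of_mem_nhds ho)).differentiableAt ho

end ThreeBody

open ThreeBody
theorem mainTheorem2 (ħ m θ₁ θ₂ : ℝ) (hħ : 0 < ħ) (hm : 0 < m)
    (hθ₁ : θ₁ ∈ Set.Ico 0 (2 * Real.pi)) (hθ₂ : θ₂ ∈ Set.Ico 0 (2 * Real.pi)) :
    -- existence and uniqueness, and bounded derivatives
    (∀ Ψ₀ : Positions → Spinor, IsInitialData θ₁ θ₂ Ψ₀ →
      ∃ Ψ : Config → Spinor, IsSolution ħ m θ₁ θ₂ Ψ₀ Ψ ∧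
        (∀ T : ℝ, ∃ K : ℝ≥0, LipschitzOnWith K Ψ (closure S1 ∩ timeSlab T)) ∧
        (∀ᵐ p : Config, p ∈ S1 → DifferentiableAt ℝ Ψ p) ∧
        ∀ Φ : Config → Spinor, IsSolution ħ m θ₁ θ₂ Ψ₀ Φ → Φ = Ψ) ∧
    -- continuous dependence on the data, in the sup norm and for the first derivatives
    (∀ T : ℝ, ∃ C : ℝ≥0, ∀ (Ψ₀ Φ₀ : Positions → Spinor) (Ψ Φ : Config → Spinor),
      IsInitialData θ₁ θ₂ Ψ₀ → IsInitialData θ₁ θ₂ Φ₀ →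
      IsSolution ħ m θ₁ θ₂ Ψ₀ Ψ → IsSolution ħ m θ₁ θ₂ Φ₀ Φ →
      ∀ δ : ℝ≥0, (∀ s ∈ halfSpace, ‖Ψ₀ s - Φ₀ s‖ ≤ δ) →
        (∀ p ∈ timeSlab T, ‖Ψ p - Φ p‖ ≤ C * δ) ∧
        ((∀ s ∈ halfSpace, ‖fderivWithin ℝ (Ψ₀ - Φ₀) halfSpace s‖ ≤ δ) →
          LipschitzOnWith (C * δ) (Ψ - Φ) (closure S1 ∩ timeSlab T))) := by
  have hω : 0 < m / ħ := div_pos hm hħ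
  refine ⟨fun Ψ₀ h0 => ?_, fun T => ?_⟩
  · obtain ⟨M, hM⟩ := h0.exists_norm_le
    obtain ⟨L, hL0, hL⟩ := h0.exists_norm_fderivWithin_le
    obtain ⟨Ψ, hΨ, hb⟩ := exists_isSolution hħ hm h0 hL0 hM (h0.norm_sub_le_of_fderivWithin hL)
    have hlip : ∀ T : ℝ, ∃ K : ℝ≥0, LipschitzOnWith K Ψ (closure S1 ∩ timeSlab T) := by
      intro T
      refine ⟨(60 * (L + 24 * (m / ħ) * M) * Real.exp (24 * (m / ħ) * (4 * T))).toNNReal,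
        LipschitzOnWith.of_dist_le' fun P hP Q hQ => ?_⟩
      rw [dist_eq_norm, dist_eq_norm]
      exact (hb T).2 P hP Q hQ
    exact ⟨Ψ, hΨ, hlip, ae_differentiableAt_of_lipschitzOnWith hlip, fun Φ hΦ => hΨ.unique hħ hm hΦ⟩
  · set E := Real.exp (24 * (m / ħ) * (4 * T)) with hE
    have hE0 : 0 < E := Real.exp_pos _
    refine ⟨NNReal.mk (60 * (1 + 24 * (m / ħ)) * E) (by positivity),
      fun Ψ₀ Φ₀ Ψ Φ hΨ₀ hΦ₀ hΨ hΦ δ hδ => ⟨fun P hP => ?_, fun hδ' => ?_⟩⟩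
    · obtain ⟨L, hL0, hL⟩ := (hΨ₀.sub hΦ₀).exists_norm_fderivWithin_le
      obtain ⟨X, hX, hb⟩ := exists_isSolution hħ hm (hΨ₀.sub hΦ₀) hL0 hδ
        ((hΨ₀.sub hΦ₀).norm_sub_le_of_fderivWithin hL)
      have h1 := (hb T).1 P hP
      rw [← hΨ.sub_eq hħ hm hΦ hX] at h1
      refine h1.trans ?_
      rw [NNReal.coe_mk, ← hE]
      have h2 : 0 ≤ E * δ := by positivity
      have h3 : 0 ≤ m / ħ * (E * δ) := by positivity
      nlinarith
    · obtain ⟨X, hX, hb⟩ := exists_isSolution hħ hm (hΨ₀.sub hΦ₀) δ.2 hδ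
        ((hΨ₀.sub hΦ₀).norm_sub_le_of_fderivWithin hδ')
      rw [hΨ.sub_eq hħ hm hΦ hX]
      refine LipschitzOnWith.of_dist_le_mul fun P hP Q hQ => ?_
      rw [dist_eq_norm, dist_eq_norm]
      refine ((hb T).2 P hP Q hQ).trans (le_of_eq ?_)
      rw [NNReal.coe_mul, NNReal.coe_mk]
      simp only [NNReal.val_eq_coe]
      ring
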